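/- **Model.** Let $m\ge 1$ and let $S=[0,1)^m$ carry the torus metric $d(\cdot,\cdot)$ derived from a fixed norm on $\mathbb R^m$ (for instance the Euclidean norm); let $c_m$ be the volume of the unit ball of this norm. Divide $S$ into $\kappa^m$ equal half-open cubes (regions) $\mathcal R_\ell$, with densities $\rho_\ell\ge 0$ such that $\sum_\ell \rho_\ell\kappa^{-m}=1$. Let $A_1,A_2>0$ and $p\in(0,1)$ be such that $pA_1\max_\ell\rho_\ell<1$. The nodes $v_1,v_2,\dots$ are independent random points of $S$ whose density equals $\rho_\ell$ on $\mathcal R_\ell$. For a node $v$ already present at time $t\ge 1$, the sphere of influence $S(v,t)$ is the ball about $v$ of volume $(A_1\deg^-(v,t)+A_2)/t$ (all of $S$ if this number is at least $1$), where $\deg^-(v,t)$ is the in-degree of $v$ in $G_t$. $G_0$ is the null graph; $G_t$ arises from $G_{t-1}$ by adding $v_t$ and, independently for each node $u$ of $G_{t-1}$ with $v_t\in S(u,t-1)$, adding the directed link $(v_t,u)$ with probability $p$. Let $cn(u,v,n)$ be the number of common in-neighbours of $u$ and $v$ in $G_n$, and let $\delta(v)$ be the distance from $v$ to the boundary of the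 cube containing it. **Theorem.** Let $\varepsilon>0$. There is a constant $K$, depending only on the parameters of the model and on $\varepsilon$, such that for every function $\omega=\omega(n)$ tending to infinity there is a sequence $\eta(n)\to 0$ for which, with probability tending to $1$ as $n\to\infty$, the following holds for all pairs of distinct nodes $u,v$ of $G_n$ simultaneously. Let $k=\deg^-(u,n)$ and $j=\deg^-(v,n)$, suppose that $u$ and $v$ lie in the same region, let $\rho$ be its density, and suppose that $k\ge j\ge\omega^2\log n$. Put $$T_v=n\left(\frac{\omega\log n}{j}\right)^{\frac1{p\rho A_1}},\qquad c=(1+\varepsilon)\,\frac{A_1}{c_m\,n^{p\rho A_1}\,T_v^{1-p\rho A_1}},$$ suppose that $\delta(v)^m\ge cj$ and $\delta(u)^m\ge ck$, and let $d=d(u,v)$ and $$\mathrm{lo}=\left(\frac{A_1k+A_2}{c_mn}\right)^{1/m}-\left(\frac{A_1j+A_2}{c_mn}\right)^{1/m},\qquad \mathrm{hi}=\varepsilon\left(\frac{(\omega\log n)(k/j)}{T_v}\right)^{1/m}.$$ 1. If $d\ge \mathrm{hi}$, then $cn(u,v,n)\le K\,\omega\log n$. 2. If $d\le \mathrm{lo}$,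 then $|cn(u,v,n)-pj|\le\eta(n)\,pj$. 3. If $\mathrm{lo}<d<\mathrm{hi}$, and if $\varepsilon$ is so small that $c_m\varepsilon^m<(1+\varepsilon)A_1$ (equivalently, $\mathrm{hi}<(ck)^{1/m}$, the lower bound imposed on $\delta(u)$), then $$\bigl|cn(u,v,n)-F\bigr|\le\bigl(\eta(n)+K(j/k)^{1/m}\bigr)F,\qquad F=C\,j\,n^{-\alpha}k^{\alpha}d^{-m\alpha},$$ where $\alpha=\dfrac{p\rho A_1}{1-p\rho A_1}$ and $C=pA_1^{\alpha}c_m^{-\alpha}$. -/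

import Mathlib

open Filter Topology MeasureTheory

noncomputable section

/-- Parameters of the inhomogeneous spatial preferential attachment model on the torus `[0,1)^m`
divided into `κ ^ m` equal cubes.  The metric is the torus metric derived from an arbitrary norm
on `ℝ^m` (for instance the Euclidean one); `ρ ℓ` is the density of the cube with index `ℓ`. -/
structure SPAModel (m κ : ℕ) where
  /-- the norm on `ℝ^m` -/
  nrm : Seminorm ℝ (Fin m → ℝ)
  nrm_definite : ∀ x, nrm x = 0 → x = 0
  /-- the densities of the cubes -/
  ρ : (Fin m → Fin κ) → ℝ
  ρ_nonneg : ∀ ℓ, 0 ≤ ρ ℓ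
  ρ_total : ∑ ℓ, ρ ℓ * ((κ : ℝ) ^ m)⁻¹ = 1
  A₁ : ℝ
  A₂ : ℝ
  p : ℝ
  A₁_pos : 0 < A₁
  A₂_pos : 0 < A₂
  p_pos : 0 < p
  p_lt_one : p < 1
  subcritical : ∀ ℓ, p * A₁ * ρ ℓ < 1

namespace SPAModel

/-- The space `S = [0,1)^m`. -/
def unitCube (m : ℕ) : Set (Fin m → ℝ) := {x | ∀ i, 0 ≤ x i ∧ x i < 1}

/-- The region with index `ℓ`: the product of the intervals `[ℓ i / κ, (ℓ i + 1) / κ)`. -/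
def region {m κ : ℕ} (ℓ : Fin m → Fin κ) : Set (Fin m → ℝ) :=
  {x | ∀ i, ((ℓ i : ℕ) : ℝ) / κ ≤ x i ∧ x i < (((ℓ i : ℕ) : ℝ) + 1) / κ}

variable {m κ : ℕ} (M : SPAModel m κ)

/-- The torus distance derived from the norm. -/
def torusDist (x y : Fin m → ℝ) : ℝ :=
  ⨅ z : Fin m → ℤ, M.nrm (x - y + fun i => (z i : ℝ))

/-- The volume `c_m` of the unit ball of the norm. -/
def unitBallVolume : ℝ := volume.real {x : Fin m → ℝ | M.nrm x ≤ 1}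

/-- The ball of radius `r` about `x` in the torus. -/
def torusBall (x : Fin m → ℝ) (r : ℝ) : Set (Fin m → ℝ) :=
  {y ∈ unitCube m | M.torusDist x y ≤ r}

/-- The ball centred at `x` of volume `s`; it is the whole space if `s ≥ 1`. -/
def ballOfVolume (x : Fin m → ℝ) (s : ℝ) : Set (Fin m → ℝ) :=
  {y ∈ unitCube m |
    1 ≤ s ∨ y ∈ M.torusBall x (sInf {r : ℝ | 0 ≤ r ∧ s ≤ volume.real (M.torusBall x r)})}

/-- The distance from `x` to the boundary of the region with index `ℓ`. -/
def boundaryDist (ℓ : Fin m → Fin κ) (x : Fin m → ℝ) : ℝ :=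
  ⨅ b : frontier (region ℓ), M.torusDist x b

/-- The law of the position of a node: it has density `ρ ℓ` on the region with index `ℓ`. -/
def positionLaw : Measure (Fin m → ℝ) :=
  ∑ ℓ, ENNReal.ofReal (M.ρ ℓ) • volume.restrict (region ℓ)

/-- The law of a single biased coin, which shows `true` with probability `p`. -/
def coinLaw : Measure Bool :=
  ENNReal.ofReal M.p • Measure.dirac true + ENNReal.ofReal (1 - M.p) • Measure.dirac false

/-- The randomness of the model.  The `t`-th entry holds the position of `v_t` and, for each `i`,
the coin which decides whether `v_t` links to `v_i` in case `v_t` falls into the sphere of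
influence of `v_i`. -/
abbrev Outcome (m : ℕ) : Type := ℕ → (Fin m → ℝ) × (ℕ → Bool)

/-- All positions and all coins are independent. -/
def law : Measure (Outcome m) :=
  Measure.infinitePi fun _ : ℕ => M.positionLaw.prod (Measure.infinitePi fun _ : ℕ => M.coinLaw)

/-- The position of the node `v_t`. -/
def node (s : Outcome m) (t : ℕ) : Fin m → ℝ := (s t).1

/-- The number of edges of `E` that point to the node with index `i`. -/
def inDeg (E : Finset (ℕ × ℕ)) (i : ℕ) : ℕ := (E.filter fun e => e.2 = i).card

/-- The sphere of influence of `v_i` at time `t`, when the edge set is `E`. -/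
def influence (s : Outcome m) (E : Finset (ℕ × ℕ)) (i t : ℕ) : Set (Fin m → ℝ) :=
  M.ballOfVolume (node s i) ((M.A₁ * (inDeg E i : ℝ) + M.A₂) / t)

open Classical in
/-- The edge set of `G_t`, whose nodes are `v_1, …, v_t`; the pair `(a, b)` is the directed link
from `v_a` to `v_b`.  In the step from `G_t` to `G_{t+1}` the node `v_{t+1}` links to each of those
`v_i`, `1 ≤ i ≤ t`, whose sphere of influence at time `t` contains `v_{t+1}` and whose coin shows
`true`. -/
def edges (s : Outcome m) : ℕ → Finset (ℕ × ℕ)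
  | 0 => ∅
  | t + 1 => edges s t ∪
      ((Finset.Icc 1 t).filter fun i =>
        node s (t + 1) ∈ M.influence s (edges s t) i t ∧ (s (t + 1)).2 i = true).image
          fun i => (t + 1, i)

/-- The in-degree of `v_i` at time `t`. -/
def degIn (s : Outcome m) (i t : ℕ) : ℕ := inDeg (M.edges s t) i

/-- The number of common in-neighbours of `v_i` and `v_j` at time `t`. -/
def commonNbrs (s : Outcome m) (i j t : ℕ) : ℕ :=
  ((Finset.Icc 1 t).filter fun w => (w, i) ∈ M.edges s t ∧ (w, j) ∈ M.edges s t).card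

/-- Every region has volume `κ ^ (-m)`. -/
theorem volume_region (ℓ : Fin m → Fin κ) :
    volume (region ℓ) = ENNReal.ofReal (((κ : ℝ) ^ m)⁻¹) := by
  have h : region ℓ = Set.univ.pi fun i =>
      Set.Ico (((ℓ i : ℕ) : ℝ) / κ) ((((ℓ i : ℕ) : ℝ) + 1) / κ) := by
    ext x; simp [region, Set.mem_pi]
  have h2 : ∀ i, (((ℓ i : ℕ) : ℝ) + 1) / κ - ((ℓ i : ℕ) : ℝ) / κ = (κ : ℝ)⁻¹ := by
    intro i; rw [← sub_div]; simp
  rw [h, volume_pi_pi]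
  simp only [Real.volume_Ico, h2]
  rw [Finset.prod_const, Finset.card_univ, Fintype.card_fin, ← inv_pow,
    ENNReal.ofReal_pow (by positivity)]

instance : IsProbabilityMeasure M.positionLaw := by
  constructor
  simp only [positionLaw, Measure.coe_finsetSum, Finset.sum_apply, Measure.smul_apply,
    Measure.restrict_apply_univ, volume_region, smul_eq_mul]
  simp only [← ENNReal.ofReal_mul (M.ρ_nonneg _)]
  rw [← ENNReal.ofReal_sum_of_nonneg (fun ℓ _ => mul_nonneg (M.ρ_nonneg ℓ) (by positivity)),
    M.ρ_total, ENNReal.ofReal_one]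

instance : IsProbabilityMeasure M.coinLaw := by
  constructor
  simp only [coinLaw, Measure.add_apply, Measure.smul_apply, measure_univ, smul_eq_mul, mul_one]
  rw [← ENNReal.ofReal_add M.p_pos.le (by linarith [M.p_lt_one])]
  simp

instance : IsProbabilityMeasure M.law := by
  unfold law; infer_instance

end SPAModel

end

/-! Let D be the in-degree of a node shifted by A₂/A₁, so that its sphere of influence B at time t
has volume V = A₁D/t. The next node links to it with conditional probability pμ(B). Hence log D
grows at rate γ/t with γ = pA₁μ(B)/V, and log V falls at rate (1-γ)/t. While B lies inside a cube of
density ρ, γ is the constant a = pρA₁, so D grows like t^a and V shrinks like t^(-(1-a)).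
Subcriticality bounds γ by some g < 1 everywhere.

Probability enters only through one exponential bound. Products of factors (1+W)^{1_A} exp(-Wν(A))
with predictable W have mean at most one (`measure_le_exp_neg`), and a union bound covers all nodes,
pairs and time windows (`law_not_good_le`). Weights proportional to 1/D give concentration of log D,
constant weights give concentration of the number of common neighbours. The rest is deterministic,
on outcomes that are `Regular` for levels N ≪ w ≪ j, where w = ω log n.

The hypothesis on the distance to the boundary concerns only the final degrees. Its factor 1+ε
leaves room to extrapolate the power law back to a fixed fraction of T_v, and `GrowthPath.backward`
shows that the true path follows the extrapolation. From that time on (`NodePair`) both spheres are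
genuine balls inside the cube, with known radii whose ratio is about y = (j/k)^(1/m). Let e^L be the
time at which the sphere of u has radius d. Outside a window of logarithmic length O(y+η) about L,
the sphere of v is contained in that of u before e^L, and the two are disjoint afterwards. So the
common neighbours are, up to the factor p for the coin of u, the in-neighbours that v acquires
before e^L: about pG with G = j(e^L/n)^a, which is F. If d ≥ hi, then e^L is O(T_v) and v has only
O(w) in-neighbours by then. If d ≤ lo, containment persists essentially until time n and the count
is pj.

The delicate case is d just below hi. There G may be of order w, so the links received before the
power laws set in, when spheres may cross boundaries of cubes, are not negligible.
`exists_early_subset` shows that containment already holds from the time when v has degree ψw. The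
reason is that γ is Lipschitz in log V and depends on the centre only through d/V^(1/m), a quantity
that sums to a bounded total because V decreases. Both log volumes thus follow the same
one-dimensional flow up to a bounded error, and the integral of 1/(1-γ) between them is nearly
conserved (`exists_log_sphereVol_sub_le`). Spheres of comparable size at an early time would remain
comparable, contradicting k ≫ j. If k/j is bounded, the term K(j/k)^(1/m) absorbs a crude bound. -/

noncomputable section

/-! ### Torus distance and volumes of balls -/

namespace SPAModel

variable {m κ : ℕ}

/-- The representative of `y` modulo `ℤ^m` in the unit cube. -/
theorem exists_int_add_mem_unitCube (y : Fin m → ℝ) :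
    ∃ z : Fin m → ℤ, (y + fun i => (z i : ℝ)) ∈ unitCube m := by
  refine ⟨fun i => -⌊y i⌋, fun i => ?_⟩
  have h1 := Int.floor_le (y i)
  have h2 := Int.lt_floor_add_one (y i)
  simp only [Pi.add_apply, Int.cast_neg]
  constructor <;> linarith

theorem eq_zero_of_mem_unitCube {y : Fin m → ℝ} {z : Fin m → ℤ} (h : y ∈ unitCube m)
    (h' : (y + fun i => (z i : ℝ)) ∈ unitCube m) : z = 0 := by
  funext i
  have h1 := h i
  have h2 := h' i
  simp only [Pi.add_apply] at h2
  have h3 : (z i : ℝ) < 1 := by linarith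
  have h4 : (-1 : ℝ) < z i := by linarith
  have h5 : z i < 1 := by exact_mod_cast h3
  have h6 : -1 < z i := by exact_mod_cast h4
  simp only [Pi.zero_apply]
  omega

theorem measurableSet_unitCube : MeasurableSet (unitCube m) := by
  have : unitCube m = Set.univ.pi fun _ => Set.Ico (0 : ℝ) 1 := by
    ext x; simp [unitCube, Set.mem_pi]
  rw [this]
  exact MeasurableSet.univ_pi fun _ => measurableSet_Ico

theorem volume_unitCube : volume (unitCube m) = 1 := by
  have : unitCube m = Set.univ.pi fun _ => Set.Ico (0 : ℝ) 1 := by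
    ext x; simp [unitCube, Set.mem_pi]
  rw [this, volume_pi_pi]
  simp

/-- Folding a set into the unit cube modulo `ℤ^m` does not increase its volume. -/
theorem volume_fold_le {A : Set (Fin m → ℝ)} (hA : MeasurableSet A) :
    volume {y ∈ unitCube m | ∃ z : Fin m → ℤ, (y + fun i => (z i : ℝ)) ∈ A} ≤ volume A := by
  -- The pieces of `A` cut out by the integer translates of the cube. They are disjoint because the
  -- cube is a fundamental domain, so their translates back into the cube have total volume at most
  -- that of `A`.
  set T : (Fin m → ℤ) → Set (Fin m → ℝ) := fun z =>
    {w | w ∈ A ∧ (w - fun i => (z i : ℝ)) ∈ unitCube m} with hT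
  have hTm : ∀ z, MeasurableSet (T z) := fun z =>
    hA.inter (measurableSet_unitCube.preimage (measurable_id.sub_const _))
  have hTd : Pairwise (Function.onFun Disjoint T) := by
    intro z z' hz
    rw [Function.onFun, Set.disjoint_left]
    rintro w ⟨-, h1⟩ ⟨-, h2⟩
    apply hz
    have := eq_zero_of_mem_unitCube (z := z - z') h1 (by
      convert h2 using 1
      funext i
      simp)
    exact sub_eq_zero.mp this
  calc volume {y ∈ unitCube m | ∃ z : Fin m → ℤ, (y + fun i => (z i : ℝ)) ∈ A}
      ≤ volume (⋃ z : Fin m → ℤ, (fun y => y + fun i => (z i : ℝ)) ⁻¹' T z) := by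
        apply measure_mono
        rintro y ⟨hy, z, hz⟩
        refine Set.mem_iUnion.mpr ⟨z, hz, ?_⟩
        simpa using hy
    _ ≤ ∑' z : Fin m → ℤ, volume ((fun y => y + fun i => (z i : ℝ)) ⁻¹' T z) :=
        measure_iUnion_le _
    _ = ∑' z : Fin m → ℤ, volume (T z) := by
        congr 1; funext z
        exact measure_preimage_add_right _ _ _
    _ = volume (⋃ z, T z) := (measure_iUnion hTd hTm).symm
    _ ≤ volume A := by
        apply measure_mono
        intro w hw
        obtain ⟨z, hz⟩ := Set.mem_iUnion.mp hw
        exact hz.1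

variable (M : SPAModel m κ)

theorem bddBelow_torusDist (x y : Fin m → ℝ) :
    BddBelow (Set.range fun z : Fin m → ℤ => M.nrm (x - y + fun i => (z i : ℝ))) :=
  ⟨0, by rintro _ ⟨z, rfl⟩; exact apply_nonneg _ _⟩

theorem torusDist_le (x y : Fin m → ℝ) (z : Fin m → ℤ) :
    M.torusDist x y ≤ M.nrm (x - y + fun i => (z i : ℝ)) :=
  ciInf_le (M.bddBelow_torusDist x y) z

theorem torusDist_le_nrm (x y : Fin m → ℝ) : M.torusDist x y ≤ M.nrm (x - y) := by
  have h := M.torusDist_le x y 0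
  have h0 : (fun i : Fin m => (((0 : Fin m → ℤ) i : ℤ) : ℝ)) = 0 := by funext i; simp
  rwa [h0, add_zero] at h

theorem torusDist_nonneg (x y : Fin m → ℝ) : 0 ≤ M.torusDist x y :=
  le_ciInf fun _ => apply_nonneg _ _

theorem exists_of_torusDist_lt {x y : Fin m → ℝ} {r : ℝ} (h : M.torusDist x y < r) :
    ∃ z : Fin m → ℤ, M.nrm (x - y + fun i => (z i : ℝ)) < r :=
  exists_lt_of_ciInf_lt h

theorem torusDist_comm (x y : Fin m → ℝ) : M.torusDist x y = M.torusDist y x := by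
  suffices h : ∀ x y, M.torusDist x y ≤ M.torusDist y x from le_antisymm (h x y) (h y x)
  intro x y
  refine le_ciInf fun z => ?_
  refine (M.torusDist_le x y (-z)).trans_eq ?_
  rw [← map_neg_eq_map]
  congr 1
  funext i
  simp
  ring

theorem torusDist_triangle (x y w : Fin m → ℝ) :
    M.torusDist x w ≤ M.torusDist x y + M.torusDist y w := by
  refine le_of_forall_pos_lt_add fun η hη => ?_
  obtain ⟨z, hz⟩ := M.exists_of_torusDist_lt (lt_add_of_pos_right (M.torusDist x y) (half_pos hη))
  obtain ⟨z', hz'⟩ :=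
    M.exists_of_torusDist_lt (lt_add_of_pos_right (M.torusDist y w) (half_pos hη))
  have h := M.torusDist_le x w (z + z')
  have h2 : (x - w + fun i => (((z + z') i : ℤ) : ℝ)) =
      (x - y + fun i => (z i : ℝ)) + (y - w + fun i => (z' i : ℝ)) := by
    funext i; simp; ring
  rw [h2] at h
  have := map_add_le_add M.nrm (x - y + fun i => (z i : ℝ)) (y - w + fun i => (z' i : ℝ))
  linarith

/-- The norm is bounded by a multiple of the supremum norm. -/
theorem exists_nrm_le : ∃ C : ℝ, 1 ≤ C ∧ ∀ x, M.nrm x ≤ C * ‖x‖ := by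
  refine ⟨∑ i, M.nrm (Pi.single i 1) + 1, ?_, fun x => ?_⟩
  · linarith [Finset.sum_nonneg fun (i : Fin m) (_ : i ∈ Finset.univ) =>
      apply_nonneg M.nrm (Pi.single i (1 : ℝ))]
  · have hx : x = ∑ i, x i • (Pi.single i (1 : ℝ) : Fin m → ℝ) := by
      funext j
      simp [Finset.sum_apply, Pi.single_apply]
    have h1 : M.nrm x ≤ ∑ i, M.nrm (x i • (Pi.single i (1 : ℝ) : Fin m → ℝ)) := by
      conv_lhs => rw [hx]
      exact Finset.le_sum_of_subadditive M.nrm (map_zero _).le (map_add_le_add _) _ _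
    refine h1.trans ?_
    rw [add_mul, Finset.sum_mul, one_mul]
    refine le_add_of_le_of_nonneg (Finset.sum_le_sum fun i _ => ?_) (norm_nonneg _)
    rw [map_smul_eq_mul, mul_comm]
    exact mul_le_mul_of_nonneg_left (norm_le_pi_norm x i) (apply_nonneg _ _)

theorem continuous_nrm : Continuous M.nrm := by
  obtain ⟨C, hC, h⟩ := M.exists_nrm_le
  refine (LipschitzWith.of_dist_le_mul (K := ⟨C, by linarith⟩) fun x y => ?_).continuous
  rw [Real.dist_eq, dist_eq_norm]
  exact (abs_sub_map_le_sub M.nrm x y).trans (h _)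

/-- A multiple of the norm bounds the supremum norm. -/
theorem exists_le_nrm : ∃ c : ℝ, 0 < c ∧ ∀ x, c * ‖x‖ ≤ M.nrm x := by
  by_cases hne : (Metric.sphere (0 : Fin m → ℝ) 1).Nonempty
  · obtain ⟨x₀, hx₀, hmin⟩ := (isCompact_sphere (0 : Fin m → ℝ) 1).exists_isMinOn hne
      M.continuous_nrm.continuousOn
    have hx₀' : ‖x₀‖ = 1 := by simpa using hx₀
    refine ⟨M.nrm x₀, ?_, fun x => ?_⟩
    · refine lt_of_le_of_ne (apply_nonneg _ _) fun h => ?_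
      rw [M.nrm_definite x₀ h.symm, norm_zero] at hx₀'
      exact zero_ne_one hx₀'
    · by_cases hx : x = 0
      · simp [hx]
      · have hn : 0 < ‖x‖ := norm_pos_iff.mpr hx
        have h1 : (‖x‖⁻¹ • x) ∈ Metric.sphere (0 : Fin m → ℝ) 1 := by
          simp [norm_smul, hn.ne']
        have h2 := hmin h1
        simp only [Set.mem_ofPred_eq, map_smul_eq_mul, norm_inv, norm_norm] at h2
        calc M.nrm x₀ * ‖x‖ ≤ (‖x‖⁻¹ * M.nrm x) * ‖x‖ := by gcongr
          _ = M.nrm x := by field_simp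
  · refine ⟨1, one_pos, fun x => ?_⟩
    by_cases hx : x = 0
    · simp [hx]
    · exact absurd ⟨‖x‖⁻¹ • x, by simp [norm_smul, norm_ne_zero_iff.mpr hx]⟩ hne

theorem measurable_torusDist :
    Measurable fun q : (Fin m → ℝ) × (Fin m → ℝ) => M.torusDist q.1 q.2 := by
  unfold torusDist
  refine Measurable.iInf fun z => ?_
  exact M.continuous_nrm.measurable.comp
    ((measurable_fst.sub measurable_snd).add measurable_const)

theorem measurableSet_torusBall (x : Fin m → ℝ) (r : ℝ) : MeasurableSet (M.torusBall x r) :=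
  measurableSet_unitCube.inter
    (measurableSet_le (M.measurable_torusDist.comp measurable_prodMk_left) measurable_const)

theorem torusDist_eq_zero_sub (x y : Fin m → ℝ) : M.torusDist x y = M.torusDist 0 (y - x) := by
  unfold torusDist
  simp

theorem torusDist_add_int (x y : Fin m → ℝ) (z : Fin m → ℤ) :
    M.torusDist x (y + fun i => (z i : ℝ)) ≤ M.torusDist x y := by
  refine le_ciInf fun z' => ?_
  refine (M.torusDist_le _ _ (z' + z)).trans_eq ?_
  congr 1
  funext i
  simp
  ring

/-- The volume of the ball of radius `r` in the torus. -/
def ballVol (r : ℝ) : ℝ := volume.real (M.torusBall 0 r)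

/-- A translation carries one ball to the other modulo `ℤ^m`, and folding back into the cube cannot
increase volume. The inequality for arbitrary pairs of centres gives equality by symmetry. -/
theorem volume_torusBall (x : Fin m → ℝ) (r : ℝ) :
    volume (M.torusBall x r) = volume (M.torusBall 0 r) := by
  suffices h : ∀ x x', volume (M.torusBall x r) ≤ volume (M.torusBall x' r) from
    le_antisymm (h x 0) (h 0 x)
  intro x x'
  set A : Set (Fin m → ℝ) := (fun w => w + (x' - x)) ⁻¹' M.torusBall x' r with hA
  have hAm : MeasurableSet A :=
    (M.measurableSet_torusBall x' r).preimage (measurable_id.add_const _)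
  have hvol : volume A = volume (M.torusBall x' r) := measure_preimage_add_right _ _ _
  rw [← hvol]
  refine le_trans (measure_mono ?_) (volume_fold_le hAm)
  rintro y ⟨hy, hd⟩
  refine ⟨hy, ?_⟩
  obtain ⟨z, hz⟩ := exists_int_add_mem_unitCube (y + (x' - x))
  refine ⟨z, ?_⟩
  have h1 : (y + fun i => (z i : ℝ)) + (x' - x) = (y + (x' - x)) + fun i => (z i : ℝ) := by
    abel
  refine ⟨by show (y + fun i => (z i : ℝ)) + (x' - x) ∈ _; rw [h1]; exact hz, ?_⟩
  show M.torusDist x' ((y + fun i => (z i : ℝ)) + (x' - x)) ≤ r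
  rw [h1]
  refine (M.torusDist_add_int _ _ _).trans ?_
  rw [torusDist_eq_zero_sub] at hd ⊢
  rwa [show y + (x' - x) - x' = y - x by abel]

theorem volume_torusBall_le_one (x : Fin m → ℝ) (r : ℝ) : volume (M.torusBall x r) ≤ 1 := by
  rw [← volume_unitCube (m := m)]
  exact measure_mono fun y hy => hy.1

theorem volume_torusBall_ne_top (x : Fin m → ℝ) (r : ℝ) : volume (M.torusBall x r) ≠ ⊤ :=
  ((M.volume_torusBall_le_one x r).trans_lt ENNReal.one_lt_top).ne

theorem real_volume_torusBall (x : Fin m → ℝ) (r : ℝ) :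
    volume.real (M.torusBall x r) = M.ballVol r := by
  rw [ballVol, measureReal_def, measureReal_def, volume_torusBall]

theorem torusBall_subset {x : Fin m → ℝ} {y : Fin m → ℝ} {r r' : ℝ}
    (h : M.torusDist x y + r ≤ r') : M.torusBall y r ⊆ M.torusBall x r' := fun w hw =>
  ⟨hw.1, (M.torusDist_triangle x y w).trans (by linarith [hw.2])⟩

theorem ballVol_mono : Monotone M.ballVol := fun _ _ h =>
  measureReal_mono (fun _ hw => ⟨hw.1, hw.2.trans h⟩) (M.volume_torusBall_ne_top _ _)

theorem ballVol_nonneg (r : ℝ) : 0 ≤ M.ballVol r := measureReal_nonneg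

theorem ballVol_le_one (r : ℝ) : M.ballVol r ≤ 1 :=
  ENNReal.toReal_le_of_le_ofReal zero_le_one (by simpa using M.volume_torusBall_le_one 0 r)

theorem volume_nrm_ball_ne_top (x : Fin m → ℝ) (r : ℝ) : volume {w | M.nrm (w - x) ≤ r} ≠ ⊤ := by
  obtain ⟨c, hc, h⟩ := M.exists_le_nrm
  refine ne_top_of_le_ne_top (isCompact_closedBall x (r / c)).measure_lt_top.ne (measure_mono ?_)
  intro w hw
  rw [Metric.mem_closedBall, dist_eq_norm, le_div_iff₀ hc, mul_comm]
  exact (h _).trans hw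

theorem measurableSet_nrm_ball (x : Fin m → ℝ) (r : ℝ) : MeasurableSet {w | M.nrm (w - x) ≤ r} :=
  measurableSet_le (M.continuous_nrm.measurable.comp (measurable_id.sub_const _)) measurable_const

theorem unitBallVolume_pos : 0 < M.unitBallVolume := by
  obtain ⟨C, hC, h⟩ := M.exists_nrm_le
  have h0 : {x : Fin m → ℝ | M.nrm x ≤ 1} = {w | M.nrm (w - 0) ≤ 1} := by simp
  rw [unitBallVolume, h0]
  refine ENNReal.toReal_pos ?_ (M.volume_nrm_ball_ne_top 0 1)
  refine (lt_of_lt_of_le (Metric.measure_ball_pos volume (0 : Fin m → ℝ) (r := 1 / C)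
    (by positivity)) (measure_mono ?_)).ne'
  intro w hw
  rw [Metric.mem_ball, dist_zero_right, lt_div_iff₀ (by linarith)] at hw
  simp only [Set.mem_ofPred_eq, sub_zero]
  linarith [h w]

theorem real_volume_nrm_ball (x : Fin m → ℝ) {r : ℝ} (hr : 0 < r) :
    volume.real {w | M.nrm (w - x) ≤ r} = M.unitBallVolume * r ^ m := by
  have h1 : {w | M.nrm (w - x) ≤ r} = (fun w => w + -x) ⁻¹' ((fun w => r • w) '' {w | M.nrm w ≤ 1}) := by
    ext w
    simp only [Set.mem_preimage, Set.mem_image, Set.mem_ofPred_eq, ← sub_eq_add_neg]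
    constructor
    · intro h
      refine ⟨r⁻¹ • (w - x), ?_, smul_inv_smul₀ hr.ne' _⟩
      rw [map_smul_eq_mul, norm_inv, Real.norm_eq_abs, abs_of_pos hr, inv_mul_le_iff₀ hr, mul_one]
      exact h
    · rintro ⟨v, hv, hvw⟩
      rw [← hvw, map_smul_eq_mul, Real.norm_eq_abs, abs_of_pos hr]
      exact mul_le_of_le_one_right hr.le hv
  rw [measureReal_def, h1, measure_preimage_add_right, Set.image_smul, Measure.addHaar_smul,
    ENNReal.toReal_mul,
    unitBallVolume, measureReal_def]
  simp only [Module.finrank_fintype_fun_eq_card, Fintype.card_fin]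
  rw [ENNReal.toReal_ofReal (abs_nonneg _), abs_of_pos (pow_pos hr m), mul_comm]

/-- The torus ball is a folded copy of the norm ball. The argument runs with a radius `r' > r`,
where the infimum defining the distance has a witness, and lets `r'` decrease to `r`. -/
theorem ballVol_le {r : ℝ} (hr : 0 ≤ r) : M.ballVol r ≤ M.unitBallVolume * r ^ m := by
  have key : ∀ r' > r, M.ballVol r ≤ M.unitBallVolume * r' ^ m := by
    intro r' hr'
    rw [← M.real_volume_nrm_ball 0 (hr.trans_lt hr')]
    refine ENNReal.toReal_mono (M.volume_nrm_ball_ne_top 0 r') (le_trans (measure_mono ?_)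
      (volume_fold_le (M.measurableSet_nrm_ball 0 r')))
    rintro y ⟨hy, hd⟩
    obtain ⟨z, hz⟩ := M.exists_of_torusDist_lt (hd.trans_lt hr')
    refine ⟨hy, -z, ?_⟩
    simp only [Set.mem_ofPred_eq, sub_zero]
    refine le_of_eq_of_le ?_ hz.le
    rw [← map_neg_eq_map]
    congr 1
    funext i
    simp
    ring
  refine ge_of_tendsto (x := 𝓝[>] r) (f := fun r' => M.unitBallVolume * r' ^ m) ?_
    (eventually_of_mem self_mem_nhdsWithin key)
  exact (((continuous_const.mul (continuous_pow m)).tendsto r).mono_left nhdsWithin_le_nhds)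

/-- A torus shell is covered by the folded norm shell: a point at torus distance more than `r` has
no representative of norm at most `r`. -/
theorem ballVol_sub_le {r r' : ℝ} (hr : 0 < r) (h : r ≤ r') :
    M.ballVol r' - M.ballVol r ≤ M.unitBallVolume * (r' ^ m - r ^ m) := by
  have key : ∀ s > r', M.ballVol r' - M.ballVol r ≤ M.unitBallVolume * (s ^ m - r ^ m) := by
    intro s hs
    set A : Set (Fin m → ℝ) := {w | M.nrm (w - 0) ≤ s} \ {w | M.nrm (w - 0) ≤ r} with hA
    have hAm : MeasurableSet A := (M.measurableSet_nrm_ball 0 s).diff (M.measurableSet_nrm_ball 0 r)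
    have hAv : volume.real A = M.unitBallVolume * (s ^ m - r ^ m) := by
      rw [hA, measureReal_sdiff
        (show {w | M.nrm (w - 0) ≤ r} ⊆ {w | M.nrm (w - 0) ≤ s} from
          fun w hw => le_trans hw (h.trans hs.le))
        (M.measurableSet_nrm_ball 0 r) (M.volume_nrm_ball_ne_top 0 s),
        M.real_volume_nrm_ball 0 hr, M.real_volume_nrm_ball 0 (by linarith)]
      ring
    have hd : M.ballVol r' - M.ballVol r = volume.real (M.torusBall 0 r' \ M.torusBall 0 r) := by
      rw [measureReal_sdiff (show M.torusBall 0 r ⊆ M.torusBall 0 r' from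
        fun w hw => ⟨hw.1, hw.2.trans h⟩) (M.measurableSet_torusBall 0 r)
        (M.volume_torusBall_ne_top 0 r')]
      rfl
    rw [hd, ← hAv]
    refine ENNReal.toReal_mono (ne_top_of_le_ne_top (M.volume_nrm_ball_ne_top 0 s)
      (measure_mono Set.sdiff_subset)) (le_trans (measure_mono ?_) (volume_fold_le hAm))
    rintro y ⟨⟨hy, hd1⟩, hd2⟩
    have hd3 : r < M.torusDist 0 y := by
      by_contra hcon
      exact hd2 ⟨hy, not_lt.mp hcon⟩
    obtain ⟨z, hz⟩ := M.exists_of_torusDist_lt (hd1.trans_lt hs)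
    have he : M.nrm ((y + fun i => ((-z) i : ℝ)) - 0) = M.nrm (0 - y + fun i => (z i : ℝ)) := by
      rw [← map_neg_eq_map]
      congr 1
      funext i
      simp
      ring
    have he' := M.torusDist_le 0 y z
    exact ⟨hy, -z, by
      show M.nrm _ ≤ s
      simp only [Pi.neg_apply, Int.cast_neg, sub_zero] at he ⊢
      linarith, by
      show ¬ (M.nrm _ ≤ r)
      simp only [Pi.neg_apply, Int.cast_neg, sub_zero] at he ⊢
      linarith⟩
  refine ge_of_tendsto (x := 𝓝[>] r') (f := fun s => M.unitBallVolume * (s ^ m - r ^ m)) ?_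
    (eventually_of_mem self_mem_nhdsWithin key)
  exact (((continuous_const.mul ((continuous_pow m).sub continuous_const)).tendsto r').mono_left
    nhdsWithin_le_nhds)

end SPAModel

/-! ### Radii, cubes and the law of a position -/

namespace SPAModel

variable {m κ : ℕ} (M : SPAModel m κ)

theorem ballVol_zero (hm : 0 < m) : M.ballVol 0 = 0 :=
  le_antisymm (by simpa [hm.ne'] using M.ballVol_le le_rfl) (M.ballVol_nonneg 0)

theorem ballVol_sub_le' (hm : 0 < m) {r r' : ℝ} (hr : 0 ≤ r) (h : r ≤ r') :
    M.ballVol r' - M.ballVol r ≤ M.unitBallVolume * (r' ^ m - r ^ m) := by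
  rcases hr.eq_or_lt with rfl | hr
  · rw [M.ballVol_zero hm, sub_zero, zero_pow hm.ne', sub_zero]
    exact M.ballVol_le h
  · exact M.ballVol_sub_le hr h

/-- Increments of the volume are dominated by those of the continuous function `c_m r^m`. -/
theorem continuousOn_ballVol (hm : 0 < m) : ContinuousOn M.ballVol (Set.Ici 0) := by
  intro a ha
  have hc : Continuous fun r : ℝ => M.unitBallVolume * r ^ m :=
    continuous_const.mul (continuous_pow m)
  have h0 := ((tendsto_iff_dist_tendsto_zero).mp (hc.tendsto a)).mono_left
    (nhdsWithin_le_nhds (s := Set.Ici 0))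
  refine (tendsto_iff_dist_tendsto_zero).mpr (squeeze_zero' (Eventually.of_forall fun _ =>
    dist_nonneg) (eventually_of_mem self_mem_nhdsWithin fun r hr => ?_) h0)
  rw [Real.dist_eq, Real.dist_eq]
  rcases le_total a r with h | h
  · have h1 := M.ballVol_sub_le' hm ha h
    have h2 := M.ballVol_mono h
    rw [abs_of_nonneg (by linarith)]
    exact le_trans (by linarith) (le_abs_self _)
  · have h1 := M.ballVol_sub_le' hm hr h
    have h2 := M.ballVol_mono h
    rw [abs_of_nonpos (by linarith)]
    exact le_trans (by linarith) (neg_le_abs _)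

/-- A cube of side `h` about a point of an interval of length at least `2 * h` meets the interval in
length at least `h`, in each coordinate. -/
theorem le_volume_inter_box {lo len : Fin m → ℝ} {x : Fin m → ℝ} {h : ℝ} (hh : 0 ≤ h)
    (hlen : ∀ i, 2 * h ≤ len i) (hx : ∀ i, lo i ≤ x i ∧ x i < lo i + len i) :
    ENNReal.ofReal (h ^ m) ≤
      volume {y : Fin m → ℝ | (∀ i, lo i ≤ y i ∧ y i < lo i + len i) ∧ ∀ i, |y i - x i| ≤ h} := by
  -- In each coordinate the interval of length `h` starting or ending at `x i` is placed on the side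
  -- of the longer half.
  set a : Fin m → ℝ := fun i => if x i < lo i + len i / 2 then x i else x i - h with ha
  have hsub : (Set.univ.pi fun i => Set.Ico (a i) (a i + h)) ⊆
      {y : Fin m → ℝ | (∀ i, lo i ≤ y i ∧ y i < lo i + len i) ∧ ∀ i, |y i - x i| ≤ h} := by
    intro y hy
    have key : ∀ i, (lo i ≤ y i ∧ y i < lo i + len i) ∧ |y i - x i| ≤ h := by
      intro i
      have h1 := hy i (Set.mem_univ i)
      have h2 := hlen i
      have h3 := hx i
      rw [Set.mem_Ico] at h1
      rw [abs_le]
      by_cases hc : x i < lo i + len i / 2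
      · have h4 : a i = x i := by simp [ha, hc]
        rw [h4] at h1
        refine ⟨⟨by linarith, by linarith⟩, by linarith, by linarith⟩
      · have h4 : a i = x i - h := by simp [ha, hc]
        rw [h4] at h1
        rw [not_lt] at hc
        refine ⟨⟨by linarith, by linarith⟩, by linarith, by linarith⟩
    exact ⟨fun i => (key i).1, fun i => (key i).2⟩
  refine le_trans (le_of_eq ?_) (measure_mono hsub)
  rw [volume_pi_pi]
  simp [ENNReal.ofReal_pow hh]

theorem κ_pos (M : SPAModel m κ) (hm : 0 < m) : 0 < κ := by
  rcases Nat.eq_zero_or_pos κ with h | h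
  · exfalso
    have h1 := M.ρ_total
    have : IsEmpty (Fin m → Fin κ) := ⟨fun f => by have := (f ⟨0, hm⟩).2; omega⟩
    simp at h1
  · exact h

theorem region_subset_unitCube (ℓ : Fin m → Fin κ) : region ℓ ⊆ unitCube m := by
  intro x hx i
  have h1 := hx i
  have hκ : (0 : ℝ) < κ := by
    have := (ℓ i).2
    exact_mod_cast (by omega : 0 < κ)
  refine ⟨le_trans (by positivity) h1.1, h1.2.trans_le ?_⟩
  rw [div_le_one hκ]
  exact_mod_cast (ℓ i).2

theorem measurableSet_region (ℓ : Fin m → Fin κ) : MeasurableSet (region ℓ) := by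
  have h : region ℓ = Set.univ.pi fun i =>
      Set.Ico (((ℓ i : ℕ) : ℝ) / κ) ((((ℓ i : ℕ) : ℝ) + 1) / κ) := by
    ext x; simp [region, Set.mem_pi]
  rw [h]
  exact MeasurableSet.univ_pi fun _ => measurableSet_Ico

/-- Balls about a point of a region meet the region in a positive fraction of their volume. -/
theorem exists_le_volume_torusBall_inter_region (hm : 0 < m) : ∃ C : ℝ, 1 ≤ C ∧
    ∀ (ℓ : Fin m → Fin κ) (x : Fin m → ℝ), x ∈ region ℓ → ∀ r : ℝ, 0 ≤ r → r ≤ 1 →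
      (r / C) ^ m ≤ volume.real (M.torusBall x r ∩ region ℓ) := by
  obtain ⟨C, hC, hN⟩ := M.exists_nrm_le
  have hκ : (1 : ℝ) ≤ κ := by exact_mod_cast M.κ_pos hm
  have hC2 : 1 ≤ 2 * C * κ := by nlinarith
  -- Boxes of half-width `r / (2Cκ)` are small enough both to have norm radius at most `r` and to
  -- satisfy the requirement that the cube's side `1/κ` be at least twice that width.
  refine ⟨2 * C * κ, hC2, fun ℓ x hx r hr hr1 => ?_⟩
  have hfin : volume (M.torusBall x r ∩ region ℓ) ≠ ⊤ :=
    ne_top_of_le_ne_top (M.volume_torusBall_ne_top x r) (measure_mono Set.inter_subset_left)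
  rw [measureReal_def, ← ENNReal.ofReal_le_iff_le_toReal hfin]
  have hrC : r / (2 * C * κ) * C ≤ r := by
    rw [div_mul_eq_mul_div, div_le_iff₀ (by linarith)]
    nlinarith [mul_nonneg hr (by linarith : (0:ℝ) ≤ C), mul_nonneg (mul_nonneg hr (by linarith : (0:ℝ) ≤ C)) (by linarith : (0:ℝ) ≤ κ - 1)]
  refine (le_volume_inter_box (lo := fun i => ((ℓ i : ℕ) : ℝ) / κ) (len := fun _ => 1 / (κ : ℝ))
    (x := x) (h := r / (2 * C * κ)) (by positivity) (fun i => ?_) (fun i => ?_)).trans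
    (measure_mono ?_)
  · rw [show 2 * (r / (2 * C * κ)) = (r / C) * (1 / κ) by field_simp]
    exact mul_le_of_le_one_left (by positivity) ((div_le_one (by linarith)).mpr (by linarith))
  · have := hx i
    rwa [add_div] at this
  · rintro y ⟨hy1, hy2⟩
    have hyr : y ∈ region ℓ := by
      intro i
      have := hy1 i
      rwa [← add_div] at this
    refine ⟨⟨region_subset_unitCube ℓ hyr, ?_⟩, hyr⟩
    refine (M.torusDist_le_nrm x y).trans ((hN _).trans ?_)
    have : ‖x - y‖ ≤ r / (2 * C * κ) := by
      rw [pi_norm_le_iff_of_nonneg (by positivity)]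
      intro i
      rw [Pi.sub_apply, Real.norm_eq_abs, abs_sub_comm]
      exact hy2 i
    nlinarith

theorem exists_mem_region (M : SPAModel m κ) (hm : 0 < m) : ∃ (ℓ : Fin m → Fin κ) (x : Fin m → ℝ), x ∈ region ℓ := by
  have hκ := M.κ_pos hm
  refine ⟨fun _ => ⟨0, hκ⟩, 0, fun i => ?_⟩
  have : (0 : ℝ) < κ := by exact_mod_cast hκ
  simp [this]

theorem exists_ballVol_eq_one : ∃ C : ℝ, 1 ≤ C ∧ ∀ r, C ≤ r → M.ballVol r = 1 := by
  obtain ⟨C, hC, hN⟩ := M.exists_nrm_le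
  refine ⟨C, hC, fun r hr => ?_⟩
  have : M.torusBall 0 r = unitCube m := by
    refine Set.Subset.antisymm (fun y hy => hy.1) fun y hy => ⟨hy, ?_⟩
    refine (M.torusDist_le_nrm 0 y).trans ((hN _).trans (le_trans ?_ hr))
    refine mul_le_of_le_one_right (by linarith) ?_
    rw [zero_sub, norm_neg, pi_norm_le_iff_of_nonneg zero_le_one]
    intro i
    rw [Real.norm_eq_abs, abs_of_nonneg (hy i).1]
    exact (hy i).2.le
  rw [ballVol, this, measureReal_def, volume_unitCube, ENNReal.toReal_one]

/-- Lower bound for the volume of balls. -/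
theorem exists_le_ballVol (hm : 0 < m) : ∃ c : ℝ, 0 < c ∧
    ∀ r, 0 ≤ r → M.ballVol r < 1 → c * r ^ m ≤ M.ballVol r := by
  obtain ⟨C, hC, h⟩ := M.exists_le_volume_torusBall_inter_region hm
  obtain ⟨C', hC', h'⟩ := M.exists_ballVol_eq_one
  obtain ⟨ℓ, x, hx⟩ := M.exists_mem_region hm
  refine ⟨1 / (C * C') ^ m, by positivity, fun r hr hr1 => ?_⟩
  have hrC : r ≤ C' := by
    by_contra hcon
    exact hr1.ne (h' r (not_le.mp hcon).le)
  have h0 : 0 ≤ r / C' := by positivity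
  have h1 : r / C' ≤ 1 := (div_le_one (by linarith)).mpr hrC
  have h2 := h ℓ x hx (r / C') h0 h1
  calc 1 / (C * C') ^ m * r ^ m = (r / C' / C) ^ m := by
        rw [div_div, div_pow, mul_comm C' C]; ring
    _ ≤ _ := h2
    _ ≤ volume.real (M.torusBall x (r / C')) :=
        measureReal_mono Set.inter_subset_left (M.volume_torusBall_ne_top _ _)
    _ = M.ballVol (r / C') := M.real_volume_torusBall _ _
    _ ≤ M.ballVol r := M.ballVol_mono (div_le_self hr hC')

/-- The radius of the balls of volume `s`. -/
def radius (s : ℝ) : ℝ := sInf {r : ℝ | 0 ≤ r ∧ s ≤ M.ballVol r}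

theorem radius_nonneg (s : ℝ) : 0 ≤ M.radius s := Real.sInf_nonneg fun _ hr => hr.1

theorem radius_le {r s : ℝ} (hr : 0 ≤ r) (h : s ≤ M.ballVol r) : M.radius s ≤ r :=
  csInf_le ⟨0, fun _ hr => hr.1⟩ ⟨hr, h⟩

/-- The intermediate value theorem supplies some radius of volume `s`, which bounds the infimum from
above; continuity from the right shows that the infimum itself still has volume at least `s`. -/
theorem ballVol_radius (hm : 0 < m) {s : ℝ} (hs : 0 ≤ s) (hs1 : s ≤ 1) :
    M.ballVol (M.radius s) = s := by
  obtain ⟨C, hC, hC1⟩ := M.exists_ballVol_eq_one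
  have hC0 : (0 : ℝ) ≤ C := by linarith
  have hmem : s ∈ Set.Icc (M.ballVol 0) (M.ballVol C) := by
    rw [M.ballVol_zero hm, hC1 C le_rfl]
    exact ⟨hs, hs1⟩
  obtain ⟨r₀, hr₀, hr₀s⟩ := intermediate_value_Icc hC0
    ((M.continuousOn_ballVol hm).mono fun r hr => hr.1) hmem
  refine le_antisymm ((M.ballVol_mono (M.radius_le hr₀.1 hr₀s.ge)).trans_eq hr₀s) ?_
  have hcont : Tendsto M.ballVol (𝓝[>] M.radius s) (𝓝 (M.ballVol (M.radius s))) :=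
    ((M.continuousOn_ballVol hm) _ (M.radius_nonneg s)).mono_left
      (nhdsWithin_mono _ fun r hr => le_trans (M.radius_nonneg s) (le_of_lt hr))
  refine ge_of_tendsto hcont (eventually_of_mem self_mem_nhdsWithin fun r hr => ?_)
  obtain ⟨r', hr', hlt⟩ := exists_lt_of_csInf_lt
    (⟨r₀, hr₀.1, hr₀s.ge⟩ : {r : ℝ | 0 ≤ r ∧ s ≤ M.ballVol r}.Nonempty) hr
  exact hr'.2.trans (M.ballVol_mono hlt.le)

theorem le_mul_radius_pow (hm : 0 < m) {s : ℝ} (hs : 0 ≤ s) (hs1 : s ≤ 1) :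
    s ≤ M.unitBallVolume * M.radius s ^ m := by
  conv_lhs => rw [← M.ballVol_radius hm hs hs1]
  exact M.ballVol_le (M.radius_nonneg s)

theorem ballOfVolume_of_one_le {x : Fin m → ℝ} {s : ℝ} (h : 1 ≤ s) :
    M.ballOfVolume x s = unitCube m := by
  ext y; simp [ballOfVolume, h]

theorem ballOfVolume_of_lt_one {x : Fin m → ℝ} {s : ℝ} (h : s < 1) :
    M.ballOfVolume x s = M.torusBall x (M.radius s) := by
  ext y
  simp only [ballOfVolume, real_volume_torusBall, Set.mem_ofPred_eq, not_le.mpr h, false_or]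
  exact ⟨fun h => h.2, fun h => ⟨h.1, h⟩⟩

theorem ballOfVolume_subset_unitCube {x : Fin m → ℝ} {s : ℝ} :
    M.ballOfVolume x s ⊆ unitCube m := fun _ hy => hy.1

theorem volume_ballOfVolume_ne_top (x : Fin m → ℝ) (s : ℝ) :
    volume (M.ballOfVolume x s) ≠ ⊤ :=
  ne_top_of_le_ne_top (by rw [volume_unitCube]; exact ENNReal.one_ne_top)
    (measure_mono M.ballOfVolume_subset_unitCube)

theorem measurableSet_ballOfVolume (x : Fin m → ℝ) (s : ℝ) :
    MeasurableSet (M.ballOfVolume x s) := by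
  rcases le_or_gt 1 s with h | h
  · rw [M.ballOfVolume_of_one_le h]; exact measurableSet_unitCube
  · rw [M.ballOfVolume_of_lt_one h]; exact M.measurableSet_torusBall _ _

theorem measurableSet_mem_ballOfVolume (s : ℝ) :
    MeasurableSet {q : (Fin m → ℝ) × (Fin m → ℝ) | q.2 ∈ M.ballOfVolume q.1 s} := by
  rcases le_or_gt 1 s with h | h
  · simp only [M.ballOfVolume_of_one_le h]
    exact measurableSet_unitCube.preimage measurable_snd
  · simp only [M.ballOfVolume_of_lt_one h]
    exact (measurableSet_unitCube.preimage measurable_snd).inter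
      (measurableSet_le M.measurable_torusDist measurable_const)

theorem real_volume_ballOfVolume (hm : 0 < m) (x : Fin m → ℝ) {s : ℝ} (hs : 0 ≤ s) :
    volume.real (M.ballOfVolume x s) = min s 1 := by
  rcases le_or_gt 1 s with h | h
  · rw [M.ballOfVolume_of_one_le h, measureReal_def, volume_unitCube, min_eq_right h,
      ENNReal.toReal_one]
  · rw [M.ballOfVolume_of_lt_one h, real_volume_torusBall, M.ballVol_radius hm hs h.le,
      min_eq_left h.le]

theorem radius_mono (hm : 0 < m) {s s' : ℝ} (hs : 0 ≤ s') (h : s ≤ s') (h1 : s' ≤ 1) :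
    M.radius s ≤ M.radius s' :=
  M.radius_le (M.radius_nonneg s') (by rwa [M.ballVol_radius hm hs h1])

theorem ballOfVolume_mono (hm : 0 < m) (x : Fin m → ℝ) {s s' : ℝ} (hs : 0 ≤ s) (h : s ≤ s') :
    M.ballOfVolume x s ⊆ M.ballOfVolume x s' := by
  rcases le_or_gt 1 s' with h1 | h1
  · rw [M.ballOfVolume_of_one_le h1]; exact M.ballOfVolume_subset_unitCube
  · rw [M.ballOfVolume_of_lt_one h1, M.ballOfVolume_of_lt_one (h.trans_lt h1)]
    exact fun y hy => ⟨hy.1, hy.2.trans (M.radius_mono hm (hs.trans h) h h1.le)⟩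

theorem pairwise_disjoint_region :
    Pairwise (Function.onFun Disjoint (region : (Fin m → Fin κ) → Set (Fin m → ℝ))) := by
  intro ℓ ℓ' hne
  rw [Function.onFun, Set.disjoint_left]
  intro x hx hx'
  apply hne
  funext i
  have h1 := hx i
  have h2 := hx' i
  have hκ : (0 : ℝ) < κ := by
    have := (ℓ i).2
    exact_mod_cast (by omega : 0 < κ)
  rw [div_le_iff₀ hκ, lt_div_iff₀ hκ] at h1 h2
  have h3 : ((ℓ i : ℕ) : ℝ) < (ℓ' i : ℕ) + 1 := by linarith
  have h4 : ((ℓ' i : ℕ) : ℝ) < (ℓ i : ℕ) + 1 := by linarith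
  have h5 : (ℓ i : ℕ) < (ℓ' i : ℕ) + 1 := by exact_mod_cast h3
  have h6 : (ℓ' i : ℕ) < (ℓ i : ℕ) + 1 := by exact_mod_cast h4
  exact Fin.ext (by omega)

/-- A bound for the densities that respects subcriticality. -/
theorem exists_density_bound : ∃ R : ℝ, 0 < R ∧ M.p * M.A₁ * R < 1 ∧ ∀ ℓ, M.ρ ℓ ≤ R := by
  have hne : Nonempty (Fin m → Fin κ) := by
    by_contra h
    rw [not_nonempty_iff] at h
    have := M.ρ_total
    simp at this
  obtain ⟨ℓ₀, h₀⟩ := Finite.exists_max M.ρ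
  refine ⟨M.ρ ℓ₀, ?_, M.subcritical ℓ₀, h₀⟩
  by_contra h
  have hz : ∀ ℓ, M.ρ ℓ = 0 := fun ℓ => le_antisymm ((h₀ ℓ).trans (not_lt.mp h)) (M.ρ_nonneg ℓ)
  have := M.ρ_total
  simp [hz] at this

theorem real_positionLaw (B : Set (Fin m → ℝ)) (hB : MeasurableSet B) :
    M.positionLaw.real B = ∑ ℓ, M.ρ ℓ * volume.real (B ∩ region ℓ) := by
  rw [measureReal_def, positionLaw]
  simp only [Measure.coe_finsetSum, Finset.sum_apply, Measure.smul_apply, smul_eq_mul]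
  rw [ENNReal.toReal_sum]
  · refine Finset.sum_congr rfl fun ℓ _ => ?_
    rw [ENNReal.toReal_mul, ENNReal.toReal_ofReal (M.ρ_nonneg ℓ), Measure.restrict_apply hB,
      measureReal_def]
  · intro ℓ _
    refine ENNReal.mul_ne_top ENNReal.ofReal_ne_top ?_
    rw [Measure.restrict_apply hB]
    exact ne_top_of_le_ne_top (by rw [volume_region]; exact ENNReal.ofReal_ne_top)
      (measure_mono Set.inter_subset_right)

theorem real_positionLaw_le {R : ℝ} (hR : ∀ ℓ, M.ρ ℓ ≤ R) {B : Set (Fin m → ℝ)}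
    (hB : MeasurableSet B) (hfin : volume B ≠ ⊤) : M.positionLaw.real B ≤ R * volume.real B := by
  have hR0 : 0 ≤ R ∨ IsEmpty (Fin m → Fin κ) := by
    rcases isEmpty_or_nonempty (Fin m → Fin κ) with h | ⟨⟨ℓ⟩⟩
    · exact Or.inr h
    · exact Or.inl ((M.ρ_nonneg ℓ).trans (hR ℓ))
  rcases hR0 with hR0 | hemp
  swap
  · have := M.ρ_total
    simp at this
  rw [M.real_positionLaw B hB]
  calc ∑ ℓ, M.ρ ℓ * volume.real (B ∩ region ℓ) ≤ ∑ ℓ, R * volume.real (B ∩ region ℓ) :=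
        Finset.sum_le_sum fun ℓ _ => mul_le_mul_of_nonneg_right (hR ℓ) measureReal_nonneg
    _ = R * ∑ ℓ : Fin m → Fin κ, volume.real (B ∩ region ℓ) := by rw [Finset.mul_sum]
    _ = R * volume.real (⋃ ℓ : Fin m → Fin κ, B ∩ region ℓ) := by
        rw [measureReal_def, measure_iUnion (fun i j hij =>
          (pairwise_disjoint_region hij).mono Set.inter_subset_right Set.inter_subset_right)
          (fun ℓ => hB.inter (measurableSet_region ℓ)), tsum_fintype, ENNReal.toReal_sum]
        · rfl
        · exact fun ℓ _ => ne_top_of_le_ne_top hfin (measure_mono Set.inter_subset_left)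
    _ ≤ R * volume.real B := by
        refine mul_le_mul_of_nonneg_left (measureReal_mono ?_ hfin) hR0
        exact Set.iUnion_subset fun _ => Set.inter_subset_left

theorem le_real_positionLaw {B : Set (Fin m → ℝ)} (hB : MeasurableSet B) (ℓ : Fin m → Fin κ) :
    M.ρ ℓ * volume.real (B ∩ region ℓ) ≤ M.positionLaw.real B := by
  rw [M.real_positionLaw B hB]
  exact Finset.single_le_sum (f := fun ℓ => M.ρ ℓ * volume.real (B ∩ region ℓ))
    (fun ℓ _ => mul_nonneg (M.ρ_nonneg ℓ) measureReal_nonneg) (Finset.mem_univ ℓ)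

theorem real_positionLaw_of_subset {B : Set (Fin m → ℝ)} (hB : MeasurableSet B)
    {ℓ : Fin m → Fin κ} (h : B ⊆ region ℓ) : M.positionLaw.real B = M.ρ ℓ * volume.real B := by
  rw [M.real_positionLaw B hB, Finset.sum_eq_single ℓ, Set.inter_eq_left.mpr h]
  · intro ℓ' _ hne
    have : B ∩ region ℓ' = ∅ := by
      rw [← Set.disjoint_iff_inter_eq_empty]
      exact (pairwise_disjoint_region hne.symm).mono_left h
    rw [this, measureReal_empty, mul_zero]
  · simp

/-- A segment leaving the cube is connected, so it meets the frontier, and the point where it does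
is no farther from `x` than `y` is. -/
theorem mem_region_of_nrm_lt {ℓ : Fin m → Fin κ} {x y : Fin m → ℝ} (hx : x ∈ region ℓ)
    (h : M.nrm (x - y) < M.boundaryDist ℓ x) : y ∈ region ℓ := by
  by_contra hy
  obtain ⟨b, hb, hbf⟩ : (segment ℝ x y ∩ frontier (region ℓ)).Nonempty := by
    have hconn : IsPreconnected (segment ℝ x y) := (convex_segment x y).isPreconnected
    rw [Set.nonempty_iff_ne_empty]
    intro hemp
    have hnf : ∀ w ∈ segment ℝ x y, w ∉ frontier (region ℓ) := fun w hw hwf =>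
      Set.notMem_empty w (hemp ▸ ⟨hw, hwf⟩)
    have hin : ∀ w ∈ segment ℝ x y, w ∈ region ℓ → w ∈ interior (region ℓ) := fun w hw hwr => by
      by_contra hcon
      exact hnf w hw ⟨subset_closure hwr, hcon⟩
    have hout : ∀ w ∈ segment ℝ x y, w ∉ region ℓ → w ∈ (closure (region ℓ))ᶜ :=
      fun w hw hwr hcl => hnf w hw ⟨hcl, fun hfint => hwr (interior_subset hfint)⟩
    obtain ⟨w, -, hw1, hw2⟩ := hconn (interior (region ℓ)) (closure (region ℓ))ᶜ isOpen_interior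
      isClosed_closure.isOpen_compl
      (fun w hw => (em (w ∈ region ℓ)).imp (hin w hw) (hout w hw))
      ⟨x, left_mem_segment ℝ x y, hin x (left_mem_segment ℝ x y) hx⟩
      ⟨y, right_mem_segment ℝ x y, hout y (right_mem_segment ℝ x y) hy⟩
    exact hw2 (interior_subset_closure hw1)
  have h1 : M.boundaryDist ℓ x ≤ M.torusDist x b :=
    ciInf_le (f := fun b : frontier (region ℓ) => M.torusDist x b)
      ⟨0, by rintro _ ⟨b, rfl⟩; exact M.torusDist_nonneg _ _⟩ ⟨b, hbf⟩
  have h2 : M.nrm (x - b) ≤ M.nrm (x - y) := by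
    obtain ⟨s, t, hs, ht, hst, rfl⟩ := hb
    have : x - (s • x + t • y) = t • (x - y) := by
      rw [smul_sub, eq_sub_of_add_eq hst, sub_smul, one_smul]
      abel
    rw [this, map_smul_eq_mul, Real.norm_eq_abs, abs_of_nonneg ht]
    exact mul_le_of_le_one_left (apply_nonneg _ _) (by linarith)
  linarith [M.torusDist_le_nrm x b]

/-- A ball whose radius is smaller than the distance to the boundary of the region lies in the
region. -/
theorem torusBall_subset_region {ℓ : Fin m → Fin κ} {x : Fin m → ℝ} (hx : x ∈ region ℓ) {r : ℝ}
    (h : r < M.boundaryDist ℓ x) : M.torusBall x r ⊆ region ℓ := by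
  rintro y ⟨hy, hd⟩
  obtain ⟨z, hz⟩ := M.exists_of_torusDist_lt (hd.trans_lt h)
  have h1 : x - y + (fun i => (z i : ℝ)) = x - (y + fun i => ((-z) i : ℝ)) := by
    funext i; simp; ring
  rw [h1] at hz
  have h2 := M.mem_region_of_nrm_lt hx hz
  -- The representative of `y` close to `x` lies in the region, hence in the unit cube, so it is `y`
  -- itself: no wrapping around occurs.
  have h3 : -z = 0 := eq_zero_of_mem_unitCube hy (by
    have := region_subset_unitCube ℓ h2
    simpa using this)
  rw [h3] at h2
  convert h2 using 1
  funext i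
  simp

/-- The norm ball about `x` lies entirely in the region, so its projection to the torus is injective
and loses no volume. -/
theorem ballVol_eq_of_lt_boundaryDist (hm : 0 < m) {ℓ : Fin m → Fin κ} {x : Fin m → ℝ}
    (hx : x ∈ region ℓ) {r : ℝ} (hr : 0 ≤ r) (h : r < M.boundaryDist ℓ x) :
    M.ballVol r = M.unitBallVolume * r ^ m := by
  rcases hr.eq_or_lt with rfl | hr0
  · rw [M.ballVol_zero hm, zero_pow hm.ne', mul_zero]
  refine le_antisymm (M.ballVol_le hr) ?_
  rw [← M.real_volume_nrm_ball x hr0, ← M.real_volume_torusBall x]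
  refine measureReal_mono (fun y hy => ?_) (M.volume_torusBall_ne_top x r)
  have hy' : M.nrm (x - y) ≤ r := by rw [← map_neg_eq_map, neg_sub]; exact hy
  exact ⟨region_subset_unitCube ℓ (M.mem_region_of_nrm_lt hx (hy'.trans_lt h)),
    (M.torusDist_le_nrm x y).trans hy'⟩

end SPAModel

/-! ### Probability and inclusion of balls -/

namespace SPAModel

variable {m κ : ℕ} (M : SPAModel m κ)

/-- The probability that a new node falls into the ball of volume `V` about `x`. -/
def ballProb (x : Fin m → ℝ) (V : ℝ) : ℝ := M.positionLaw.real (M.ballOfVolume x V)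

theorem ballProb_nonneg (x : Fin m → ℝ) (V : ℝ) : 0 ≤ M.ballProb x V := measureReal_nonneg

theorem ballProb_le {R : ℝ} (hm : 0 < m) (hR : ∀ ℓ, M.ρ ℓ ≤ R) (hR0 : 0 < R) (x : Fin m → ℝ)
    {V : ℝ} (hV : 0 ≤ V) : M.ballProb x V ≤ R * V := by
  refine (M.real_positionLaw_le hR (M.measurableSet_ballOfVolume x V)
    (M.volume_ballOfVolume_ne_top x V)).trans ?_
  rw [M.real_volume_ballOfVolume hm x hV]
  exact mul_le_mul_of_nonneg_left (min_le_left _ _) hR0.le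

theorem ballProb_mono (hm : 0 < m) (x : Fin m → ℝ) {V V' : ℝ} (hV : 0 ≤ V) (h : V ≤ V') :
    M.ballProb x V ≤ M.ballProb x V' :=
  measureReal_mono (M.ballOfVolume_mono hm x hV h)

theorem ballProb_sub_le {R : ℝ} (hm : 0 < m) (hR : ∀ ℓ, M.ρ ℓ ≤ R) (hR0 : 0 < R)
    (x : Fin m → ℝ) {V V' : ℝ} (hV : 0 ≤ V) (h : V ≤ V') :
    M.ballProb x V' - M.ballProb x V ≤ R * (V' - V) := by
  have hsub := M.ballOfVolume_mono hm x hV h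
  have hmeas := M.measurableSet_ballOfVolume x V
  rw [ballProb, ballProb, ← measureReal_sdiff hsub hmeas (measure_ne_top _ _)]
  refine (M.real_positionLaw_le hR ((M.measurableSet_ballOfVolume x V').diff hmeas)
    (ne_top_of_le_ne_top (M.volume_ballOfVolume_ne_top x V')
      (measure_mono Set.sdiff_subset))).trans ?_
  rw [measureReal_sdiff hsub hmeas (M.volume_ballOfVolume_ne_top x V'),
    M.real_volume_ballOfVolume hm x hV, M.real_volume_ballOfVolume hm x (hV.trans h)]
  refine mul_le_mul_of_nonneg_left ?_ hR0.le
  rcases le_total V 1 with h1 | h1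
  · rw [min_eq_left h1]
    linarith [min_le_left V' 1]
  · rw [min_eq_right h1, min_eq_right (h1.trans h)]
    linarith

theorem one_add_pow_le {x : ℝ} (hx : 0 ≤ x) (hx1 : x ≤ 1) (k : ℕ) :
    (1 + x) ^ k ≤ 1 + (2 ^ k - 1) * x := by
  induction k with
  | zero => simp
  | succ k ih =>
    have h1 : (1 : ℝ) ≤ 2 ^ k := one_le_pow₀ (by norm_num)
    calc (1 + x) ^ (k + 1) = (1 + x) ^ k * (1 + x) := pow_succ _ _
      _ ≤ (1 + (2 ^ k - 1) * x) * (1 + x) := by gcongr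
      _ ≤ 1 + (2 ^ (k + 1) - 1) * x := by
        rw [pow_succ]
        nlinarith [mul_nonneg (mul_nonneg (by linarith : (0:ℝ) ≤ 2 ^ k - 1) hx)
          (by linarith : (0:ℝ) ≤ 1 - x)]

theorem root_pow (hm : 0 < m) {x : ℝ} (hx : 0 ≤ x) : (x ^ (1 / (m : ℝ))) ^ m = x := by
  rw [one_div, Real.rpow_inv_natCast_pow hx hm.ne']

theorem root_le_iff (hm : 0 < m) {x y : ℝ} (hx : 0 ≤ x) (hy : 0 ≤ y) :
    x ^ (1 / (m : ℝ)) ≤ y ↔ x ≤ y ^ m := by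
  rw [← pow_le_pow_iff_left₀ (Real.rpow_nonneg hx _) hy hm.ne', root_pow hm hx]

theorem div_rpow_inv_le_radius (hm : 0 < m) {V : ℝ} (hV : 0 ≤ V) (hV1 : V ≤ 1) :
    (V / M.unitBallVolume) ^ (1 / (m : ℝ)) ≤ M.radius V := by
  have hc := M.unitBallVolume_pos
  rw [root_le_iff hm (by positivity) (M.radius_nonneg V), div_le_iff₀' hc]
  exact M.le_mul_radius_pow hm hV hV1

/-- The probability of a ball of given volume depends on the centre in a Lipschitz way, relative to
the scale of the ball. -/
theorem exists_ballProb_sub_le_dist {R : ℝ} (hm : 0 < m) (hR : ∀ ℓ, M.ρ ℓ ≤ R) (hR0 : 0 < R) :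
    ∃ C : ℝ, 0 < C ∧ ∀ (u v : Fin m → ℝ) (V : ℝ), 0 < V →
      M.ballProb u V - M.ballProb v V ≤
        C * (M.torusDist u v / V ^ (1 / (m : ℝ))) * V := by
  obtain ⟨c, hc, hcV⟩ := M.exists_le_ballVol hm
  have hcm := M.unitBallVolume_pos
  set cm := M.unitBallVolume with hcmdef
  set q := cm ^ (1 / (m : ℝ)) with hq
  have hq0 : 0 < q := Real.rpow_pos_of_pos hcm _
  refine ⟨R * q * (1 + cm * 2 ^ m / c), by positivity, fun u v V hV => ?_⟩
  set d := M.torusDist u v with hd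
  have hd0 : 0 ≤ d := M.torusDist_nonneg u v
  have hVm : 0 < V ^ (1 / (m : ℝ)) := Real.rpow_pos_of_pos hV _
  rcases le_or_gt 1 V with h1 | h1
  · rw [ballProb, ballProb, M.ballOfVolume_of_one_le h1, M.ballOfVolume_of_one_le h1, sub_self]
    positivity
  set r := M.radius V with hr
  have hrV : V ≤ cm * r ^ m := M.le_mul_radius_pow hm hV.le h1.le
  have hrlow : V ^ (1 / (m : ℝ)) / q ≤ r := by
    rw [hq, ← Real.div_rpow hV.le hcm.le]
    exact M.div_rpow_inv_le_radius hm hV.le h1.le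
  have hr0 : 0 < r := lt_of_lt_of_le (by positivity) hrlow
  have hball : M.ballVol r = V := M.ballVol_radius hm hV.le h1.le
  have hcr : c * r ^ m ≤ V := by rw [← hball]; exact hcV r hr0.le (by rw [hball]; exact h1)
  have hdr : d / r ≤ q * (d / V ^ (1 / (m : ℝ))) := by
    rw [div_le_iff₀ hr0]
    calc d = q * (d / V ^ (1 / (m : ℝ))) * (V ^ (1 / (m : ℝ)) / q) := by field_simp
      _ ≤ _ := by gcongr
  have hkey : M.ballProb u V - M.ballProb v V ≤ R * (1 + cm * 2 ^ m / c) * (d / r) * V := by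
    -- If the centres are close relative to the radius, the excess lies in a shell of thickness `d`,
    -- whose volume is at most a multiple of `(d / r) V`. Otherwise `d / r` exceeds one and the
    -- trivial bound `R V` suffices.
    rcases le_or_gt d r with hdr1 | hdr1
    · have hsub : M.ballOfVolume u V ⊆ M.torusBall v (r + d) := by
        rw [M.ballOfVolume_of_lt_one h1]
        exact M.torusBall_subset (by rw [M.torusDist_comm, ← hd, ← hr]; linarith)
      have hsub2 : M.ballOfVolume v V ⊆ M.torusBall v (r + d) := by
        rw [M.ballOfVolume_of_lt_one h1]
        exact fun y hy => ⟨hy.1, hy.2.trans (by linarith)⟩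
      have hmv := M.measurableSet_ballOfVolume v V
      have hx : d / r ≤ 1 := (div_le_one hr0).mpr hdr1
      calc M.ballProb u V - M.ballProb v V
          ≤ M.positionLaw.real (M.torusBall v (r + d)) - M.ballProb v V :=
            sub_le_sub_right (measureReal_mono hsub) _
        _ = M.positionLaw.real (M.torusBall v (r + d) \ M.ballOfVolume v V) := by
            rw [measureReal_sdiff hsub2 hmv (measure_ne_top _ _), ballProb]
        _ ≤ R * volume.real (M.torusBall v (r + d) \ M.ballOfVolume v V) :=
            M.real_positionLaw_le hR ((M.measurableSet_torusBall _ _).diff hmv)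
              (ne_top_of_le_ne_top (M.volume_torusBall_ne_top v (r + d))
                (measure_mono Set.sdiff_subset))
        _ = R * (M.ballVol (r + d) - M.ballVol r) := by
            rw [measureReal_sdiff hsub2 hmv (M.volume_torusBall_ne_top _ _),
              M.real_volume_torusBall, M.real_volume_ballOfVolume hm v hV.le, min_eq_left h1.le,
              hball]
        _ ≤ R * (cm * ((r + d) ^ m - r ^ m)) := by
            gcongr
            exact M.ballVol_sub_le hr0 (by linarith)
        _ = R * (cm * (r ^ m * ((1 + d / r) ^ m - 1))) := by
            have : r + d = r * (1 + d / r) := by field_simp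
            rw [this, mul_pow]; ring
        _ ≤ R * (cm * (V / c * (2 ^ m * (d / r)))) := by
            have h2 : (1 + d / r) ^ m - 1 ≤ 2 ^ m * (d / r) := by
              have h3 : 0 ≤ d / r := by positivity
              have := one_add_pow_le h3 hx m
              linarith
            have h3 : r ^ m ≤ V / c := by rwa [le_div_iff₀' hc]
            have h4 : (1 : ℝ) ≤ (1 + d / r) ^ m := one_le_pow₀ (by linarith [div_nonneg hd0 hr0.le])
            gcongr
        _ = R * (cm * 2 ^ m / c) * (d / r) * V := by ring
        _ ≤ R * (1 + cm * 2 ^ m / c) * (d / r) * V := by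
            gcongr
            linarith
    · have h2 : 1 ≤ d / r := (one_le_div hr0).mpr hdr1.le
      calc M.ballProb u V - M.ballProb v V ≤ R * V := by
            linarith [M.ballProb_le hm hR hR0 u hV.le, M.ballProb_nonneg v V]
        _ ≤ R * (1 + cm * 2 ^ m / c) * (d / r) * V := by
            rw [mul_assoc R, mul_assoc R]
            have h3 : 1 ≤ (1 + cm * 2 ^ m / c) * (d / r) :=
              one_le_mul_of_one_le_of_one_le (by linarith [show 0 ≤ cm * 2 ^ m / c by positivity]) h2
            gcongr
            nlinarith
  refine hkey.trans ?_
  calc R * (1 + cm * 2 ^ m / c) * (d / r) * V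
      ≤ R * (1 + cm * 2 ^ m / c) * (q * (d / V ^ (1 / (m : ℝ)))) * V := by gcongr
    _ = _ := by ring

/-- Balls about a point of a region have probability at least proportional to their volume. -/
theorem exists_le_ballProb (hm : 0 < m) : ∃ c : ℝ, 0 < c ∧
    ∀ (ℓ : Fin m → Fin κ) (x : Fin m → ℝ), x ∈ region ℓ → ∀ V : ℝ, 0 ≤ V →
      M.ρ ℓ * (c * min V 1) ≤ M.ballProb x V := by
  obtain ⟨C, hC, h⟩ := M.exists_le_volume_torusBall_inter_region hm
  have hcm := M.unitBallVolume_pos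
  set cm := M.unitBallVolume with hcmdef
  refine ⟨1 / (C ^ m * (cm + 1)), by positivity, fun ℓ x hx V hV => ?_⟩
  refine le_trans (mul_le_mul_of_nonneg_left ?_ (M.ρ_nonneg ℓ))
    (M.le_real_positionLaw (M.measurableSet_ballOfVolume x V) ℓ)
  have hfin : volume (M.ballOfVolume x V ∩ region ℓ) ≠ ⊤ :=
    ne_top_of_le_ne_top (M.volume_ballOfVolume_ne_top x V) (measure_mono Set.inter_subset_left)
  have key : ∀ r, 0 ≤ r → r ≤ 1 → min V 1 ≤ (cm + 1) * r ^ m →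
      M.torusBall x r ⊆ M.ballOfVolume x V →
      1 / (C ^ m * (cm + 1)) * min V 1 ≤ volume.real (M.ballOfVolume x V ∩ region ℓ) := by
    intro r hr hr1 hrm hsub
    calc 1 / (C ^ m * (cm + 1)) * min V 1 ≤ 1 / (C ^ m * (cm + 1)) * ((cm + 1) * r ^ m) := by
          gcongr
      _ = (r / C) ^ m := by
          rw [div_pow]; field_simp
      _ ≤ _ := h ℓ x hx r hr hr1
      _ ≤ _ := measureReal_mono (Set.inter_subset_inter_left _ hsub) hfin
  rcases le_or_gt 1 V with h1 | h1
  · refine key 1 zero_le_one le_rfl ?_ ?_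
    · rw [min_eq_right h1, one_pow]; linarith
    · rw [M.ballOfVolume_of_one_le h1]; exact fun y hy => hy.1
  · have hrV : V ≤ cm * M.radius V ^ m := M.le_mul_radius_pow hm hV h1.le
    have hr0 := M.radius_nonneg V
    refine key (min (M.radius V) 1) (le_min hr0 zero_le_one) (min_le_right _ _) ?_ ?_
    · rw [min_eq_left h1.le]
      rcases le_total (M.radius V) 1 with h2 | h2
      · rw [min_eq_left h2]
        nlinarith [pow_nonneg hr0 m]
      · rw [min_eq_right h2, one_pow]; linarith
    · rw [M.ballOfVolume_of_lt_one h1]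
      exact fun y hy => ⟨hy.1, hy.2.trans (min_le_left _ _)⟩

theorem boundaryDist_nonneg (ℓ : Fin m → Fin κ) (x : Fin m → ℝ) : 0 ≤ M.boundaryDist ℓ x :=
  Real.iInf_nonneg fun _ => M.torusDist_nonneg _ _

section InRegion

variable {ℓ : Fin m → Fin κ} {x : Fin m → ℝ} {V : ℝ}

theorem root_lt_boundaryDist (hm : 0 < m) (hV : 0 ≤ V)
    (h : V < M.unitBallVolume * M.boundaryDist ℓ x ^ m) :
    (V / M.unitBallVolume) ^ (1 / (m : ℝ)) < M.boundaryDist ℓ x := by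
  have hcm := M.unitBallVolume_pos
  by_contra hcon
  have h1 := pow_le_pow_left₀ (M.boundaryDist_nonneg ℓ x) (not_lt.mp hcon) m
  rw [root_pow hm (by positivity), le_div_iff₀' hcm] at h1
  linarith

/-- A slightly larger radius is still smaller than the distance to the boundary. The corresponding
ball has its Euclidean volume, which is at most one, and this makes the inequality for `V` strict.
-/
theorem lt_one_of_lt_boundaryDist (hm : 0 < m) (hx : x ∈ region ℓ) (hV : 0 ≤ V)
    (h : V < M.unitBallVolume * M.boundaryDist ℓ x ^ m) : V < 1 := by
  have hcm := M.unitBallVolume_pos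
  have h1 := M.root_lt_boundaryDist hm hV h
  obtain ⟨r, hr1, hr2⟩ := exists_between h1
  have h0 : 0 ≤ (V / M.unitBallVolume) ^ (1 / (m : ℝ)) := Real.rpow_nonneg (by positivity) _
  have hr0 : 0 ≤ r := h0.trans hr1.le
  have h2 := M.ballVol_eq_of_lt_boundaryDist hm hx hr0 hr2
  have h3 := M.ballVol_le_one r
  have h4 := pow_lt_pow_left₀ hr1 h0 hm.ne'
  rw [root_pow hm (by positivity), div_lt_iff₀' hcm] at h4
  linarith

theorem radius_eq_of_lt_boundaryDist (hm : 0 < m) (hx : x ∈ region ℓ) (hV : 0 ≤ V)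
    (h : V < M.unitBallVolume * M.boundaryDist ℓ x ^ m) :
    M.radius V = (V / M.unitBallVolume) ^ (1 / (m : ℝ)) := by
  have hcm := M.unitBallVolume_pos
  have h1 := M.root_lt_boundaryDist hm hV h
  have hV1 := M.lt_one_of_lt_boundaryDist hm hx hV h
  have h0 : 0 ≤ (V / M.unitBallVolume) ^ (1 / (m : ℝ)) := Real.rpow_nonneg (by positivity) _
  refine le_antisymm (M.radius_le h0 ?_) (M.div_rpow_inv_le_radius hm hV hV1.le)
  rw [M.ballVol_eq_of_lt_boundaryDist hm hx h0 h1, root_pow hm (by positivity)]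
  field_simp
  exact le_rfl

theorem ballOfVolume_subset_region (hm : 0 < m) (hx : x ∈ region ℓ) (hV : 0 ≤ V)
    (h : V < M.unitBallVolume * M.boundaryDist ℓ x ^ m) : M.ballOfVolume x V ⊆ region ℓ := by
  rw [M.ballOfVolume_of_lt_one (M.lt_one_of_lt_boundaryDist hm hx hV h),
    M.radius_eq_of_lt_boundaryDist hm hx hV h]
  exact M.torusBall_subset_region hx (M.root_lt_boundaryDist hm hV h)

theorem ballProb_eq_of_lt_boundaryDist (hm : 0 < m) (hx : x ∈ region ℓ) (hV : 0 ≤ V)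
    (h : V < M.unitBallVolume * M.boundaryDist ℓ x ^ m) : M.ballProb x V = M.ρ ℓ * V := by
  rw [ballProb, M.real_positionLaw_of_subset (M.measurableSet_ballOfVolume x V)
    (M.ballOfVolume_subset_region hm hx hV h), M.real_volume_ballOfVolume hm x hV,
    min_eq_left (M.lt_one_of_lt_boundaryDist hm hx hV h).le]

end InRegion

theorem ballOfVolume_subset_of_radius {u v : Fin m → ℝ} {V V' : ℝ} (hV : V < 1)
    (h : V' < 1 → M.torusDist u v + M.radius V ≤ M.radius V') :
    M.ballOfVolume v V ⊆ M.ballOfVolume u V' := by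
  rcases le_or_gt 1 V' with h1 | h1
  · rw [M.ballOfVolume_of_one_le h1]; exact M.ballOfVolume_subset_unitCube
  · rw [M.ballOfVolume_of_lt_one h1, M.ballOfVolume_of_lt_one hV]
    exact M.torusBall_subset (h h1)

theorem ballOfVolume_disjoint_of_radius {u v : Fin m → ℝ} {V V' : ℝ} (hV : V < 1) (hV' : V' < 1)
    (h : M.radius V + M.radius V' < M.torusDist u v) :
    M.ballOfVolume u V ∩ M.ballOfVolume v V' = ∅ := by
  rw [M.ballOfVolume_of_lt_one hV', M.ballOfVolume_of_lt_one hV]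
  by_contra hne
  obtain ⟨y, hy1, hy2⟩ := Set.nonempty_iff_ne_empty.mpr hne
  have := M.torusDist_triangle u y v
  have h2 := hy1.2
  have h3 := hy2.2
  rw [M.torusDist_comm] at h3
  linarith

/-- A much smaller ball whose centre lies well inside a large ball is contained in the latter. -/
theorem exists_ballOfVolume_subset (hm : 0 < m) {θ : ℝ} (hθ : 1 < θ) : ∃ c : ℝ, 0 < c ∧ c ≤ 1 ∧
    ∀ (u v : Fin m → ℝ) (V V' : ℝ), 0 ≤ V →
      θ * M.unitBallVolume * M.torusDist u v ^ m ≤ V' → V ≤ c * V' →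
      M.ballOfVolume v V ⊆ M.ballOfVolume u V' := by
  obtain ⟨c₁, hc₁, hcV⟩ := M.exists_le_ballVol hm
  have hcm := M.unitBallVolume_pos
  set cm := M.unitBallVolume with hcmdef
  -- The margin `θ` in volume puts the centre of the small ball within `τ` times the large radius.
  -- The remaining fraction `1 - τ` is available for the small radius.
  set τ := θ ^ (-(1 / (m : ℝ))) with hτ
  have hτ0 : 0 < τ := Real.rpow_pos_of_pos (by linarith) _
  have hm' : (0 : ℝ) < m := by exact_mod_cast hm
  have hτ1 : τ < 1 := Real.rpow_lt_one_of_one_lt_of_neg hθ (by simp [hm])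
  have hτm : θ * τ ^ m = 1 := by
    rw [hτ, Real.rpow_neg (by linarith), inv_pow, root_pow hm (by linarith)]
    field_simp
  have hpos : 0 < c₁ / cm * (1 - τ) ^ m := mul_pos (by positivity) (pow_pos (by linarith) m)
  refine ⟨min 1 (c₁ / cm * (1 - τ) ^ m), lt_min one_pos hpos, min_le_left _ _,
    fun u v V V' hV hd hVV => ?_⟩
  rcases le_or_gt 1 V' with h1 | h1
  · rw [M.ballOfVolume_of_one_le h1]; exact M.ballOfVolume_subset_unitCube
  have hd0 := M.torusDist_nonneg u v
  have hV'0 : 0 ≤ V' := le_trans (by positivity) hd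
  have hV1 : V < 1 := by
    have : min 1 (c₁ / cm * (1 - τ) ^ m) * V' ≤ 1 * V' := by
      gcongr
      exact min_le_left _ _
    linarith
  refine M.ballOfVolume_subset_of_radius hV1 fun _ => ?_
  have hr' : V' ≤ cm * M.radius V' ^ m := M.le_mul_radius_pow hm hV'0 h1.le
  have hr'0 := M.radius_nonneg V'
  have hr0 := M.radius_nonneg V
  have hA : M.torusDist u v ≤ τ * M.radius V' := by
    refine le_of_pow_le_pow_left₀ hm.ne' (by positivity) ?_
    rw [mul_pow]
    have h3 : θ * cm * M.torusDist u v ^ m ≤ cm * M.radius V' ^ m := hd.trans hr'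
    have h4 : θ * M.torusDist u v ^ m ≤ M.radius V' ^ m := by
      by_contra hcon
      rw [not_le] at hcon
      nlinarith
    calc M.torusDist u v ^ m = τ ^ m * (θ * M.torusDist u v ^ m) := by
          rw [← mul_assoc, mul_comm (τ ^ m), hτm, one_mul]
      _ ≤ _ := by gcongr
  have hB : M.radius V ≤ (1 - τ) * M.radius V' := by
    refine le_of_pow_le_pow_left₀ hm.ne' (mul_nonneg (by linarith) hr'0) ?_
    rw [mul_pow]
    have h3 : c₁ * M.radius V ^ m ≤ V := by
      have h5 := M.ballVol_radius hm hV hV1.le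
      conv_rhs => rw [← h5]
      exact hcV _ hr0 (by rw [h5]; exact hV1)
    have h6 : 0 ≤ (1 - τ) ^ m := pow_nonneg (by linarith) m
    have h4 : c₁ * M.radius V ^ m ≤ c₁ * ((1 - τ) ^ m * M.radius V' ^ m) := by
      calc c₁ * M.radius V ^ m ≤ V := h3
        _ ≤ min 1 (c₁ / cm * (1 - τ) ^ m) * V' := hVV
        _ ≤ (c₁ / cm * (1 - τ) ^ m) * (cm * M.radius V' ^ m) := by
            gcongr
            exact min_le_right _ _
        _ = _ := by field_simp
    exact le_of_mul_le_mul_left h4 hc₁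
  linarith

end SPAModel

/-! ### Exponential bounds for predictable sums -/

namespace SPAModel

section Product

variable {Y : Type*} [MeasurableSpace Y] (ν : Measure Y) [IsProbabilityMeasure ν]

theorem measurable_update_prod (t : ℕ) :
    Measurable fun q : (ℕ → Y) × Y => Function.update q.1 t q.2 := by
  rw [measurable_pi_iff]
  intro i
  by_cases h : i = t
  · subst h
    simpa using measurable_snd
  · simp only [Function.update_of_ne h]
    exact (measurable_pi_apply i).comp measurable_fst

/-- Resampling one coordinate preserves a product law. -/
theorem measurePreserving_update (t : ℕ) :
    MeasurePreserving (fun q : (ℕ → Y) × Y => Function.update q.1 t q.2)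
      ((Measure.infinitePi fun _ : ℕ => ν).prod ν) (Measure.infinitePi fun _ : ℕ => ν) := by
  refine ⟨measurable_update_prod t, ?_⟩
  refine Measure.eq_infinitePi _ fun s T hT => ?_
  have hmeas : MeasurableSet (Set.pi (s : Set ℕ) T) :=
    MeasurableSet.pi s.countable_toSet fun i _ => hT i
  rw [Measure.map_apply (measurable_update_prod t) hmeas]
  by_cases hts : t ∈ s
  · have hpre : (fun q : (ℕ → Y) × Y => Function.update q.1 t q.2) ⁻¹' Set.pi (s : Set ℕ) T =
        (Set.pi ((s.erase t : Finset ℕ) : Set ℕ) T) ×ˢ T t := by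
      ext q
      simp only [Set.mem_preimage, Set.mem_pi, Finset.mem_coe, Set.mem_prod, Finset.mem_erase]
      constructor
      · intro h
        refine ⟨fun i hi => ?_, by simpa using h t hts⟩
        have := h i hi.2
        rwa [Function.update_of_ne hi.1] at this
      · rintro ⟨h1, h2⟩ i hi
        by_cases hit : i = t
        · subst hit; simpa using h2
        · rw [Function.update_of_ne hit]; exact h1 i ⟨hit, hi⟩
    rw [hpre, Measure.prod_prod, Measure.infinitePi_pi _ (fun i _ => hT i),
      Finset.prod_erase_mul _ _ hts]
  · have hpre : (fun q : (ℕ → Y) × Y => Function.update q.1 t q.2) ⁻¹' Set.pi (s : Set ℕ) T =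
        (Set.pi (s : Set ℕ) T) ×ˢ Set.univ := by
      ext q
      simp only [Set.mem_preimage, Set.mem_pi, Finset.mem_coe, Set.mem_prod, Set.mem_univ,
        and_true]
      refine forall₂_congr fun i hi => ?_
      rw [Function.update_of_ne (by rintro rfl; exact hts hi)]
    rw [hpre, Measure.prod_prod, Measure.infinitePi_pi _ (fun i _ => hT i), measure_univ, mul_one]

/-- A product of successive factors with conditional means at most one has mean at most one. -/
theorem lintegral_prod_le_one (H : ℕ → (ℕ → Y) → Y → ENNReal)
    (hmeas : ∀ t, Measurable fun q : (ℕ → Y) × Y => H t q.1 q.2)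
    (hloc : ∀ t k, t < k → ∀ s y, H t (Function.update s k y) = H t s)
    (hmean : ∀ t s, ∫⁻ y, H t s y ∂ν ≤ 1) (t : ℕ) :
    ∫⁻ s, ∏ τ ∈ Finset.range t, H τ s (s (τ + 1)) ∂(Measure.infinitePi fun _ : ℕ => ν) ≤ 1 := by
  have hm1 : ∀ τ, Measurable fun s : ℕ → Y => H τ s (s (τ + 1)) := fun τ =>
    (hmeas τ).comp (measurable_id.prodMk (measurable_pi_apply (τ + 1)))
  have hmP : ∀ t, Measurable fun s : ℕ → Y => ∏ τ ∈ Finset.range t, H τ s (s (τ + 1)) := fun t =>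
    Finset.measurable_fun_prod _ fun τ _ => hm1 τ
  induction t with
  | zero => simp
  | succ t ih =>
    have hprod := lintegral_prod
      (μ := Measure.infinitePi fun _ : ℕ => ν) (ν := ν)
      (fun q : (ℕ → Y) × Y => ∏ τ ∈ Finset.range (t + 1),
        H τ (Function.update q.1 (t + 1) q.2) (Function.update q.1 (t + 1) q.2 (τ + 1)))
      ((hmP (t + 1)).comp (measurable_update_prod (t + 1))).aemeasurable
    -- Resampling entry `t + 1` exposes it as an independent variable. The earlier factors do not
    -- see it, and the last one integrates to at most one.
    rw [← (measurePreserving_update ν (t + 1)).lintegral_comp (hmP (t + 1)), hprod]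
    refine le_trans (lintegral_mono fun s => ?_) ih
    have hP : ∀ y, ∏ τ ∈ Finset.range (t + 1),
        H τ (Function.update s (t + 1) y) (Function.update s (t + 1) y (τ + 1)) =
        (∏ τ ∈ Finset.range t, H τ s (s (τ + 1))) * H t s y := by
      intro y
      rw [Finset.prod_range_succ, hloc t (t + 1) (Nat.lt_succ_self t), Function.update_self]
      congr 1
      refine Finset.prod_congr rfl fun τ hτ => ?_
      rw [Finset.mem_range] at hτ
      rw [hloc τ (t + 1) (by omega), Function.update_of_ne (by omega)]
    simp only [hP]
    have hmy : Measurable (H t s) := (hmeas t).comp measurable_prodMk_left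
    rw [lintegral_const_mul _ hmy]
    exact mul_le_of_le_one_right' (hmean t s)

/-- An exponential tail bound for sums of indicators with predictable weights. -/
theorem measure_le_exp_neg (A : ℕ → (ℕ → Y) → Set Y)
    (hA : ∀ t, MeasurableSet {q : (ℕ → Y) × Y | q.2 ∈ A t q.1})
    (hAloc : ∀ t k, t < k → ∀ s y, A t (Function.update s k y) = A t s)
    (W : ℕ → (ℕ → Y) → ℝ) (hW : ∀ t, Measurable (W t)) (hW1 : ∀ t s, -1 < W t s)
    (hWloc : ∀ t k, t < k → ∀ s y, W t (Function.update s k y) = W t s) (t : ℕ) (x : ℝ) :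
    (Measure.infinitePi fun _ : ℕ => ν) {s | x ≤ ∑ τ ∈ Finset.range t,
      ((A τ s).indicator (fun _ => Real.log (1 + W τ s)) (s (τ + 1)) - W τ s * ν.real (A τ s))} ≤
      ENNReal.ofReal (Real.exp (-x)) := by
  have hAs : ∀ t s, MeasurableSet (A t s) := fun t s => (hA t).preimage measurable_prodMk_left
  set f : ℕ → (ℕ → Y) → Y → ℝ := fun τ s y =>
    (A τ s).indicator (fun _ => Real.log (1 + W τ s)) y - W τ s * ν.real (A τ s) with hf
  have hfm : ∀ τ, Measurable fun q : (ℕ → Y) × Y => f τ q.1 q.2 := by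
    intro τ
    have h1 : (fun q : (ℕ → Y) × Y => (A τ q.1).indicator (fun _ => Real.log (1 + W τ q.1)) q.2) =
        {q : (ℕ → Y) × Y | q.2 ∈ A τ q.1}.indicator fun q => Real.log (1 + W τ q.1) := by
      funext q
      by_cases hq : q.2 ∈ A τ q.1
      · rw [Set.indicator_of_mem hq, Set.indicator_of_mem (by exact hq)]
      · rw [Set.indicator_of_notMem hq, Set.indicator_of_notMem (by exact hq)]
    have h2 : Measurable fun s : ℕ → Y => ν.real (A τ s) :=
      (measurable_measure_prodMk_left (hA τ)).ennreal_toReal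
    refine Measurable.sub ?_ (((hW τ).comp measurable_fst).mul (h2.comp measurable_fst))
    rw [h1]
    exact (Real.measurable_log.comp (measurable_const.add ((hW τ).comp measurable_fst))).indicator
      (hA τ)
  -- The mean equals `(1 + b) exp(-b)` with `b = W ν(A)`. The logarithmic weight is chosen so that
  -- the exponential is linear in `W` on `A`.
  have hmean : ∀ τ s, ∫⁻ y, ENNReal.ofReal (Real.exp (f τ s y)) ∂ν ≤ 1 := by
    intro τ s
    set b := W τ s * ν.real (A τ s) with hb
    have h1 : ∀ y, Real.exp (f τ s y) =
        Real.exp (-b) + (A τ s).indicator (fun _ => Real.exp (-b) * W τ s) y := by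
      intro y
      have hpos : 0 < 1 + W τ s := by linarith [hW1 τ s]
      by_cases hy : y ∈ A τ s
      · simp only [hf, Set.indicator_of_mem hy]
        rw [sub_eq_add_neg, Real.exp_add, Real.exp_log hpos]
        ring
      · simp only [hf, Set.indicator_of_notMem hy]
        simp [hb]
    have hfint : Integrable (fun y => Real.exp (f τ s y)) ν := by
      simp only [h1]
      exact (integrable_const _).add ((integrable_const _).indicator (hAs τ s))
    rw [← ofReal_integral_eq_lintegral_ofReal hfint
      (Eventually.of_forall fun y => (Real.exp_pos _).le)]
    rw [← ENNReal.ofReal_one]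
    refine ENNReal.ofReal_le_ofReal ?_
    simp only [h1]
    rw [integral_add (integrable_const _) ((integrable_const _).indicator (hAs τ s)),
      integral_indicator_const _ (hAs τ s), integral_const]
    simp only [probReal_univ, smul_eq_mul, one_mul]
    have h2 : 1 + b ≤ Real.exp b := by linarith [Real.add_one_le_exp b]
    calc Real.exp (-b) + ν.real (A τ s) * (Real.exp (-b) * W τ s) = Real.exp (-b) * (1 + b) := by
          rw [hb]; ring
      _ ≤ Real.exp (-b) * Real.exp b := by gcongr
      _ = 1 := by rw [← Real.exp_add]; simp
  have hfloc : ∀ t k, t < k → ∀ s y, f t (Function.update s k y) = f t s := by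
    intro t k htk s y
    simp only [hf, hAloc t k htk, hWloc t k htk]
  have key := lintegral_prod_le_one ν (fun τ s y => ENNReal.ofReal (Real.exp (f τ s y)))
    (fun τ => ENNReal.measurable_ofReal.comp (Real.measurable_exp.comp (hfm τ)))
    (fun t k htk s y => by
      funext z
      rw [hfloc t k htk]) hmean t
  have hprod : ∀ s : ℕ → Y, ∏ τ ∈ Finset.range t, ENNReal.ofReal (Real.exp (f τ s (s (τ + 1)))) =
      ENNReal.ofReal (Real.exp (∑ τ ∈ Finset.range t, f τ s (s (τ + 1)))) := by
    intro s
    rw [Real.exp_sum, ENNReal.ofReal_prod_of_nonneg fun _ _ => (Real.exp_pos _).le]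
  simp only [hprod] at key
  have hsum : Measurable fun s : ℕ → Y => ∑ τ ∈ Finset.range t, f τ s (s (τ + 1)) :=
    Finset.measurable_fun_sum _ fun τ _ =>
      (hfm τ).comp (measurable_id.prodMk (measurable_pi_apply (τ + 1)))
  have hmarkov := mul_meas_ge_le_lintegral
    (μ := Measure.infinitePi fun _ : ℕ => ν)
    (ENNReal.measurable_ofReal.comp (Real.measurable_exp.comp hsum))
    (ENNReal.ofReal (Real.exp x))
  have hle := hmarkov.trans key
  have hset : {s : ℕ → Y | x ≤ ∑ τ ∈ Finset.range t, f τ s (s (τ + 1))} ⊆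
      {s | ENNReal.ofReal (Real.exp x) ≤
        (ENNReal.ofReal ∘ Real.exp ∘ fun s : ℕ → Y => ∑ τ ∈ Finset.range t, f τ s (s (τ + 1))) s} :=
    fun s hs => ENNReal.ofReal_le_ofReal (Real.exp_le_exp.mpr hs)
  have hle2 := (mul_le_mul_right (measure_mono hset) (ENNReal.ofReal (Real.exp x))).trans hle
  rw [Real.exp_neg, ENNReal.ofReal_inv_of_pos (Real.exp_pos x)]
  rw [← one_div, ENNReal.le_div_iff_mul_le (Or.inl (by simp [Real.exp_pos])) (Or.inl (by simp)),
    mul_comm]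
  exact hle2

end Product

end SPAModel

/-! ### The graph process: recursion, measurability, linking probabilities -/

namespace SPAModel

variable {m κ : ℕ} (M : SPAModel m κ)

theorem mem_edges_succ (s : Outcome m) (t : ℕ) (e : ℕ × ℕ) :
    e ∈ M.edges s (t + 1) ↔ e ∈ M.edges s t ∨ (e.1 = t + 1 ∧ e.2 ∈ Finset.Icc 1 t ∧
      node s (t + 1) ∈ M.influence s (M.edges s t) e.2 t ∧ (s (t + 1)).2 e.2 = true) := by
  rw [edges, Finset.mem_union, Finset.mem_image]
  refine or_congr_right ?_
  constructor
  · rintro ⟨i, hi, rfl⟩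
    simp only [Finset.mem_filter] at hi
    exact ⟨rfl, hi.1, hi.2.1, hi.2.2⟩
  · rintro ⟨h1, h2, h3, h4⟩
    exact ⟨e.2, by simp only [Finset.mem_filter]; exact ⟨h2, h3, h4⟩, by rw [← h1]⟩

theorem edges_bounds (s : Outcome m) (t : ℕ) (e : ℕ × ℕ) (h : e ∈ M.edges s t) :
    1 ≤ e.2 ∧ e.2 < e.1 ∧ e.1 ≤ t := by
  induction t with
  | zero => simp [edges] at h
  | succ t ih =>
    rcases (M.mem_edges_succ s t e).mp h with h | ⟨h1, h2, -⟩
    · have := ih h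
      omega
    · rw [Finset.mem_Icc] at h2
      omega

theorem edges_mono (s : Outcome m) : Monotone (M.edges s) :=
  monotone_nat_of_le_succ fun t _ he => (M.mem_edges_succ s t _).mpr (Or.inl he)

theorem mem_edges_succ_of_ne (s : Outcome m) (t : ℕ) (e : ℕ × ℕ) (h : e.1 ≠ t + 1) :
    e ∈ M.edges s (t + 1) ↔ e ∈ M.edges s t := by
  rw [M.mem_edges_succ s t e]
  simp [h]

/-- Predictability: the graph at time `t` is built from the entries up to `t` only. This is what
allows later entries to be resampled. -/
theorem edges_update (s : Outcome m) (y : (Fin m → ℝ) × (ℕ → Bool)) {t k : ℕ} (h : t < k) :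
    M.edges (Function.update s k y) t = M.edges s t := by
  induction t with
  | zero => rfl
  | succ t ih =>
    have h0 := ih (by omega)
    ext e
    rw [M.mem_edges_succ, M.mem_edges_succ, h0]
    have h1 : Function.update s k y (t + 1) = s (t + 1) := Function.update_of_ne (by omega) _ _
    refine or_congr_right (and_congr_right fun _ => and_congr_right fun he => ?_)
    rw [Finset.mem_Icc] at he
    have h2 : Function.update s k y e.2 = s e.2 := Function.update_of_ne (by omega) _ _
    simp only [node, influence, h1, h2]

/-- The points and coins of a new node for which it links to all nodes of `F`. -/
def linkSet (F : Finset ℕ) (τ : ℕ) (s : Outcome m) : Set ((Fin m → ℝ) × (ℕ → Bool)) :=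
  {y | ∀ v ∈ F, v ∈ Finset.Icc 1 τ ∧ y.1 ∈ M.influence s (M.edges s τ) v τ ∧ y.2 v = true}

theorem mem_linkSet_iff (F : Finset ℕ) (τ : ℕ) (s : Outcome m) :
    s (τ + 1) ∈ M.linkSet F τ s ↔ ∀ v ∈ F, (τ + 1, v) ∈ M.edges s (τ + 1) := by
  refine forall₂_congr fun v _ => ?_
  rw [M.mem_edges_succ]
  have h : (τ + 1, v) ∉ M.edges s τ := fun h => by
    have := M.edges_bounds s τ _ h
    simp only at this
    omega
  simp [h, node]

theorem linkSet_update (F : Finset ℕ) (s : Outcome m) (y : (Fin m → ℝ) × (ℕ → Bool)) {t k : ℕ}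
    (h : t < k) : M.linkSet F t (Function.update s k y) = M.linkSet F t s := by
  ext z
  refine forall₂_congr fun v _ => and_congr_right fun hv => ?_
  rw [Finset.mem_Icc] at hv
  have h2 : Function.update s k y v = s v := Function.update_of_ne (by omega) _ _
  simp only [influence, node, M.edges_update s y h, h2]

theorem measurable_node (i : ℕ) : Measurable fun s : Outcome m => node s i :=
  measurable_fst.comp (measurable_pi_apply i)

/-- Membership of a point in a sphere of influence is a measurable event, once the edge set is. -/
theorem measurableSet_mem_influence (t i : ℕ)
    (h : ∀ E, MeasurableSet {s : Outcome m | M.edges s t = E}) :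
    MeasurableSet {q : Outcome m × (Fin m → ℝ) | q.2 ∈ M.influence q.1 (M.edges q.1 t) i t} := by
  have : {q : Outcome m × (Fin m → ℝ) | q.2 ∈ M.influence q.1 (M.edges q.1 t) i t} =
      ⋃ E : Finset (ℕ × ℕ), ({q | M.edges q.1 t = E} ∩ {q | q.2 ∈ M.influence q.1 E i t}) := by
    ext q
    simp
  rw [this]
  refine MeasurableSet.iUnion fun E => ((h E).preimage measurable_fst).inter ?_
  exact (M.measurableSet_mem_ballOfVolume ((M.A₁ * (inDeg E i : ℝ) + M.A₂) / t)).preimage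
    (((measurable_node i).comp measurable_fst).prodMk measurable_snd)

theorem measurableSet_edges_eq_of_mem (t : ℕ)
    (hmem : ∀ e, MeasurableSet {s : Outcome m | e ∈ M.edges s t}) (E : Finset (ℕ × ℕ)) :
    MeasurableSet {s : Outcome m | M.edges s t = E} := by
  have : {s : Outcome m | M.edges s t = E} = ⋂ e : ℕ × ℕ, {s | e ∈ M.edges s t ↔ e ∈ E} := by
    ext s
    simp only [Set.mem_ofPred_eq, Set.mem_iInter]
    exact Finset.ext_iff
  rw [this]
  refine MeasurableSet.iInter fun e => ?_
  by_cases he : e ∈ E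
  · simpa [he] using hmem e
  · have h : {s : Outcome m | e ∈ M.edges s t ↔ e ∈ E} = {s | e ∈ M.edges s t}ᶜ := by
      ext s
      simp [he]
    rw [h]
    exact (hmem e).compl

theorem measurableSet_mem_edges (t : ℕ) (e : ℕ × ℕ) :
    MeasurableSet {s : Outcome m | e ∈ M.edges s t} := by
  induction t generalizing e with
  | zero => simp [edges]
  | succ t ih =>
    simp only [M.mem_edges_succ]
    have h1 : MeasurableSet {s : Outcome m | node s (t + 1) ∈
        M.influence s (M.edges s t) e.2 t} :=
      (M.measurableSet_mem_influence t e.2 (M.measurableSet_edges_eq_of_mem t ih)).preimage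
        (measurable_id.prodMk (measurable_node (t + 1)))
    have h2 : MeasurableSet {s : Outcome m | (s (t + 1)).2 e.2 = true} :=
      (measurableSet_singleton true).preimage
        ((measurable_pi_apply e.2).comp (measurable_snd.comp (measurable_pi_apply (t + 1))))
    exact (ih e).union ((MeasurableSet.const _).inter ((MeasurableSet.const _).inter
      (h1.inter h2)))

theorem measurableSet_edges_eq (t : ℕ) (E : Finset (ℕ × ℕ)) :
    MeasurableSet {s : Outcome m | M.edges s t = E} :=
  M.measurableSet_edges_eq_of_mem t (M.measurableSet_mem_edges t) E

/-- There are only countably many finite edge sets, so no condition on `f` is needed. -/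
theorem measurable_of_edges {β : Type*} [MeasurableSpace β] (t : ℕ)
    (f : Finset (ℕ × ℕ) → β) : Measurable fun s : Outcome m => f (M.edges s t) := by
  intro B _
  have : (fun s : Outcome m => f (M.edges s t)) ⁻¹' B =
      ⋃ E : f ⁻¹' B, {s | M.edges s t = E} := by
    ext s
    simp
  rw [this]
  exact MeasurableSet.iUnion fun E => M.measurableSet_edges_eq t E

theorem measurableSet_linkSet (F : Finset ℕ) (t : ℕ) :
    MeasurableSet {q : Outcome m × ((Fin m → ℝ) × (ℕ → Bool)) | q.2 ∈ M.linkSet F t q.1} := by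
  have : {q : Outcome m × ((Fin m → ℝ) × (ℕ → Bool)) | q.2 ∈ M.linkSet F t q.1} =
      ⋂ v ∈ F, ({q | v ∈ Finset.Icc 1 t} ∩ ({q | q.2.1 ∈ M.influence q.1 (M.edges q.1 t) v t} ∩
        {q | q.2.2 v = true})) := by
    ext q
    simp only [linkSet, Set.mem_ofPred_eq, Set.mem_iInter, Set.mem_inter_iff]
  rw [this]
  refine Finset.measurableSet_biInter _ fun v _ => (MeasurableSet.const _).inter (.inter ?_ ?_)
  · exact (M.measurableSet_mem_influence t v (M.measurableSet_edges_eq t)).preimage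
      (measurable_fst.prodMk (measurable_fst.comp measurable_snd))
  · exact (measurableSet_singleton true).preimage
      ((measurable_pi_apply v).comp (measurable_snd.comp measurable_snd))

/-- The law of one entry of the randomness. -/
def stepLaw : Measure ((Fin m → ℝ) × (ℕ → Bool)) :=
  M.positionLaw.prod (Measure.infinitePi fun _ : ℕ => M.coinLaw)

instance : IsProbabilityMeasure M.stepLaw := by
  unfold stepLaw; infer_instance

theorem coinLaw_true : M.coinLaw {true} = ENNReal.ofReal M.p := by
  simp [coinLaw]

/-- Given the past, linking to all of `F` is a condition on the new position times a condition on
the `F.card` coins, and these are independent. -/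
theorem real_stepLaw_linkSet (F : Finset ℕ) (τ : ℕ) (s : Outcome m)
    (h : ∀ v ∈ F, v ∈ Finset.Icc 1 τ) : M.stepLaw.real (M.linkSet F τ s) =
      M.p ^ F.card * M.positionLaw.real (⋂ v ∈ F, M.influence s (M.edges s τ) v τ) := by
  have hset : M.linkSet F τ s =
      (⋂ v ∈ F, M.influence s (M.edges s τ) v τ) ×ˢ (Set.pi (F : Set ℕ) fun _ => {true}) := by
    ext y
    simp only [linkSet, Set.mem_ofPred_eq, Set.mem_prod, Set.mem_iInter, Set.mem_pi,
      Finset.mem_coe, Set.mem_singleton_iff]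
    exact ⟨fun hy => ⟨fun v hv => (hy v hv).2.1, fun v hv => (hy v hv).2.2⟩,
      fun hy v hv => ⟨h v hv, hy.1 v hv, hy.2 v hv⟩⟩
  rw [hset, stepLaw, measureReal_def, Measure.prod_prod,
    Measure.infinitePi_pi _ (fun i _ => measurableSet_singleton true)]
  simp only [M.coinLaw_true, Finset.prod_const, ENNReal.toReal_mul, ENNReal.toReal_pow,
    ENNReal.toReal_ofReal M.p_pos.le]
  rw [mul_comm, measureReal_def]

theorem linkSet_eq_empty (F : Finset ℕ) (τ : ℕ) (s : Outcome m)
    (h : ¬ ∀ v ∈ F, v ∈ Finset.Icc 1 τ) : M.linkSet F τ s = ∅ := by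
  push Not at h
  obtain ⟨v, hv, hvτ⟩ := h
  exact Set.eq_empty_of_forall_notMem fun y hy => hvτ (hy v hv).1

theorem degIn_succ (s : Outcome m) (v t : ℕ) : M.degIn s v (t + 1) =
    M.degIn s v t + if (t + 1, v) ∈ M.edges s (t + 1) then 1 else 0 := by
  have hnot : (t + 1, v) ∉ M.edges s t := fun h => by
    have := M.edges_bounds s t _ h
    simp only at this
    omega
  unfold degIn inDeg
  split_ifs with h
  · have : (M.edges s (t + 1)).filter (fun e => e.2 = v) =
        insert (t + 1, v) ((M.edges s t).filter fun e => e.2 = v) := by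
      ext e
      simp only [Finset.mem_filter, Finset.mem_insert]
      by_cases he : e.1 = t + 1
      · have h1 : e ∉ M.edges s t := fun h => by
          have := M.edges_bounds s t _ h
          omega
        constructor
        · rintro ⟨-, h3⟩
          exact Or.inl (Prod.ext he h3)
        · rintro (h3 | h3)
          · rw [h3]; exact ⟨h, rfl⟩
          · exact absurd h3.1 h1
      · rw [M.mem_edges_succ_of_ne s t e he]
        constructor
        · exact Or.inr
        · rintro (h3 | h3)
          · exact absurd (by rw [h3]) he
          · exact h3
    rw [this, Finset.card_insert_of_notMem (by simp [hnot])]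
  · have : (M.edges s (t + 1)).filter (fun e => e.2 = v) =
        (M.edges s t).filter fun e => e.2 = v := by
      ext e
      simp only [Finset.mem_filter]
      refine and_congr_left fun hev => ⟨fun he => ?_, fun he => M.edges_mono s t.le_succ he⟩
      refine (M.mem_edges_succ_of_ne s t e fun he1 => h ?_).mp he
      rwa [show (t + 1, v) = e from (Prod.ext he1 hev).symm]
    rw [this, add_zero]

theorem commonNbrs_succ (s : Outcome m) (u v t : ℕ) : M.commonNbrs s u v (t + 1) =
    M.commonNbrs s u v t +
      if (t + 1, u) ∈ M.edges s (t + 1) ∧ (t + 1, v) ∈ M.edges s (t + 1) then 1 else 0 := by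
  have hsub : (Finset.Icc 1 t).filter (fun w => (w, u) ∈ M.edges s (t + 1) ∧
      (w, v) ∈ M.edges s (t + 1)) =
      (Finset.Icc 1 t).filter (fun w => (w, u) ∈ M.edges s t ∧ (w, v) ∈ M.edges s t) := by
    refine Finset.filter_congr fun w hw => ?_
    rw [Finset.mem_Icc] at hw
    rw [M.mem_edges_succ_of_ne s t (w, u) (by simp; omega),
      M.mem_edges_succ_of_ne s t (w, v) (by simp; omega)]
  have hI : Finset.Icc 1 (t + 1) = insert (t + 1) (Finset.Icc 1 t) := by
    ext i; simp; omega
  unfold commonNbrs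
  rw [hI, Finset.filter_insert, hsub]
  split_ifs with h
  · rw [Finset.card_insert_of_notMem (by simp)]
  · rfl

end SPAModel

/-! ### The good event and its probability -/

namespace SPAModel

variable {m κ : ℕ} (M : SPAModel m κ)

/-- Trades the logarithmic weights of the exponential bound for linear ones at a quadratic cost;
applied to `w` and `-w` it yields a two-sided estimate. -/
theorem le_log_one_add {w : ℝ} (hw : |w| ≤ 1 / 2) : w - 2 * w ^ 2 ≤ Real.log (1 + w) := by
  rw [abs_le] at hw
  have h0 : 0 < 1 + w := by linarith
  have h := Real.one_sub_inv_le_log_of_pos h0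
  refine le_trans ?_ h
  rw [le_sub_iff_add_le, ← le_sub_iff_add_le', inv_le_iff_one_le_mul₀ h0]
  nlinarith [sq_nonneg w, mul_nonneg (sq_nonneg w) (by linarith : 0 ≤ 1 / 2 + w)]

/-- The indicator of the event that `v_{τ+1}` links to all nodes of `F`. -/
def linkInd (F : Finset ℕ) (τ : ℕ) (s : Outcome m) : ℝ :=
  (M.linkSet F τ s).indicator (fun _ => 1) (s (τ + 1))

/-- The conditional probability that `v_{τ+1}` links to all nodes of `F`. -/
def linkProb (F : Finset ℕ) (τ : ℕ) (s : Outcome m) : ℝ := M.stepLaw.real (M.linkSet F τ s)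

theorem linkInd_eq (F : Finset ℕ) (τ : ℕ) (s : Outcome m) :
    M.linkInd F τ s = 0 ∨ M.linkInd F τ s = 1 := by
  unfold linkInd
  by_cases h : s (τ + 1) ∈ M.linkSet F τ s
  · right; rw [Set.indicator_of_mem h]
  · left; rw [Set.indicator_of_notMem h]

/-- Concentration of a weighted number of links about its compensator. -/
theorem law_concentration (F : Finset ℕ) (W : ℕ → Outcome m → ℝ) (hW : ∀ t, Measurable (W t))
    (hW1 : ∀ t s, |W t s| ≤ 1 / 2)
    (hWloc : ∀ t k, t < k → ∀ s y, W t (Function.update s k y) = W t s) (t : ℕ) (x : ℝ) :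
    M.law {s | ¬ |∑ τ ∈ Finset.range t, W τ s * (M.linkInd F τ s - M.linkProb F τ s)| ≤
      2 * (∑ τ ∈ Finset.range t, W τ s ^ 2 * M.linkInd F τ s) + x} ≤
      2 * ENNReal.ofReal (Real.exp (-x)) := by
  have key := fun (W : ℕ → Outcome m → ℝ) (hW : ∀ t, Measurable (W t))
      (hW1 : ∀ t s, |W t s| ≤ 1 / 2)
      (hWloc : ∀ t k, t < k → ∀ s y, W t (Function.update s k y) = W t s) =>
    measure_le_exp_neg M.stepLaw (fun τ s => M.linkSet F τ s) (M.measurableSet_linkSet F)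
      (fun t k htk s y => M.linkSet_update F s y htk) W hW
      (fun t s => by have := abs_le.mp (hW1 t s); linarith) hWloc t x
  have h1 := key W hW hW1 hWloc
  have h2 := key (fun τ s => -W τ s) (fun t => (hW t).neg) (fun t s => by rw [abs_neg]; exact hW1 t s)
    (fun t k htk s y => by rw [hWloc t k htk])
  have hpt : ∀ (w : ℝ) (τ : ℕ) (s : Outcome m), |w| ≤ 1 / 2 →
      w * (M.linkInd F τ s - M.linkProb F τ s) - 2 * (w ^ 2 * M.linkInd F τ s) ≤
      (M.linkSet F τ s).indicator (fun _ => Real.log (1 + w)) (s (τ + 1)) -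
        w * M.stepLaw.real (M.linkSet F τ s) := by
    intro w τ s hw
    have hl := le_log_one_add hw
    unfold linkInd linkProb
    by_cases h : s (τ + 1) ∈ M.linkSet F τ s
    · rw [Set.indicator_of_mem h, Set.indicator_of_mem h]; linarith
    · rw [Set.indicator_of_notMem h, Set.indicator_of_notMem h]; linarith
  rw [two_mul]
  refine le_trans (le_trans (measure_mono ?_) (measure_union_le _ _)) (add_le_add h1 h2)
  intro s hs
  rw [Set.mem_ofPred_eq, not_le, lt_abs] at hs
  rcases hs with hs | hs
  · left
    rw [Set.mem_ofPred_eq]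
    have := Finset.sum_le_sum fun τ (_ : τ ∈ Finset.range t) => hpt (W τ s) τ s (hW1 τ s)
    rw [Finset.sum_sub_distrib, ← Finset.mul_sum] at this
    linarith
  · right
    rw [Set.mem_ofPred_eq]
    have := Finset.sum_le_sum fun τ (_ : τ ∈ Finset.range t) =>
      hpt (-W τ s) τ s (by rw [abs_neg]; exact hW1 τ s)
    rw [Finset.sum_sub_distrib, ← Finset.mul_sum] at this
    simp only [neg_mul, Finset.sum_neg_distrib, neg_sq] at this ⊢
    linarith

/-- The in-degree, shifted so that the volumes of the spheres of influence are proportional to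
it. -/
def sdeg (s : Outcome m) (v t : ℕ) : ℝ := M.degIn s v t + M.A₂ / M.A₁

theorem degIn_mono (s : Outcome m) (v : ℕ) : Monotone (M.degIn s v) :=
  monotone_nat_of_le_succ fun t => by rw [M.degIn_succ]; omega

theorem sdeg_pos (s : Outcome m) (v t : ℕ) : 0 < M.sdeg s v t := by
  have := M.A₁_pos
  have := M.A₂_pos
  unfold sdeg
  positivity

theorem sdeg_mono (s : Outcome m) (v : ℕ) : Monotone (M.sdeg s v) := fun a b h => by
  unfold sdeg
  have : (M.degIn s v a : ℝ) ≤ M.degIn s v b := by exact_mod_cast M.degIn_mono s v h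
  linarith

/-- The good event: all weighted numbers of links up to time `n` are close to their
compensators. -/
def Good (n : ℕ) (lam : ℝ) (s : Outcome m) : Prop :=
  (∀ v ∈ Finset.Icc 1 n, ∀ t₀ ∈ Finset.range (n + 1), ∀ t₁ ∈ Finset.range (n + 1),
    |∑ τ ∈ Finset.range t₁, (if t₀ ≤ τ then lam * M.sdeg s v t₀ / M.sdeg s v τ else 0) *
      (M.linkInd {v} τ s - M.linkProb {v} τ s)| ≤
    2 * (∑ τ ∈ Finset.range t₁, (if t₀ ≤ τ then lam * M.sdeg s v t₀ / M.sdeg s v τ else 0) ^ 2 *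
      M.linkInd {v} τ s) + 4 * Real.log n) ∧
  ∀ u ∈ Finset.Icc 1 n, ∀ v ∈ Finset.Icc 1 n,
    ∀ t₀ ∈ Finset.range (n + 1), ∀ t₁ ∈ Finset.range (n + 1),
    |∑ τ ∈ Finset.range t₁, (if t₀ ≤ τ then lam else 0) *
      (M.linkInd {u, v} τ s - M.linkProb {u, v} τ s)| ≤
    2 * (∑ τ ∈ Finset.range t₁, (if t₀ ≤ τ then lam else 0) ^ 2 *
      M.linkInd {u, v} τ s) + 5 * Real.log n

theorem measure_biUnion_le_card {Ω ι : Type*} [MeasurableSpace Ω] (μ : Measure Ω) (I : Finset ι)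
    (B : ι → Set Ω) (c : ENNReal) (h : ∀ i ∈ I, μ (B i) ≤ c) :
    μ {s | ∃ i ∈ I, s ∈ B i} ≤ I.card * c := by
  have : {s | ∃ i ∈ I, s ∈ B i} = ⋃ i ∈ I, B i := by
    ext s; simp
  rw [this]
  refine (measure_biUnion_finset_le I B).trans ((Finset.sum_le_sum h).trans_eq ?_)
  rw [Finset.sum_const, nsmul_eq_mul]

/-- A union bound over about `n^3` triples and `n^4` quadruples, which is why the deviations are `4
log n` and `5 log n`: each family then fails with probability `O(1/n)`. Pairs with equal entries are
included, so the second family also controls the unweighted number of links to a single node. -/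
theorem law_not_good_le {n : ℕ} (hn : 1 ≤ n) {lam : ℝ} (hl0 : 0 ≤ lam) (hl : lam ≤ 1 / 2) :
    M.law {s | ¬ M.Good n lam s} ≤ ENNReal.ofReal (16 / n) := by
  have hn' : (0 : ℝ) < n := by exact_mod_cast hn
  set I := Finset.Icc 1 n
  set J := Finset.range (n + 1)
  set B1 : ℕ × ℕ × ℕ → Set (Outcome m) := fun i => {s | ¬ |∑ τ ∈ Finset.range i.2.2,
      (if i.2.1 ≤ τ then lam * M.sdeg s i.1 i.2.1 / M.sdeg s i.1 τ else 0) *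
      (M.linkInd {i.1} τ s - M.linkProb {i.1} τ s)| ≤
    2 * (∑ τ ∈ Finset.range i.2.2,
      (if i.2.1 ≤ τ then lam * M.sdeg s i.1 i.2.1 / M.sdeg s i.1 τ else 0) ^ 2 *
      M.linkInd {i.1} τ s) + 4 * Real.log n} with hB1
  set B2 : ℕ × ℕ × ℕ × ℕ → Set (Outcome m) := fun i => {s | ¬ |∑ τ ∈ Finset.range i.2.2.2,
      (if i.2.2.1 ≤ τ then lam else 0) *
      (M.linkInd {i.1, i.2.1} τ s - M.linkProb {i.1, i.2.1} τ s)| ≤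
    2 * (∑ τ ∈ Finset.range i.2.2.2, (if i.2.2.1 ≤ τ then lam else 0) ^ 2 *
      M.linkInd {i.1, i.2.1} τ s) + 5 * Real.log n} with hB2
  have hexp : ∀ k : ℕ, Real.exp (-(k * Real.log n)) = ((n : ℝ) ^ k)⁻¹ := by
    intro k
    rw [Real.exp_neg, ← Real.log_pow, Real.exp_log (by positivity)]
  have h1 : ∀ i ∈ I ×ˢ J ×ˢ J, M.law (B1 i) ≤ 2 * ENNReal.ofReal (((n : ℝ) ^ 4)⁻¹) := by
    rintro ⟨v, t₀, t₁⟩ -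
    have := M.law_concentration {v}
      (fun τ s => if t₀ ≤ τ then lam * M.sdeg s v t₀ / M.sdeg s v τ else 0)
      (fun τ => ?_) (fun τ s => ?_) (fun τ k hk s y => ?_) t₁ (4 * Real.log n)
    · rw [show (4 : ℝ) = ((4 : ℕ) : ℝ) by norm_num, hexp] at this
      exact this
    · by_cases h : t₀ ≤ τ
      · simp only [if_pos h]
        have hd : ∀ t, Measurable fun s : Outcome m => M.sdeg s v t := fun t =>
          M.measurable_of_edges t (fun E => (inDeg E v : ℝ) + M.A₂ / M.A₁)
        exact (measurable_const.mul (hd t₀)).div (hd τ)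
      · simp only [if_neg h]; exact measurable_const
    · by_cases h : t₀ ≤ τ
      · simp only [if_pos h]
        have h1 := M.sdeg_pos s v t₀
        have h2 := M.sdeg_mono s v h
        have h3 := M.sdeg_pos s v τ
        rw [abs_of_nonneg (by positivity), div_le_iff₀ (h1.trans_le h2)]
        nlinarith
      · simp only [if_neg h]; norm_num
    · by_cases h : t₀ ≤ τ
      · simp only [if_pos h, sdeg, degIn]
        rw [M.edges_update s y hk, M.edges_update s y (h.trans_lt hk)]
      · simp only [if_neg h]
  have h2 : ∀ i ∈ I ×ˢ I ×ˢ J ×ˢ J, M.law (B2 i) ≤ 2 * ENNReal.ofReal (((n : ℝ) ^ 5)⁻¹) := by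
    rintro ⟨u, v, t₀, t₁⟩ -
    have := M.law_concentration {u, v} (fun τ s => if t₀ ≤ τ then lam else 0)
      (fun τ => measurable_const) (fun τ s => ?_) (fun τ k hk s y => rfl) t₁ (5 * Real.log n)
    · rw [show (5 : ℝ) = ((5 : ℕ) : ℝ) by norm_num, hexp] at this
      exact this
    · by_cases h : t₀ ≤ τ
      · simp only [if_pos h, abs_of_nonneg hl0, hl]
      · simp only [if_neg h]; norm_num
  have hsub : {s | ¬ M.Good n lam s} ⊆
      {s | ∃ i ∈ I ×ˢ J ×ˢ J, s ∈ B1 i} ∪ {s | ∃ i ∈ I ×ˢ I ×ˢ J ×ˢ J, s ∈ B2 i} := by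
    intro s hs
    by_contra hcon
    rw [Set.mem_union, not_or] at hcon
    obtain ⟨hc1, hc2⟩ := hcon
    apply hs
    refine ⟨fun v hv t₀ ht₀ t₁ ht₁ => ?_, fun u hu v hv t₀ ht₀ t₁ ht₁ => ?_⟩
    · by_contra hbad
      exact hc1 ⟨(v, t₀, t₁), by simp only [Finset.mem_product]; exact ⟨hv, ht₀, ht₁⟩, hbad⟩
    · by_contra hbad
      exact hc2 ⟨(u, v, t₀, t₁), by simp only [Finset.mem_product]; exact ⟨hu, hv, ht₀, ht₁⟩, hbad⟩
  refine (measure_mono hsub).trans ((measure_union_le _ _).trans ((add_le_add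
    (measure_biUnion_le_card _ _ _ _ h1) (measure_biUnion_le_card _ _ _ _ h2)).trans ?_))
  simp only [Finset.card_product, I, J, Nat.card_Icc, Finset.card_range, Nat.add_sub_cancel]
  rw [← ENNReal.ofReal_ofNat 2, ← ENNReal.ofReal_mul (by norm_num),
    ← ENNReal.ofReal_mul (by norm_num), ← ENNReal.ofReal_natCast, ← ENNReal.ofReal_natCast,
    ← ENNReal.ofReal_mul (by positivity), ← ENNReal.ofReal_mul (by positivity),
    ← ENNReal.ofReal_add (by positivity) (by positivity)]
  refine ENNReal.ofReal_le_ofReal ?_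
  have h3 : ((n : ℝ) + 1) * (n + 1) ≤ 4 * n ^ 2 := by
    have : (1 : ℝ) ≤ n := by exact_mod_cast hn
    nlinarith
  push_cast
  set N : ℝ := (n : ℝ)
  calc N * ((N + 1) * (N + 1)) * (2 * (N ^ 4)⁻¹) +
        N * (N * ((N + 1) * (N + 1))) * (2 * (N ^ 5)⁻¹)
      ≤ N * (4 * N ^ 2) * (2 * (N ^ 4)⁻¹) + N * (N * (4 * N ^ 2)) * (2 * (N ^ 5)⁻¹) := by
        gcongr
    _ = 16 / N := by field_simp; ring

end SPAModel

/-! ### Power laws for growth paths -/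

namespace SPAModel

theorem log_div_le_sum_inv {t₀ t₁ : ℕ} (h0 : 1 ≤ t₀) (h : t₀ ≤ t₁) :
    Real.log t₁ - Real.log t₀ ≤ ∑ τ ∈ Finset.Ico t₀ t₁, 1 / (τ : ℝ) := by
  induction t₁, h using Nat.le_induction with
  | base => simp
  | succ t ht ih =>
    rw [Finset.sum_Ico_succ_top ht]
    have ht0 : (0 : ℝ) < t := by exact_mod_cast (by omega : 0 < t)
    have h1 : Real.log ((t + 1 : ℕ) : ℝ) - Real.log t ≤ 1 / t := by
      rw [← Real.log_div (by positivity) ht0.ne']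
      refine (Real.log_le_sub_one_of_pos (by positivity)).trans_eq ?_
      push_cast
      field_simp
      ring
    linarith

theorem sum_inv_le_log_div {t₀ t₁ : ℕ} (h0 : 1 ≤ t₀) (h : t₀ ≤ t₁) :
    ∑ τ ∈ Finset.Ico t₀ t₁, 1 / (τ : ℝ) ≤ Real.log t₁ - Real.log t₀ + 1 / t₀ := by
  have h00 : (0 : ℝ) < t₀ := by exact_mod_cast (by omega : 0 < t₀)
  suffices hs : ∑ τ ∈ Finset.Ico t₀ t₁, 1 / (τ : ℝ) ≤
      Real.log t₁ - Real.log t₀ + (1 / t₀ - 1 / t₁) by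
    have : (0 : ℝ) ≤ 1 / t₁ := by positivity
    linarith
  induction t₁, h using Nat.le_induction with
  | base => simp
  | succ t ht ih =>
    rw [Finset.sum_Ico_succ_top ht]
    have ht0 : (0 : ℝ) < t := by exact_mod_cast (by omega : 0 < t)
    have h1 : 1 / ((t + 1 : ℕ) : ℝ) ≤ Real.log ((t + 1 : ℕ) : ℝ) - Real.log t := by
      rw [← Real.log_div (by positivity) ht0.ne']
      refine le_trans (le_of_eq ?_) (Real.one_sub_inv_le_log_of_pos (by positivity))
      push_cast
      field_simp
      ring
    linarith

/-- A sequence of shifted in-degrees whose logarithm grows, up to an error `e`, at the rate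
`γ τ / τ`, once it has reached the level `N`. -/
structure GrowthPath (D γ : ℕ → ℝ) (n : ℕ) (N e : ℝ) : Prop where
  pos : ∀ t, 0 < D t
  mono : Monotone D
  step : ∀ t, D (t + 1) ≤ D t + 1
  growth : ∀ t₀ t₁, t₀ ≤ t₁ → t₁ ≤ n → N ≤ D t₀ →
    |Real.log (D t₁) - Real.log (D t₀) - ∑ τ ∈ Finset.Ico t₀ t₁, γ τ / τ| ≤ e

namespace GrowthPath

variable {D γ : ℕ → ℝ} {n : ℕ} {N e : ℝ}

/-- Growth at a constant rate, as long as the volumes stay below a threshold `B`; they do so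
forever if they are below it once, with a margin. -/
theorem forward (P : GrowthPath D γ n N e) {a A B : ℝ} (ha : 0 ≤ a) (ha1 : a ≤ 1)
    (hreg : ∀ τ, N ≤ D τ → Real.log A + Real.log (D τ) - Real.log τ < B → γ τ = a)
    {t₀ : ℕ} (ht₀ : 1 ≤ t₀) (hN : N ≤ D t₀)
    (h0 : Real.log A + Real.log (D t₀) - Real.log t₀ + (e + 1 / t₀) < B) {t : ℕ} (ht : t₀ ≤ t)
    (htn : t ≤ n) :
    |Real.log (D t) - Real.log (D t₀) - a * (Real.log t - Real.log t₀)| ≤ e + 1 / t₀ ∧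
      Real.log A + Real.log (D t) - Real.log t < B := by
  -- As long as all earlier volumes are below the threshold, the rate is exactly `a`. Since `a ≤ 1`
  -- the volume of the power law does not increase, so the margin `e + 1 / t₀` reserved at the start
  -- keeps time `t` below the threshold as well.
  induction t using Nat.strong_induction_on with
  | _ t ih =>
    have hsum : ∑ τ ∈ Finset.Ico t₀ t, γ τ / τ = a * ∑ τ ∈ Finset.Ico t₀ t, 1 / (τ : ℝ) := by
      rw [Finset.mul_sum]
      refine Finset.sum_congr rfl fun τ hτ => ?_
      rw [Finset.mem_Ico] at hτ
      rw [hreg τ (hN.trans (P.mono hτ.1)) (ih τ hτ.2 hτ.1 (by omega)).2]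
      ring
    have hg := P.growth t₀ t ht htn hN
    rw [hsum] at hg
    have h1 := log_div_le_sum_inv ht₀ ht
    have h2 := sum_inv_le_log_div ht₀ ht
    have hpos : (0 : ℝ) < t₀ := by exact_mod_cast (by omega : 0 < t₀)
    have hlog : Real.log t₀ ≤ Real.log t := Real.log_le_log hpos (by exact_mod_cast ht)
    have hinv : (0 : ℝ) ≤ 1 / t₀ := by positivity
    set S := ∑ τ ∈ Finset.Ico t₀ t, 1 / (τ : ℝ)
    rw [abs_le] at hg ⊢
    have h3 : a * (Real.log t - Real.log t₀) ≤ a * S := mul_le_mul_of_nonneg_left h1 ha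
    have h4 : a * S ≤ a * (Real.log t - Real.log t₀) + 1 / t₀ := by
      have : a * S ≤ a * (Real.log t - Real.log t₀ + 1 / t₀) := mul_le_mul_of_nonneg_left h2 ha
      nlinarith
    have h5 : a * (Real.log t - Real.log t₀) ≤ 1 * (Real.log t - Real.log t₀) :=
      mul_le_mul_of_nonneg_right ha1 (by linarith)
    refine ⟨⟨by linarith, by linarith⟩, by linarith⟩

/-- A path follows backwards the power law extrapolated from its final value, as long as the
extrapolated volumes stay below the threshold `B`. -/
theorem backward (P : GrowthPath D γ n N e) (he : 0 ≤ e) {a A B c : ℝ} (ha : 0 ≤ a) (ha1 : a ≤ 1)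
    (hN0 : 0 < N)
    (hreg : ∀ τ, N ≤ D τ → Real.log A + Real.log (D τ) - Real.log τ < B → γ τ = a)
    {T : ℕ} (hT : 1 ≤ T) (hTn : T ≤ n)
    (hB : Real.log A + (Real.log (D n) - a * (Real.log n - Real.log T)) - Real.log T + c ≤ B)
    (hN : Real.log (N + 1) + c ≤ Real.log (D n) - a * (Real.log n - Real.log T))
    (hc : 2 * e + 3 / T < c) {t : ℕ} (ht : T ≤ t) (htn : t ≤ n) :
    |Real.log (D t) - (Real.log (D n) - a * (Real.log n - Real.log t))| ≤ e + 1 / T ∧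
      N ≤ D t ∧ Real.log A + Real.log (D t) - Real.log t < B := by
  have hTpos : (0 : ℝ) < T := by exact_mod_cast (by omega : 0 < T)
  have hTinv : (0 : ℝ) < 1 / T := by positivity
  have h3T : 3 / (T : ℝ) = 3 * (1 / T) := by ring
  rw [h3T] at hc
  have hmonolog : ∀ {x y : ℕ}, T ≤ x → x ≤ y → Real.log x ≤ Real.log y := fun hx hxy =>
    Real.log_le_log (by exact_mod_cast (by omega : 0 < _)) (by exact_mod_cast hxy)
  have hinv : ∀ x : ℕ, T ≤ x → (1 : ℝ) / x ≤ 1 / T := fun x hx =>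
    one_div_le_one_div_of_le hTpos (by exact_mod_cast hx)
  have ha1' : 0 ≤ 1 - a := by linarith
  -- the conclusion from a margin at time `x`
  have key : ∀ x : ℕ, T ≤ x → x ≤ n → N ≤ D x →
      Real.log A + Real.log (D x) - Real.log x + (e + 1 / T) < B →
      |Real.log (D x) - (Real.log (D n) - a * (Real.log n - Real.log x))| ≤ e + 1 / T := by
    intro x hx hxn hNx hBx
    have h := (P.forward ha ha1 hreg (by omega) hNx (by linarith [hinv x hx]) hxn le_rfl).1
    have h2 := hinv x hx
    rw [abs_le] at h ⊢
    constructor <;> linarith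
  have htarget : ∀ x : ℕ, T ≤ x → x ≤ n → Real.log (N + 1) + c ≤
      Real.log (D n) - a * (Real.log n - Real.log x) := by
    intro x hx hxn
    have := mul_le_mul_of_nonneg_left (hmonolog le_rfl hx) ha
    linarith
  have hvol : ∀ x : ℕ, T ≤ x → x ≤ n → Real.log A +
      (Real.log (D n) - a * (Real.log n - Real.log x)) - Real.log x + c ≤ B := by
    intro x hx hxn
    have := mul_le_mul_of_nonneg_left (hmonolog le_rfl hx) ha1'
    linarith
  have hNn : N ≤ D n := by
    have h := htarget n hTn le_rfl
    rw [sub_self, mul_zero, sub_zero] at h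
    have h2 : Real.log (N + 1) ≤ Real.log (D n) := by linarith
    have := (Real.log_le_log_iff (by linarith) (P.pos n)).mp h2
    linarith
  -- At the first time the level `N` is reached, unit steps give a value at most `N + 1`, hence a
  -- small volume. The forward power law from there to `n` then puts the path near its
  -- extrapolation, which lies above `N + 1` with margin `c`: a contradiction.
  have hND : ∀ x : ℕ, T ≤ x → x ≤ n → N ≤ D x := by
    intro x hx hxn
    by_contra hcon
    rw [not_le] at hcon
    have hex : ∃ y, x ≤ y ∧ N ≤ D y := ⟨n, hxn, hNn⟩
    classical
    set y := Nat.find hex with hy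
    obtain ⟨hxy, hNy⟩ := Nat.find_spec hex
    have hyn : y ≤ n := Nat.find_min' hex ⟨hxn, hNn⟩
    have hxy' : x < y := lt_of_le_of_ne hxy fun h => by
      rw [← hy, ← h] at hNy
      linarith
    have hprev : D (y - 1) < N := by
      by_contra hcon2
      exact Nat.find_min hex (show y - 1 < Nat.find hex by omega) ⟨by omega, not_lt.mp hcon2⟩
    have hDy : D y ≤ N + 1 := by
      have := P.step (y - 1)
      rw [show y - 1 + 1 = y by omega] at this
      linarith
    have hlogDy : Real.log (D y) ≤ Real.log (N + 1) := Real.log_le_log (P.pos y) hDy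
    have h1 := htarget y (by omega) hyn
    have h2 := hvol y (by omega) hyn
    have h3 := key y (by omega) hyn hNy (by linarith)
    rw [abs_le] at h3
    linarith [h3.1]
  -- Consider the first time `y` at which the volume is below the threshold with margin. There it
  -- agrees with the extrapolation, so it lies below `B` by nearly `c`; one step earlier it was
  -- above `B - (e + 1 / T)`. In one step the log volume drops by at most `1 / T`, which is
  -- impossible when `c > 2 e + 3 / T`.
  have hVB : ∀ x : ℕ, T ≤ x → x ≤ n →
      Real.log A + Real.log (D x) - Real.log x + (e + 1 / T) < B := by
    intro x hx hxn
    by_contra hcon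
    rw [not_lt] at hcon
    have hn2 : Real.log A + Real.log (D n) - Real.log n + (e + 1 / T) < B := by
      have := hvol n hTn le_rfl
      rw [sub_self, mul_zero, sub_zero] at this
      linarith
    have hex : ∃ y, x ≤ y ∧ Real.log A + Real.log (D y) - Real.log y + (e + 1 / T) < B :=
      ⟨n, hxn, hn2⟩
    classical
    set y := Nat.find hex with hy
    obtain ⟨hxy, hNy⟩ := Nat.find_spec hex
    have hyn : y ≤ n := Nat.find_min' hex ⟨hxn, hn2⟩
    have hxy' : x < y := lt_of_le_of_ne hxy fun h => by
      rw [← hy, ← h] at hNy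
      linarith
    have hprev : B ≤ Real.log A + Real.log (D (y - 1)) - Real.log ((y - 1 : ℕ) : ℝ) +
        (e + 1 / T) := by
      by_contra hcon2
      exact Nat.find_min hex (show y - 1 < Nat.find hex by omega) ⟨by omega, not_le.mp hcon2⟩
    have hD : Real.log (D (y - 1)) ≤ Real.log (D y) :=
      Real.log_le_log (P.pos _) (P.mono (by omega))
    have hl : Real.log y - Real.log ((y - 1 : ℕ) : ℝ) ≤ 1 / T := by
      have h1 := log_div_le_sum_inv (t₀ := y - 1) (t₁ := y) (by omega) (by omega)
      have h2 : Finset.Ico (y - 1) y = {y - 1} := by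
        ext i; simp; omega
      rw [h2, Finset.sum_singleton] at h1
      exact h1.trans (hinv _ (by omega))
    have h2 := hvol y (by omega) hyn
    have h3 := key y (by omega) hyn (hND y (by omega) hyn) hNy
    rw [abs_le] at h3
    linarith [h3.2]
  have hB' := hVB t ht htn
  exact ⟨key t ht htn (hND t ht htn) hB', hND t ht htn, by linarith⟩

end GrowthPath

end SPAModel

/-! ### Comparison with a one-dimensional flow -/

namespace SPAModel

section Potential

variable {G : ℝ → ℝ} {g : ℝ}

theorem continuous_of_abs_sub_le (hGL : ∀ x y, |G x - G y| ≤ 2 * |x - y|) : Continuous G :=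
  (LipschitzWith.of_dist_le_mul (K := 2) fun x y => by
    simpa [Real.dist_eq] using hGL x y).continuous

theorem inv_one_sub_le (hg : g < 1) (hG1 : ∀ x, G x ≤ g) (x : ℝ) : 1 / (1 - G x) ≤ 1 / (1 - g) :=
  one_div_le_one_div_of_le (by linarith) (by linarith [hG1 x])

theorem one_le_inv_one_sub (hg : g < 1) (hG0 : ∀ x, 0 ≤ G x) (hG1 : ∀ x, G x ≤ g) (x : ℝ) :
    1 ≤ 1 / (1 - G x) := by
  rw [le_div_iff₀ (by linarith [hG1 x])]
  linarith [hG0 x]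

theorem continuous_inv_one_sub (hg : g < 1) (hG1 : ∀ x, G x ≤ g)
    (hGL : ∀ x y, |G x - G y| ≤ 2 * |x - y|) : Continuous fun x => 1 / (1 - G x) :=
  continuous_const.div (continuous_const.sub (continuous_of_abs_sub_le hGL))
    fun x => by linarith [hG1 x]

theorem abs_inv_one_sub_sub_le (hg : g < 1) (hG1 : ∀ x, G x ≤ g)
    (hGL : ∀ x y, |G x - G y| ≤ 2 * |x - y|) (x y : ℝ) :
    |1 / (1 - G x) - 1 / (1 - G y)| ≤ 2 * (1 / (1 - g)) ^ 2 * |x - y| := by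
  have hx : 0 < 1 - G x := by linarith [hG1 x]
  have hy : 0 < 1 - G y := by linarith [hG1 y]
  have h1 : 1 / (1 - G x) - 1 / (1 - G y) = (G x - G y) * (1 / (1 - G x) * (1 / (1 - G y))) := by
    field_simp
    ring
  have h2 : 1 / (1 - G x) * (1 / (1 - G y)) ≤ (1 / (1 - g)) ^ 2 := by
    rw [sq]
    have := inv_one_sub_le hg hG1 x
    have := inv_one_sub_le hg hG1 y
    have : 0 < 1 / (1 - G y) := by positivity
    gcongr
  rw [h1, abs_mul, abs_of_pos (by positivity : 0 < 1 / (1 - G x) * (1 / (1 - G y)))]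
  calc |G x - G y| * (1 / (1 - G x) * (1 / (1 - G y)))
      ≤ (2 * |x - y|) * (1 / (1 - g)) ^ 2 := by
        gcongr
        exact hGL x y
    _ = _ := by ring

/-- The integral of `1 / (1 - G)` along a sequence which decreases at the rate
`(1 - G) / τ`, up to errors. -/
theorem abs_integral_add_sum_le (hg : g < 1) (hG0 : ∀ x, 0 ≤ G x) (hG1 : ∀ x, G x ≤ g)
    (hGL : ∀ x y, |G x - G y| ≤ 2 * |x - y|) {l γ κ : ℕ → ℝ} {t₀ T : ℕ} (ht₀ : 1 ≤ t₀)
    (hT : t₀ ≤ T) {e : ℝ}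
    (hl : ∀ t, t₀ ≤ t → t ≤ T → |l t - l t₀ + ∑ τ ∈ Finset.Ico t₀ t, (1 - γ τ) / τ| ≤ e)
    (hγ0 : ∀ τ, 0 ≤ γ τ) (hγ1 : ∀ τ, γ τ ≤ 1)
    (hκ : ∀ τ, t₀ ≤ τ → τ < T → |γ τ - G (l τ)| ≤ κ τ) :
    |(∫ x in l t₀..l T, 1 / (1 - G x)) + ∑ τ ∈ Finset.Ico t₀ T, 1 / (τ : ℝ)| ≤
      2 * (1 / (1 - g)) ^ 2 * ((∑ τ ∈ Finset.Ico t₀ T, κ τ / τ) +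
        (e + 1 / t₀) * ((∑ τ ∈ Finset.Ico t₀ T, 1 / (τ : ℝ)) + 1)) := by
  set f : ℝ → ℝ := fun x => 1 / (1 - G x) with hf
  set F := 1 / (1 - g) with hF
  have hfc : Continuous f := continuous_inv_one_sub hg hG1 hGL
  have hfi : ∀ a b, IntervalIntegrable f volume a b := fun a b => hfc.intervalIntegrable a b
  have hfF : ∀ x, f x ≤ F := inv_one_sub_le hg hG1
  have hf1 : ∀ x, 1 ≤ f x := one_le_inv_one_sub hg hG0 hG1
  have hF1 : 1 ≤ F := (hf1 0).trans (hfF 0)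
  have hfL : ∀ x y, |f x - f y| ≤ 2 * F ^ 2 * |x - y| := abs_inv_one_sub_sub_le hg hG1 hGL
  have he : 0 ≤ e := (abs_nonneg _).trans (hl t₀ le_rfl hT)
  -- A smoothed copy of `l`: it stays within `e` of `l` but moves by at most `1 / t₀` per step, so
  -- that the integrand is nearly constant over each step. The sequence `l` itself may fluctuate too
  -- much for a termwise comparison.
  set q : ℕ → ℝ := fun t => l t₀ - ∑ τ ∈ Finset.Ico t₀ t, (1 - γ τ) / τ with hq
  have hqt₀ : q t₀ = l t₀ := by simp [hq]
  have hql : ∀ t, t₀ ≤ t → t ≤ T → |l t - q t| ≤ e := by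
    intro t h1 h2
    have := hl t h1 h2
    simp only [hq]
    rwa [show l t - (l t₀ - ∑ τ ∈ Finset.Ico t₀ t, (1 - γ τ) / τ) =
      l t - l t₀ + ∑ τ ∈ Finset.Ico t₀ t, (1 - γ τ) / τ by ring]
  have hmain : ∀ t, t₀ ≤ t → t ≤ T →
      |(∫ x in q t₀..q t, f x) + ∑ τ ∈ Finset.Ico t₀ t, 1 / (τ : ℝ)| ≤
        ∑ τ ∈ Finset.Ico t₀ t, (F * κ τ + 2 * F ^ 2 * (e + 1 / t₀)) / τ := by
    intro t h1
    induction t, h1 using Nat.le_induction with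
    | base => simp
    | succ t ht ih =>
      intro htT
      have htpos : (0 : ℝ) < t := by exact_mod_cast (by omega : 0 < t)
      have ht₀pos : (0 : ℝ) < t₀ := by exact_mod_cast (by omega : 0 < t₀)
      rw [Finset.sum_Ico_succ_top ht, Finset.sum_Ico_succ_top ht,
        ← intervalIntegral.integral_add_adjacent_intervals (hfi (q t₀) (q t)) (hfi _ _)]
      have hqs : q (t + 1) = q t - (1 - γ t) / t := by
        simp only [hq]
        rw [Finset.sum_Ico_succ_top ht]
        ring
      set h := (1 - γ t) / t with hh
      have hh0 : 0 ≤ h := div_nonneg (by linarith [hγ1 t]) htpos.le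
      have hh1 : h ≤ 1 / t := by
        rw [hh]; gcongr; linarith [hγ0 t]
      have hinv : (1 : ℝ) / t ≤ 1 / t₀ := one_div_le_one_div_of_le ht₀pos (by exact_mod_cast ht)
      have hstep : |(∫ x in q t..q (t + 1), f x) - (q (t + 1) - q t) * f (l t)| ≤
          2 * F ^ 2 * (e + 1 / t₀) * h := by
        have hconst : (∫ x in q t..q (t + 1), f x) - (q (t + 1) - q t) * f (l t) =
            ∫ x in q t..q (t + 1), (f x - f (l t)) := by
          rw [intervalIntegral.integral_sub (hfi _ _) (by simp),
            intervalIntegral.integral_const, smul_eq_mul]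
        rw [hconst, ← Real.norm_eq_abs]
        refine (intervalIntegral.norm_integral_le_of_norm_le_const
          (C := 2 * F ^ 2 * (e + 1 / t₀)) fun x hx => ?_).trans ?_
        · rw [Real.norm_eq_abs]
          refine (hfL _ _).trans ?_
          have hx' : |x - q t| ≤ 1 / t₀ := by
            rw [Set.uIoc_of_ge (by rw [hqs]; linarith)] at hx
            rw [hqs] at hx
            rw [abs_le]
            constructor <;> linarith [hx.1, hx.2, hh1, hinv]
          have := hql t ht (by omega)
          have h3 : |x - l t| ≤ e + 1 / t₀ := by
            rw [abs_le] at this hx' ⊢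
            constructor <;> linarith [this.1, this.2, hx'.1, hx'.2]
          gcongr
        · rw [hqs, show q t - h - q t = -h by ring, abs_neg, abs_of_nonneg hh0]
      -- If `γ t` were equal to `G (l t)`, the factor `f` would cancel the speed `1 - γ` and the
      -- increment would be exactly `-1 / t`.
      have hlin : |(q (t + 1) - q t) * f (l t) + 1 / t| ≤ F * κ t / t := by
        have h1G : 0 < 1 - G (l t) := by linarith [hG1 (l t)]
        have : (q (t + 1) - q t) * f (l t) + 1 / t = f (l t) * (γ t - G (l t)) / t := by
          rw [hqs, hh]
          simp only [hf]
          field_simp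
          ring
        rw [this, abs_div, abs_of_pos htpos, abs_mul, abs_of_nonneg (by linarith [hf1 (l t)])]
        have := hκ t ht (by omega)
        have h5 := hfF (l t)
        gcongr
      have hcomb : 2 * F ^ 2 * (e + 1 / t₀) * h ≤ 2 * F ^ 2 * (e + 1 / t₀) / t := by
        rw [div_eq_mul_one_div (2 * F ^ 2 * (e + 1 / t₀))]
        gcongr
      have hfin : (F * κ t + 2 * F ^ 2 * (e + 1 / t₀)) / t =
          F * κ t / t + 2 * F ^ 2 * (e + 1 / t₀) / t := add_div _ _ _
      have hih := ih (by omega)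
      rw [hfin]
      rw [abs_le] at hih hstep hlin ⊢
      constructor <;> linarith [hih.1, hih.2, hstep.1, hstep.2, hlin.1, hlin.2]
  have h1 := hmain T hT le_rfl
  have h2 : |∫ x in q T..l T, f x| ≤ F * e := by
    rw [← Real.norm_eq_abs]
    refine (intervalIntegral.norm_integral_le_of_norm_le_const (C := F) fun x _ => ?_).trans ?_
    · rw [Real.norm_eq_abs, abs_of_nonneg (by linarith [hf1 x])]; exact hfF x
    · have := hql T hT le_rfl
      gcongr
  rw [← hqt₀, ← intervalIntegral.integral_add_adjacent_intervals (hfi (q t₀) (q T)) (hfi _ _)]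
  have hsum : ∑ τ ∈ Finset.Ico t₀ T, (F * κ τ + 2 * F ^ 2 * (e + 1 / t₀)) / τ =
      F * (∑ τ ∈ Finset.Ico t₀ T, κ τ / τ) +
        2 * F ^ 2 * (e + 1 / t₀) * ∑ τ ∈ Finset.Ico t₀ T, 1 / (τ : ℝ) := by
    rw [Finset.mul_sum, Finset.mul_sum, ← Finset.sum_add_distrib]
    refine Finset.sum_congr rfl fun τ _ => ?_
    ring
  rw [hsum] at h1
  have hκ0 : 0 ≤ ∑ τ ∈ Finset.Ico t₀ T, κ τ / τ := Finset.sum_nonneg fun τ hτ => by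
    rw [Finset.mem_Ico] at hτ
    exact div_nonneg ((abs_nonneg _).trans (hκ τ hτ.1 hτ.2)) (by positivity)
  have hFF : F ≤ 2 * F ^ 2 := by nlinarith
  have h3 := mul_le_mul_of_nonneg_right hFF hκ0
  have h4 := mul_le_mul_of_nonneg_right hFF he
  have h5 : (0 : ℝ) ≤ 2 * F ^ 2 * (1 / t₀) := by positivity
  rw [abs_le] at h1 h2 ⊢
  constructor <;> nlinarith [h1.1, h1.2, h2.1, h2.2]

/-- Two sequences which both nearly follow the flow of `G` do not separate. -/
theorem sub_le_of_follow (hg : g < 1) (hG0 : ∀ x, 0 ≤ G x) (hG1 : ∀ x, G x ≤ g)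
    (hGL : ∀ x y, |G x - G y| ≤ 2 * |x - y|) {x₀ x₁ y₀ y₁ S E E' c : ℝ} (hc : 0 ≤ c)
    (h₀ : x₀ - y₀ ≤ c)
    (hx : |(∫ x in x₀..x₁, 1 / (1 - G x)) + S| ≤ E)
    (hy : |(∫ x in y₀..y₁, 1 / (1 - G x)) + S| ≤ E') :
    x₁ - y₁ ≤ 1 / (1 - g) * c + E + E' := by
  set f : ℝ → ℝ := fun x => 1 / (1 - G x) with hf
  have hfc : Continuous f := continuous_inv_one_sub hg hG1 hGL
  have hfi : ∀ a b, IntervalIntegrable f volume a b := fun a b => hfc.intervalIntegrable a b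
  have hfF : ∀ x, f x ≤ 1 / (1 - g) := inv_one_sub_le hg hG1
  have hf1 : ∀ x, 1 ≤ f x := one_le_inv_one_sub hg hG0 hG1
  have hE : 0 ≤ E := (abs_nonneg _).trans hx
  have hE' : 0 ≤ E' := (abs_nonneg _).trans hy
  have hF0 : 0 ≤ 1 / (1 - g) := by linarith [hf1 0, hfF 0]
  rcases le_total x₁ y₁ with h | h
  · have : 0 ≤ 1 / (1 - g) * c := mul_nonneg hF0 hc
    linarith
  have h1 : x₁ - y₁ ≤ ∫ x in y₁..x₁, f x := by
    have := intervalIntegral.integral_mono_on h (f := fun _ => (1 : ℝ)) (by simp) (hfi _ _)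
      fun x _ => hf1 x
    simpa using this
  have h2 : ∫ x in y₀..x₀, f x ≤ 1 / (1 - g) * c := by
    rcases le_total x₀ y₀ with h' | h'
    · rw [intervalIntegral.integral_symm]
      have := intervalIntegral.integral_nonneg h' (f := f) (μ := volume)
        fun x _ => by linarith [hf1 x]
      linarith [mul_nonneg hF0 hc]
    · have := intervalIntegral.integral_mono_on h' (g := fun _ => 1 / (1 - g)) (hfi _ _)
        (by simp) fun x _ => hfF x
      rw [intervalIntegral.integral_const, smul_eq_mul, mul_comm] at this
      exact this.trans (mul_le_mul_of_nonneg_left h₀ hF0)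
  -- In the coordinate given by the primitive of `f` the flow has unit speed in logarithmic time, so
  -- the gap between the two sequences is conserved up to the errors. The bounds `1 ≤ f ≤ 1 / (1 -
  -- g)` translate this back to the original coordinate.
  have h3 : ∫ x in y₁..x₁, f x =
      -(∫ x in y₀..y₁, f x) + (∫ x in y₀..x₀, f x) + ∫ x in x₀..x₁, f x := by
    rw [← intervalIntegral.integral_symm, intervalIntegral.integral_add_adjacent_intervals
      (hfi _ _) (hfi _ _), intervalIntegral.integral_add_adjacent_intervals (hfi _ _) (hfi _ _)]
  rw [abs_le] at hx hy
  linarith [hx.2, hy.1]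

end Potential

/-- A sum comparable to the integral of `x^(b-1)`. -/
theorem sum_rpow_div_le {b : ℝ} (hb : 0 < b) {t₀ T : ℕ} (ht₀ : 1 ≤ t₀) (hT : t₀ ≤ T) :
    ∑ τ ∈ Finset.Ico t₀ T, Real.exp (b * Real.log τ) / τ ≤ 2 / b * Real.exp (b * Real.log T) := by
  suffices h : ∑ τ ∈ Finset.Ico t₀ T, Real.exp (b * Real.log τ) / τ ≤
      2 / b * (Real.exp (b * Real.log T) - Real.exp (b * Real.log t₀)) by
    have : 0 ≤ 2 / b * Real.exp (b * Real.log t₀) := by positivity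
    linarith
  induction T, hT using Nat.le_induction with
  | base => simp
  | succ t ht ih =>
    rw [Finset.sum_Ico_succ_top ht]
    have htpos : (1 : ℝ) ≤ t := by exact_mod_cast (by omega : 1 ≤ t)
    have h1 : 1 / (2 * (t : ℝ)) ≤ Real.log ((t + 1 : ℕ) : ℝ) - Real.log t := by
      rw [← Real.log_div (by positivity) (by positivity)]
      refine le_trans ?_ (Real.one_sub_inv_le_log_of_pos (by positivity))
      push_cast
      rw [inv_div, one_sub_div (by positivity), div_le_div_iff₀ (by positivity) (by positivity)]
      linarith
    have h2 : b * (Real.log ((t + 1 : ℕ) : ℝ) - Real.log t) + 1 ≤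
        Real.exp (b * (Real.log ((t + 1 : ℕ) : ℝ) - Real.log t)) := Real.add_one_le_exp _
    have h3 : Real.exp (b * Real.log ((t + 1 : ℕ) : ℝ)) = Real.exp (b * Real.log t) *
        Real.exp (b * (Real.log ((t + 1 : ℕ) : ℝ) - Real.log t)) := by
      rw [← Real.exp_add]; ring_nf
    have h4 : Real.exp (b * Real.log t) / t ≤
        2 / b * (Real.exp (b * Real.log ((t + 1 : ℕ) : ℝ)) - Real.exp (b * Real.log t)) := by
      rw [h3]
      have h5 : b * (1 / (2 * (t : ℝ))) ≤
          Real.exp (b * (Real.log ((t + 1 : ℕ) : ℝ) - Real.log t)) - 1 := by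
        have := mul_le_mul_of_nonneg_left h1 hb.le
        linarith
      set X := Real.exp (b * Real.log t) with hX
      have hX0 : 0 < X := Real.exp_pos _
      calc X / t = 2 / b * (X * (b * (1 / (2 * (t : ℝ))))) := by field_simp
        _ ≤ 2 / b * (X * (Real.exp (b * (Real.log ((t + 1 : ℕ) : ℝ) - Real.log t)) - 1)) := by
            gcongr
        _ = _ := by ring
    linarith

end SPAModel

/-! ### From numbers of links to logarithms of degrees -/

namespace SPAModel

variable {m κ : ℕ} (M : SPAModel m κ)

theorem sum_range_ite {f : ℕ → ℝ} {t₀ t₁ : ℕ} :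
    ∑ τ ∈ Finset.range t₁, (if t₀ ≤ τ then f τ else 0) = ∑ τ ∈ Finset.Ico t₀ t₁, f τ := by
  rw [← Finset.sum_filter]
  congr 1
  ext i
  simp
  omega

theorem linkInd_single (s : Outcome m) (v τ : ℕ) :
    M.linkInd {v} τ s = M.sdeg s v (τ + 1) - M.sdeg s v τ := by
  unfold linkInd sdeg
  rw [M.degIn_succ]
  by_cases h : s (τ + 1) ∈ M.linkSet {v} τ s
  · have h2 := (M.mem_linkSet_iff {v} τ s).mp h v (by simp)
    rw [Set.indicator_of_mem h, if_pos h2]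
    push_cast; ring
  · have h2 : (τ + 1, v) ∉ M.edges s (τ + 1) := fun hc =>
      h ((M.mem_linkSet_iff {v} τ s).mpr (by simpa using hc))
    rw [Set.indicator_of_notMem h, if_neg h2]
    push_cast; ring

theorem linkInd_pair (s : Outcome m) (u v τ : ℕ) :
    M.linkInd {u, v} τ s = M.commonNbrs s u v (τ + 1) - M.commonNbrs s u v τ := by
  unfold linkInd
  rw [M.commonNbrs_succ]
  by_cases h : s (τ + 1) ∈ M.linkSet {u, v} τ s
  · have h2 := (M.mem_linkSet_iff {u, v} τ s).mp h
    rw [Set.indicator_of_mem h, if_pos ⟨h2 u (by simp), h2 v (by simp)⟩]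
    push_cast; ring
  · have h2 : ¬ ((τ + 1, u) ∈ M.edges s (τ + 1) ∧ (τ + 1, v) ∈ M.edges s (τ + 1)) := fun hc =>
      h ((M.mem_linkSet_iff {u, v} τ s).mpr (by simpa using hc))
    rw [Set.indicator_of_notMem h, if_neg h2]
    push_cast; ring

theorem sum_linkInd_single (s : Outcome m) (v : ℕ) {t₀ t₁ : ℕ} (h : t₀ ≤ t₁) :
    ∑ τ ∈ Finset.Ico t₀ t₁, M.linkInd {v} τ s = M.sdeg s v t₁ - M.sdeg s v t₀ := by
  simp only [linkInd_single]
  exact Finset.sum_Ico_sub (M.sdeg s v) h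

theorem sum_linkInd_pair (s : Outcome m) (u v : ℕ) {t₀ t₁ : ℕ} (h : t₀ ≤ t₁) :
    ∑ τ ∈ Finset.Ico t₀ t₁, M.linkInd {u, v} τ s =
      M.commonNbrs s u v t₁ - M.commonNbrs s u v t₀ := by
  simp only [linkInd_pair]
  exact Finset.sum_Ico_sub (fun t => (M.commonNbrs s u v t : ℝ)) h

theorem commonNbrs_mono (s : Outcome m) (u v : ℕ) : Monotone (M.commonNbrs s u v) :=
  monotone_nat_of_le_succ fun t => by rw [M.commonNbrs_succ]; omega

theorem commonNbrs_sub_le (s : Outcome m) (u v : ℕ) {t₀ t₁ : ℕ} (h : t₀ ≤ t₁) :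
    (M.commonNbrs s u v t₁ : ℝ) - M.commonNbrs s u v t₀ ≤ M.sdeg s v t₁ - M.sdeg s v t₀ := by
  rw [← M.sum_linkInd_pair s u v h, ← M.sum_linkInd_single s v h]
  refine Finset.sum_le_sum fun τ _ => ?_
  unfold linkInd
  have hsub : M.linkSet {u, v} τ s ⊆ M.linkSet {v} τ s := fun y hy w hw =>
    hy w (Finset.mem_insert_of_mem hw)
  exact Set.indicator_le_indicator_of_subset hsub (fun _ => zero_le_one) _

theorem commonNbrs_le_degIn (s : Outcome m) (u v t : ℕ) :
    (M.commonNbrs s u v t : ℝ) ≤ M.degIn s v t := by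
  have h := M.commonNbrs_sub_le s u v (Nat.zero_le t)
  have h0 : M.commonNbrs s u v 0 = 0 := by simp [commonNbrs]
  have h1 : M.degIn s v 0 = 0 := by simp [degIn, inDeg, edges]
  simp only [sdeg, h0, h1] at h
  push_cast at h
  linarith

theorem degIn_le (s : Outcome m) (v t : ℕ) : M.degIn s v t ≤ t := by
  induction t with
  | zero => simp [degIn, inDeg, edges]
  | succ t ih =>
    rw [M.degIn_succ]
    split_ifs <;> omega

theorem lt_of_degIn_pos (s : Outcome m) (v t : ℕ) (h : 0 < M.degIn s v t) : v < t ∧ 1 ≤ v := by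
  unfold degIn inDeg at h
  obtain ⟨e, he⟩ := Finset.card_pos.mp h
  rw [Finset.mem_filter] at he
  have := M.edges_bounds s t e he.1
  omega

/-- The volume of the sphere of influence. -/
def sphereVol (s : Outcome m) (v t : ℕ) : ℝ := M.A₁ * M.sdeg s v t / t

theorem influence_eq (s : Outcome m) (v t : ℕ) :
    M.influence s (M.edges s t) v t = M.ballOfVolume (node s v) (M.sphereVol s v t) := by
  unfold influence sphereVol sdeg degIn
  have := M.A₁_pos
  congr 2
  field_simp

theorem sphereVol_pos (s : Outcome m) (v : ℕ) {t : ℕ} (ht : 1 ≤ t) : 0 < M.sphereVol s v t := by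
  have := M.A₁_pos
  have := M.sdeg_pos s v t
  have : (0 : ℝ) < t := by exact_mod_cast ht
  unfold sphereVol
  positivity

/-- The growth rate `p A₁ μ(B) / |B|` of a node with sphere of influence `B`. -/
def growthRate (x : Fin m → ℝ) (V : ℝ) : ℝ := M.p * M.A₁ * M.ballProb x V / V

theorem linkProb_single (s : Outcome m) {v τ : ℕ} (h : v ∈ Finset.Icc 1 τ) :
    M.linkProb {v} τ s = M.p * M.ballProb (node s v) (M.sphereVol s v τ) := by
  unfold linkProb
  rw [M.real_stepLaw_linkSet {v} τ s (by simpa using h)]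
  simp [influence_eq, ballProb]

theorem linkProb_single_div (s : Outcome m) {v τ : ℕ} (h : v ∈ Finset.Icc 1 τ) :
    M.linkProb {v} τ s / M.sdeg s v τ =
      M.growthRate (node s v) (M.sphereVol s v τ) / τ := by
  rw [M.linkProb_single s h, growthRate]
  have h1 := M.sdeg_pos s v τ
  have h2 := M.A₁_pos
  have h3 : (0 : ℝ) < τ := by exact_mod_cast (by rw [Finset.mem_Icc] at h; omega)
  conv_rhs => rw [show M.sphereVol s v τ = M.A₁ * M.sdeg s v τ / τ from rfl]
  rw [show M.ballProb (node s v) (M.A₁ * M.sdeg s v τ / τ) =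
    M.ballProb (node s v) (M.sphereVol s v τ) from rfl]
  field_simp

theorem linkProb_pair (s : Outcome m) {u v τ : ℕ} (huv : u ≠ v) (hu : u ∈ Finset.Icc 1 τ)
    (hv : v ∈ Finset.Icc 1 τ) :
    M.linkProb {u, v} τ s = M.p ^ 2 * M.positionLaw.real
      (M.ballOfVolume (node s u) (M.sphereVol s u τ) ∩
        M.ballOfVolume (node s v) (M.sphereVol s v τ)) := by
  unfold linkProb
  have h : ∀ w ∈ ({u, v} : Finset ℕ), w ∈ Finset.Icc 1 τ := by
    intro w hw
    rw [Finset.mem_insert, Finset.mem_singleton] at hw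
    rcases hw with rfl | rfl <;> assumption
  rw [M.real_stepLaw_linkSet {u, v} τ s h, Finset.card_pair huv]
  simp [influence_eq]

theorem linkProb_pair_le (s : Outcome m) {u v τ : ℕ} (huv : u ≠ v) :
    M.linkProb {u, v} τ s ≤ M.p * M.linkProb {v} τ s := by
  by_cases h : u ∈ Finset.Icc 1 τ ∧ v ∈ Finset.Icc 1 τ
  · rw [M.linkProb_pair s huv h.1 h.2, M.linkProb_single s h.2, ← mul_assoc, ← sq]
    refine mul_le_mul_of_nonneg_left ?_ (sq_nonneg _)
    exact measureReal_mono Set.inter_subset_right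
  · have : M.linkSet {u, v} τ s = ∅ := M.linkSet_eq_empty _ τ s fun hc =>
      h ⟨hc u (by simp), hc v (by simp)⟩
    rw [linkProb, this, measureReal_empty]
    exact mul_nonneg M.p_pos.le measureReal_nonneg

theorem linkProb_pair_of_subset (s : Outcome m) {u v τ : ℕ} (huv : u ≠ v)
    (hu : u ∈ Finset.Icc 1 τ) (hv : v ∈ Finset.Icc 1 τ)
    (h : M.ballOfVolume (node s v) (M.sphereVol s v τ) ⊆
      M.ballOfVolume (node s u) (M.sphereVol s u τ)) :
    M.linkProb {u, v} τ s = M.p * M.linkProb {v} τ s := by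
  rw [M.linkProb_pair s huv hu hv, M.linkProb_single s hv, Set.inter_eq_right.mpr h, ballProb]
  ring

theorem linkInd_pair_of_disjoint (s : Outcome m) {u v τ : ℕ}
    (h : M.ballOfVolume (node s u) (M.sphereVol s u τ) ∩
      M.ballOfVolume (node s v) (M.sphereVol s v τ) = ∅) :
    M.linkInd {u, v} τ s = 0 := by
  unfold linkInd
  refine Set.indicator_of_notMem (fun hmem => ?_) _
  have h1 := (hmem u (by simp)).2.1
  have h2 := (hmem v (by simp)).2.1
  rw [influence_eq] at h1 h2
  exact Set.notMem_empty _ (h ▸ Set.mem_inter h1 h2)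

/-- Each link raises the degree `D` by one, and `1 / D² ≤ 2 / D - 2 / (D + 1)` for `D ≥ 1`, so the
sum telescopes whatever the times of the links. -/
theorem sum_linkInd_div_sq_le (s : Outcome m) (v : ℕ) {t₀ t₁ : ℕ} (h : t₀ ≤ t₁)
    (h1 : 1 ≤ M.sdeg s v t₀) :
    ∑ τ ∈ Finset.Ico t₀ t₁, M.linkInd {v} τ s / M.sdeg s v τ ^ 2 ≤ 2 / M.sdeg s v t₀ := by
  suffices hs : ∑ τ ∈ Finset.Ico t₀ t₁, M.linkInd {v} τ s / M.sdeg s v τ ^ 2 ≤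
      2 / M.sdeg s v t₀ - 2 / M.sdeg s v t₁ by
    have := M.sdeg_pos s v t₁
    have : 0 < 2 / M.sdeg s v t₁ := by positivity
    linarith
  induction t₁, h using Nat.le_induction with
  | base => simp
  | succ t ht ih =>
    rw [Finset.sum_Ico_succ_top ht]
    have hD : 1 ≤ M.sdeg s v t := h1.trans (M.sdeg_mono s v ht)
    have hs := M.linkInd_single s v t
    rcases M.linkInd_eq {v} t s with h0 | h0
    · rw [h0] at hs ⊢
      rw [show M.sdeg s v (t + 1) = M.sdeg s v t by linarith]
      simpa using ih
    · rw [h0] at hs ⊢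
      rw [show M.sdeg s v (t + 1) = M.sdeg s v t + 1 by linarith]
      set D := M.sdeg s v t
      have : 1 / D ^ 2 ≤ 2 / D - 2 / (D + 1) := by
        rw [div_sub_div _ _ (by positivity) (by positivity), div_le_div_iff₀ (by positivity)
          (by positivity)]
        nlinarith [mul_nonneg (by linarith : 0 ≤ D - 1) (by positivity : 0 ≤ D)]
      linarith

/-- A link changes `log D` by `log (1 + 1 / D)`, which lies between `1 / D - 1 / D²` and `1 / D`. -/
theorem abs_log_sub_sum_le (s : Outcome m) (v : ℕ) {t₀ t₁ : ℕ} (h : t₀ ≤ t₁)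
    (h1 : 1 ≤ M.sdeg s v t₀) :
    |Real.log (M.sdeg s v t₁) - Real.log (M.sdeg s v t₀) -
      ∑ τ ∈ Finset.Ico t₀ t₁, M.linkInd {v} τ s / M.sdeg s v τ| ≤
      ∑ τ ∈ Finset.Ico t₀ t₁, M.linkInd {v} τ s / M.sdeg s v τ ^ 2 := by
  rw [← Finset.sum_Ico_sub (fun t => Real.log (M.sdeg s v t)) h, ← Finset.sum_sub_distrib]
  refine (Finset.abs_sum_le_sum_abs _ _).trans (Finset.sum_le_sum fun τ hτ => ?_)
  rw [Finset.mem_Ico] at hτ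
  have hD : 1 ≤ M.sdeg s v τ := h1.trans (M.sdeg_mono s v hτ.1)
  have hs := M.linkInd_single s v τ
  rcases M.linkInd_eq {v} τ s with h0 | h0
  · rw [h0] at hs ⊢
    rw [show M.sdeg s v (τ + 1) = M.sdeg s v τ by linarith]
    simp
  · rw [h0] at hs ⊢
    rw [show M.sdeg s v (τ + 1) = M.sdeg s v τ + 1 by linarith]
    set D := M.sdeg s v τ
    rw [← Real.log_div (by positivity) (by positivity)]
    have h2 := Real.log_le_sub_one_of_pos (show 0 < (D + 1) / D by positivity)
    have h3 := Real.one_sub_inv_le_log_of_pos (show 0 < (D + 1) / D by positivity)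
    have h4 : (D + 1) / D - 1 = 1 / D := by field_simp; ring
    have h5 : 1 / D - 1 / D ^ 2 ≤ 1 - ((D + 1) / D)⁻¹ := by
      rw [inv_div, one_sub_div (by positivity), div_sub_div _ _ (by positivity) (by positivity),
        div_le_div_iff₀ (by positivity) (by positivity)]
      nlinarith [sq_nonneg D]
    have h6 : 0 ≤ 1 / D ^ 2 := by positivity
    rw [abs_le]
    constructor <;> linarith

section GoodConsequences

variable {n : ℕ} {lam : ℝ} {s : Outcome m}

/-- On the good event, the in-degree of a node grows at its growth rate. -/
theorem Good.growth (hG : M.Good n lam s) (hl : 0 < lam) {v : ℕ} (hv : v ∈ Finset.Icc 1 n)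
    {t₀ t₁ : ℕ} (h : t₀ ≤ t₁) (ht₁ : t₁ ≤ n) (h1 : 1 ≤ M.sdeg s v t₀)
    (hdeg : 0 < M.degIn s v t₀) :
    |Real.log (M.sdeg s v t₁) - Real.log (M.sdeg s v t₀) -
      ∑ τ ∈ Finset.Ico t₀ t₁, M.growthRate (node s v) (M.sphereVol s v τ) / τ| ≤
      4 * lam + 4 * Real.log n / (lam * M.sdeg s v t₀) + 2 / M.sdeg s v t₀ := by
  have hvt := M.lt_of_degIn_pos s v t₀ hdeg
  have hg := hG.1 v hv t₀ (Finset.mem_range.mpr (by omega)) t₁ (Finset.mem_range.mpr (by omega))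
  set D₀ := M.sdeg s v t₀ with hD₀
  have hD₀pos : 0 < D₀ := M.sdeg_pos s v t₀
  have e1 : ∑ τ ∈ Finset.range t₁, (if t₀ ≤ τ then lam * D₀ / M.sdeg s v τ else 0) *
      (M.linkInd {v} τ s - M.linkProb {v} τ s) = lam * D₀ *
      ((∑ τ ∈ Finset.Ico t₀ t₁, M.linkInd {v} τ s / M.sdeg s v τ) -
        ∑ τ ∈ Finset.Ico t₀ t₁, M.growthRate (node s v) (M.sphereVol s v τ) / τ) := by
    rw [← Finset.sum_sub_distrib, Finset.mul_sum, ← sum_range_ite]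
    refine Finset.sum_congr rfl fun τ _ => ?_
    split_ifs with hτ
    · rw [← M.linkProb_single_div s (Finset.mem_Icc.mpr (by omega))]
      ring
    · ring
  have e2 : ∑ τ ∈ Finset.range t₁, (if t₀ ≤ τ then lam * D₀ / M.sdeg s v τ else 0) ^ 2 *
      M.linkInd {v} τ s = (lam * D₀) ^ 2 *
      ∑ τ ∈ Finset.Ico t₀ t₁, M.linkInd {v} τ s / M.sdeg s v τ ^ 2 := by
    rw [Finset.mul_sum, ← sum_range_ite]
    refine Finset.sum_congr rfl fun τ _ => ?_
    split_ifs with hτ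
    · ring
    · ring
  rw [e1, e2, abs_mul, abs_of_pos (by positivity : 0 < lam * D₀)] at hg
  have hsq := M.sum_linkInd_div_sq_le s v h h1
  have hlog := M.abs_log_sub_sum_le s v h h1
  set Q := ∑ τ ∈ Finset.Ico t₀ t₁, M.linkInd {v} τ s / M.sdeg s v τ ^ 2
  set I := ∑ τ ∈ Finset.Ico t₀ t₁, M.linkInd {v} τ s / M.sdeg s v τ
  set R := ∑ τ ∈ Finset.Ico t₀ t₁, M.growthRate (node s v) (M.sphereVol s v τ) / τ
  -- The normalisation of the weights by `D₀` makes the quadratic term `2 (lam D₀)² · 2 / D₀`, which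
  -- leaves `4 lam` after division by `lam D₀`.
  have h3 : |I - R| ≤ 4 * lam + 4 * Real.log n / (lam * D₀) := by
    have hlD : 0 < lam * D₀ := by positivity
    rw [← mul_le_mul_iff_right₀ hlD]
    refine hg.trans ?_
    have h4 : (lam * D₀) ^ 2 * Q ≤ (lam * D₀) ^ 2 * (2 / D₀) :=
      mul_le_mul_of_nonneg_left hsq (sq_nonneg _)
    have h5 : (lam * D₀) ^ 2 * (2 / D₀) = 2 * lam * (lam * D₀) := by field_simp
    have h6 : lam * D₀ * (4 * lam + 4 * Real.log n / (lam * D₀)) =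
        4 * lam * (lam * D₀) + 4 * Real.log n := by field_simp
    rw [h6]
    linarith
  rw [abs_le] at h3 hlog ⊢
  constructor <;> linarith [h3.1, h3.2, hlog.1, hlog.2]

/-- On the good event, the number of common neighbours is close to its compensator. -/
theorem Good.pair (hG : M.Good n lam s) (hl : 0 < lam) {u v : ℕ} (hu : u ∈ Finset.Icc 1 n)
    (hv : v ∈ Finset.Icc 1 n) {t₀ t₁ : ℕ} (h : t₀ ≤ t₁) (ht₁ : t₁ ≤ n) :
    |(∑ τ ∈ Finset.Ico t₀ t₁, M.linkInd {u, v} τ s) -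
      ∑ τ ∈ Finset.Ico t₀ t₁, M.linkProb {u, v} τ s| ≤
      2 * lam * M.sdeg s v t₁ + 5 * Real.log n / lam := by
  have hg := hG.2 u hu v hv t₀ (Finset.mem_range.mpr (by omega)) t₁
    (Finset.mem_range.mpr (by omega))
  have e1 : ∑ τ ∈ Finset.range t₁, (if t₀ ≤ τ then lam else 0) *
      (M.linkInd {u, v} τ s - M.linkProb {u, v} τ s) = lam *
      ((∑ τ ∈ Finset.Ico t₀ t₁, M.linkInd {u, v} τ s) -
        ∑ τ ∈ Finset.Ico t₀ t₁, M.linkProb {u, v} τ s) := by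
    rw [← Finset.sum_sub_distrib, Finset.mul_sum, ← sum_range_ite]
    refine Finset.sum_congr rfl fun τ _ => ?_
    split_ifs with hτ <;> ring
  have e2 : ∑ τ ∈ Finset.range t₁, (if t₀ ≤ τ then lam else 0) ^ 2 *
      M.linkInd {u, v} τ s = lam ^ 2 * ∑ τ ∈ Finset.Ico t₀ t₁, M.linkInd {u, v} τ s := by
    rw [Finset.mul_sum, ← sum_range_ite]
    refine Finset.sum_congr rfl fun τ _ => ?_
    split_ifs with hτ <;> ring
  rw [e1, e2, abs_mul, abs_of_pos hl] at hg
  have h2 : ∑ τ ∈ Finset.Ico t₀ t₁, M.linkInd {u, v} τ s ≤ M.sdeg s v t₁ := by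
    rw [M.sum_linkInd_pair s u v h]
    linarith [M.commonNbrs_sub_le s u v h, M.sdeg_pos s v t₀]
  rw [← mul_le_mul_iff_right₀ hl]
  refine hg.trans ?_
  have h3 := mul_le_mul_of_nonneg_left h2 (sq_nonneg lam)
  have h4 : lam * (2 * lam * M.sdeg s v t₁ + 5 * Real.log n / lam) =
      2 * (lam ^ 2 * M.sdeg s v t₁) + 5 * Real.log n := by field_simp
  rw [h4]
  linarith

end GoodConsequences

end SPAModel

/-! ### Growth rates and regular outcomes -/

namespace SPAModel

variable {m κ : ℕ} (M : SPAModel m κ)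

section GrowthRate

variable {R : ℝ}

theorem growthRate_nonneg (x : Fin m → ℝ) {V : ℝ} (hV : 0 < V) : 0 ≤ M.growthRate x V := by
  have := M.A₁_pos
  have := M.p_pos
  have := M.ballProb_nonneg x V
  unfold growthRate
  positivity

theorem growthRate_le (hm : 0 < m) (hR : ∀ ℓ, M.ρ ℓ ≤ R) (hR0 : 0 < R) (x : Fin m → ℝ) {V : ℝ}
    (hV : 0 < V) : M.growthRate x V ≤ M.p * M.A₁ * R := by
  have := M.A₁_pos
  have := M.p_pos
  rw [growthRate, div_le_iff₀ hV, mul_assoc _ R V]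
  have := M.ballProb_le hm hR hR0 x hV.le
  gcongr

/-- The change of the rate is a gain from the added shell minus a loss from the larger denominator.
Both are nonnegative and at most `p A₁ R (1 - V / V')`, and `1 - exp(-(b - a)) ≤ b - a`. -/
theorem growthRate_sub_le_aux (hm : 0 < m) (hR : ∀ ℓ, M.ρ ℓ ≤ R) (hR0 : 0 < R)
    (hR1 : M.p * M.A₁ * R < 1) (x : Fin m → ℝ) {a b : ℝ} (hab : a ≤ b) :
    |M.growthRate x (Real.exp b) - M.growthRate x (Real.exp a)| ≤ 2 * (b - a) := by
  have hA := M.A₁_pos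
  have hp := M.p_pos
  set V := Real.exp a
  set V' := Real.exp b
  have hV : 0 < V := Real.exp_pos a
  have hV' : 0 < V' := Real.exp_pos b
  have hVV : V ≤ V' := Real.exp_le_exp.mpr hab
  have h1 : 1 - V / V' ≤ b - a := by
    have : V / V' = Real.exp (-(b - a)) := by rw [← Real.exp_sub]; ring_nf
    rw [this]
    linarith [Real.add_one_le_exp (-(b - a))]
  have h0 : 0 ≤ 1 - V / V' := by
    rw [sub_nonneg]; exact (div_le_one hV').mpr hVV
  set P := M.ballProb x V with hP
  set P' := M.ballProb x V' with hP'
  have hP1 : P ≤ R * V := M.ballProb_le hm hR hR0 x hV.le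
  have hP0 : 0 ≤ P := M.ballProb_nonneg x V
  have hPP : P ≤ P' := M.ballProb_mono hm x hV.le hVV
  have hPd : P' - P ≤ R * (V' - V) := M.ballProb_sub_le hm hR hR0 x hV.le hVV
  have hdec : M.growthRate x V' - M.growthRate x V =
      M.p * M.A₁ * ((P' - P) / V') - M.p * M.A₁ * (P / V * (1 - V / V')) := by
    simp only [growthRate, ← hP, ← hP']
    field_simp
    ring
  have h2 : (P' - P) / V' ≤ R * (1 - V / V') := by
    rw [div_le_iff₀ hV']
    calc P' - P ≤ R * (V' - V) := hPd
      _ = R * (1 - V / V') * V' := by field_simp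
  have h3 : P / V * (1 - V / V') ≤ R * (1 - V / V') := by
    gcongr
    rwa [div_le_iff₀ hV]
  have h4 : 0 ≤ (P' - P) / V' := div_nonneg (by linarith) hV'.le
  have h5 : 0 ≤ P / V * (1 - V / V') := by positivity
  have hpA : 0 < M.p * M.A₁ := by positivity
  have h6 := mul_le_mul_of_nonneg_left h2 hpA.le
  have h7 := mul_le_mul_of_nonneg_left h3 hpA.le
  have h8 := mul_nonneg hpA.le h4
  have h9 := mul_nonneg hpA.le h5
  have h10 : M.p * M.A₁ * (R * (1 - V / V')) ≤ 1 * (b - a) := by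
    rw [← mul_assoc]
    exact mul_le_mul hR1.le h1 h0 zero_le_one
  rw [hdec, abs_le]
  constructor <;> linarith

theorem abs_growthRate_sub_le (hm : 0 < m) (hR : ∀ ℓ, M.ρ ℓ ≤ R) (hR0 : 0 < R)
    (hR1 : M.p * M.A₁ * R < 1) (x : Fin m → ℝ) (a b : ℝ) :
    |M.growthRate x (Real.exp a) - M.growthRate x (Real.exp b)| ≤ 2 * |a - b| := by
  rcases le_total a b with h | h
  · rw [abs_sub_comm, abs_of_nonpos (by linarith : a - b ≤ 0)]
    exact (M.growthRate_sub_le_aux hm hR hR0 hR1 x h).trans (by linarith)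
  · rw [abs_of_nonneg (by linarith : 0 ≤ a - b)]
    exact M.growthRate_sub_le_aux hm hR hR0 hR1 x h

theorem exists_growthRate_sub_le_dist (hm : 0 < m) (hR : ∀ ℓ, M.ρ ℓ ≤ R) (hR0 : 0 < R) :
    ∃ C : ℝ, 0 < C ∧ ∀ (u v : Fin m → ℝ) (V : ℝ), 0 < V →
      |M.growthRate u V - M.growthRate v V| ≤ C * (M.torusDist u v / V ^ (1 / (m : ℝ))) := by
  have hA := M.A₁_pos
  have hp := M.p_pos
  obtain ⟨C, hC, h⟩ := M.exists_ballProb_sub_le_dist hm hR hR0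
  refine ⟨M.p * M.A₁ * C, by positivity, fun u v V hV => ?_⟩
  have h1 := h u v V hV
  have h2 := h v u V hV
  rw [M.torusDist_comm v u] at h2
  have hdec : M.growthRate u V - M.growthRate v V =
      M.p * M.A₁ * ((M.ballProb u V - M.ballProb v V) / V) := by
    unfold growthRate
    field_simp
  rw [hdec, abs_mul, abs_of_pos (by positivity : 0 < M.p * M.A₁), mul_assoc (M.p * M.A₁) C]
  refine mul_le_mul_of_nonneg_left ?_ (by positivity)
  rw [abs_div, abs_of_pos hV, div_le_iff₀ hV, abs_le]
  constructor <;> linarith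

/-- Keeps a node of a region of positive density from stalling, even while its sphere crosses the
boundary: its degree grows by a constant factor in bounded logarithmic time. -/
theorem exists_le_growthRate (hm : 0 < m) {ℓ : Fin m → Fin κ} (hρ : 0 < M.ρ ℓ) (B : ℝ) :
    ∃ c : ℝ, 0 < c ∧ ∀ x ∈ region ℓ, ∀ V, 0 < V → V ≤ B → c ≤ M.growthRate x V := by
  have hA := M.A₁_pos
  have hp := M.p_pos
  obtain ⟨c, hc, h⟩ := M.exists_le_ballProb hm
  refine ⟨M.p * M.A₁ * (M.ρ ℓ * c / (|B| + 1)), by positivity, fun x hx V hV hVB => ?_⟩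
  rw [growthRate, le_div_iff₀ hV, mul_assoc]
  refine mul_le_mul_of_nonneg_left (le_trans ?_ (h ℓ x hx V hV.le)) (by positivity)
  have h1 : V / (|B| + 1) ≤ min V 1 := by
    rw [div_le_iff₀ (by positivity)]
    have hB : V ≤ |B| := hVB.trans (le_abs_self B)
    rcases le_total V 1 with h2 | h2
    · rw [min_eq_left h2]; nlinarith [abs_nonneg B]
    · rw [min_eq_right h2]; linarith
  calc M.ρ ℓ * c / (|B| + 1) * V = M.ρ ℓ * (c * (V / (|B| + 1))) := by ring
    _ ≤ _ := by gcongr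

theorem growthRate_eq_of_lt_boundaryDist (hm : 0 < m) {ℓ : Fin m → Fin κ} {x : Fin m → ℝ} {V : ℝ}
    (hx : x ∈ region ℓ) (hV : 0 < V) (h : V < M.unitBallVolume * M.boundaryDist ℓ x ^ m) :
    M.growthRate x V = M.p * M.ρ ℓ * M.A₁ := by
  rw [growthRate, M.ballProb_eq_of_lt_boundaryDist hm hx hV.le h]
  field_simp

end GrowthRate

/-- The pathwise information about the process that is used: the in-degrees grow at their growth
rates above the level `N`, the numbers of common neighbours are close to their compensators up to
errors proportional to the scale `w`, and `N` is small compared to `w`. -/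
structure Regular (s : Outcome m) (n : ℕ) (w N η : ℝ) : Prop where
  n_pos : 1 ≤ n
  path : ∀ v ∈ Finset.Icc 1 n, GrowthPath (M.sdeg s v)
    (fun τ => M.growthRate (node s v) (M.sphereVol s v τ)) n N η
  pair : ∀ u ∈ Finset.Icc 1 n, ∀ v ∈ Finset.Icc 1 n, ∀ t₀ t₁, t₀ ≤ t₁ → t₁ ≤ n →
    |(∑ τ ∈ Finset.Ico t₀ t₁, M.linkInd {u, v} τ s) -
      ∑ τ ∈ Finset.Ico t₀ t₁, M.linkProb {u, v} τ s| ≤ η * (M.sdeg s v t₁ + w)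
  le_N : (1 + 1 / M.A₁) / η + M.A₂ / M.A₁ + 1 ≤ N
  N_le : N + 1 ≤ η * w

section

variable {M} {s : Outcome m} {n : ℕ} {w N η : ℝ}

theorem Regular.one_le_N (hS : M.Regular s n w N η) (hη : 0 < η) : 1 ≤ N := by
  have := hS.le_N
  have h1 := M.A₁_pos
  have h2 := M.A₂_pos
  have : 0 < (1 + 1 / M.A₁) / η + M.A₂ / M.A₁ := by positivity
  linarith

theorem Regular.w_pos (hS : M.Regular s n w N η) (hη : 0 < η) : 0 < w := by
  have h1 := hS.one_le_N hη
  have h2 := hS.N_le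
  by_contra hcon
  nlinarith

theorem Regular.lt_of_le_sdeg (hS : M.Regular s n w N η) (hη : 0 < η) {v t : ℕ}
    (h : N ≤ M.sdeg s v t) : 1 ≤ v ∧ v < t := by
  have h1 := M.A₁_pos
  have h2 := hS.le_N
  have h3 : 0 < (1 + 1 / M.A₁) / η := by positivity
  have h4 : 0 < M.degIn s v t := by
    unfold sdeg at h
    have : (0 : ℝ) < M.degIn s v t := by linarith
    exact_mod_cast this
  have := M.lt_of_degIn_pos s v t h4
  exact ⟨this.2, this.1⟩

/-- The threshold of the logarithmic volume below which a sphere lies in its region. -/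
theorem growthRate_sphereVol_eq (hm : 0 < m) {ℓ : Fin m → Fin κ} {v τ : ℕ}
    (hv : node s v ∈ region ℓ) (hτ : 1 ≤ τ)
    (hδ : 0 < M.unitBallVolume * M.boundaryDist ℓ (node s v) ^ m)
    (h : Real.log M.A₁ + Real.log (M.sdeg s v τ) - Real.log τ <
      Real.log (M.unitBallVolume * M.boundaryDist ℓ (node s v) ^ m)) :
    M.sphereVol s v τ < M.unitBallVolume * M.boundaryDist ℓ (node s v) ^ m ∧
    M.growthRate (node s v) (M.sphereVol s v τ) = M.p * M.ρ ℓ * M.A₁ := by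
  have hA := M.A₁_pos
  have hD := M.sdeg_pos s v τ
  have hτ' : (0 : ℝ) < τ := by exact_mod_cast hτ
  have hV := M.sphereVol_pos s v hτ
  have hlog : Real.log (M.sphereVol s v τ) =
      Real.log M.A₁ + Real.log (M.sdeg s v τ) - Real.log τ := by
    unfold sphereVol
    rw [Real.log_div (by positivity) (by positivity), Real.log_mul (by positivity) (by positivity)]
  rw [← hlog, Real.log_lt_log_iff hV hδ] at h
  exact ⟨h, M.growthRate_eq_of_lt_boundaryDist hm hv hV h⟩

theorem unitBallVolume_mul_boundaryDist_le_one (hm : 0 < m) {ℓ : Fin m → Fin κ} {x : Fin m → ℝ}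
    (hx : x ∈ region ℓ) : M.unitBallVolume * M.boundaryDist ℓ x ^ m ≤ 1 := by
  have h0 : 0 ≤ M.unitBallVolume * M.boundaryDist ℓ x ^ m :=
    mul_nonneg M.unitBallVolume_pos.le (pow_nonneg (M.boundaryDist_nonneg ℓ x) m)
  refine le_of_forall_lt_imp_le_of_dense fun V hV => ?_
  rcases le_or_gt 0 V with h | h
  · exact (M.lt_one_of_lt_boundaryDist hm hx h hV).le
  · linarith

/-- The in-degree of a node whose distance to the boundary is large enough follows a power law
backwards until its extrapolated value is of order `w`. -/
theorem Regular.powerLaw (hm : 0 < m) (hS : M.Regular s n w N η) (hη : 0 < η)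
    {ℓ : Fin m → Fin κ} {v : ℕ} (hvn : v ∈ Finset.Icc 1 n) (hv : node s v ∈ region ℓ)
    {a : ℝ} (ha : a = M.p * M.ρ ℓ * M.A₁) (ha0 : 0 < a) (ha1 : a < 1) {lε c₁ lθ : ℝ}
    (hc₁ : 2 * c₁ ≤ lε) (hlθ : (1 - a) * lθ = 2 * c₁ - lε)
    (hη1 : η < 1) (hηc : 5 * η < c₁) (hηθ : Real.log η + c₁ ≤ a * lθ)
    {j lT : ℝ} (hj : w ≤ η * j) (hjk : j ≤ M.degIn s v n)
    (hlT : lT = Real.log n + 1 / a * (Real.log w - Real.log j))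
    (hδ : 0 < M.unitBallVolume * M.boundaryDist ℓ (node s v) ^ m)
    (hB : lε + Real.log M.A₁ + Real.log (M.degIn s v n) - a * Real.log n - (1 - a) * lT ≤
      Real.log (M.unitBallVolume * M.boundaryDist ℓ (node s v) ^ m)) {T : ℕ}
    (hT : T = ⌈Real.exp (lθ + lT)⌉₊) :
    1 ≤ T ∧ T ≤ n ∧ 1 / (T : ℝ) ≤ η ∧ M.A₂ / M.A₁ ≤ η * M.degIn s v n ∧
      Real.log M.A₁ + Real.log (M.sdeg s v n) - a * (Real.log n - Real.log T) - Real.log T + c₁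
        ≤ Real.log (M.unitBallVolume * M.boundaryDist ℓ (node s v) ^ m) ∧
      ∀ t, T ≤ t → t ≤ n →
        |Real.log (M.sdeg s v t) - (Real.log (M.sdeg s v n) - a * (Real.log n - Real.log t))| ≤
          2 * η ∧ N ≤ M.sdeg s v t ∧
        M.sphereVol s v t < M.unitBallVolume * M.boundaryDist ℓ (node s v) ^ m := by
  have hA := M.A₁_pos
  have hA₂ := M.A₂_pos
  have hN1 := hS.one_le_N hη
  have hw := hS.w_pos hη
  have hNw := hS.N_le
  have hleN := hS.le_N
  have hn0 : (0 : ℝ) < n := by exact_mod_cast hS.n_pos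
  have hj0 : 0 < j := (mul_pos_iff_of_pos_left hη).mp (hw.trans_le hj)
  have hk0 : (0 : ℝ) < M.degIn s v n := hj0.trans_le hjk
  have hTr : Real.exp (lθ + lT) ≤ T := hT ▸ Nat.le_ceil _
  have hTpos : (0 : ℝ) < T := (Real.exp_pos _).trans_le hTr
  have hT1 : 1 ≤ T := by exact_mod_cast hTpos
  have hlogT : lθ + lT ≤ Real.log T := (Real.le_log_iff_exp_le hTpos).mpr hTr
  have hlθ0 : lθ ≤ 0 := by
    by_contra hcon
    have := mul_pos (by linarith : 0 < 1 - a) (not_le.mp hcon)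
    linarith
  have hwj : w ≤ j := hj.trans (mul_le_of_le_one_left hj0.le hη1.le)
  have hlogwj : Real.log w ≤ Real.log j := Real.log_le_log hw hwj
  have hlTn : lT ≤ Real.log n := by
    have : 1 / a * (Real.log w - Real.log j) ≤ 0 :=
      mul_nonpos_of_nonneg_of_nonpos (by positivity) (by linarith)
    linarith
  have hTn : T ≤ n := by
    rw [hT, Nat.ceil_le]
    calc Real.exp (lθ + lT) ≤ Real.exp (Real.log n) := Real.exp_le_exp.mpr (by linarith)
      _ = n := Real.exp_log hn0
  have haT : a * lT = a * Real.log n + (Real.log w - Real.log j) := by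
    rw [hlT]
    field_simp
  have hβ : M.A₂ / M.A₁ ≤ η * M.degIn s v n := by
    have h1 : 0 < (1 + 1 / M.A₁) / η := by positivity
    have h2 : η * w ≤ 1 * w := mul_le_mul_of_nonneg_right hη1.le hw.le
    have h3 : η * j ≤ η * M.degIn s v n := mul_le_mul_of_nonneg_left hjk hη.le
    linarith
  have hlogk : Real.log j ≤ Real.log (M.degIn s v n) := Real.log_le_log hj0 hjk
  have hsd : M.sdeg s v n = M.degIn s v n + M.A₂ / M.A₁ := rfl
  have hDk : Real.log (M.degIn s v n) ≤ Real.log (M.sdeg s v n) :=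
    Real.log_le_log hk0 (by rw [hsd]; linarith [div_pos hA₂ hA])
  have hDk' : Real.log (M.sdeg s v n) ≤ Real.log (M.degIn s v n) + η := by
    have h1 : M.sdeg s v n ≤ M.degIn s v n * Real.exp η := by
      have := Real.add_one_le_exp η
      have := mul_le_mul_of_nonneg_left this hk0.le
      rw [hsd]
      linarith
    calc Real.log (M.sdeg s v n) ≤ Real.log (M.degIn s v n * Real.exp η) :=
          Real.log_le_log (M.sdeg_pos s v n) h1
      _ = _ := by rw [Real.log_mul hk0.ne' (Real.exp_pos _).ne', Real.log_exp]
  set B := Real.log (M.unitBallVolume * M.boundaryDist ℓ (node s v) ^ m) with hBdef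
  have hB0 : B ≤ 0 :=
    Real.log_nonpos hδ.le (M.unitBallVolume_mul_boundaryDist_le_one hm hv)
  -- Going back from `exp lT` by the factor `exp lθ` multiplies the extrapolated volume by `exp(-(1
  -- - a) lθ) = exp(lε - 2 c₁)`. This uses up the margin `lε` except for `2 c₁`.
  have hBT : Real.log M.A₁ + Real.log (M.sdeg s v n) - a * (Real.log n - Real.log T) -
      Real.log T + c₁ ≤ B := by
    have h1 : (1 - a) * (lθ + lT) ≤ (1 - a) * Real.log T :=
      mul_le_mul_of_nonneg_left hlogT (by linarith)
    linarith
  have hNT : Real.log (N + 1) + c₁ ≤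
      Real.log (M.sdeg s v n) - a * (Real.log n - Real.log T) := by
    have h1 : Real.log (N + 1) ≤ Real.log η + Real.log w := by
      rw [← Real.log_mul hη.ne' hw.ne']
      exact Real.log_le_log (by linarith) hNw
    have h2 : a * (lθ + lT) ≤ a * Real.log T := mul_le_mul_of_nonneg_left hlogT ha0.le
    linarith
  -- At time `T` the extrapolated degree exceeds `N + 1` while the extrapolated volume is below one,
  -- which forces `T ≥ A₁ (N + 1)`.
  have hTinv : 1 / (T : ℝ) ≤ η := by
    have h1 : Real.log (M.A₁ * (N + 1)) ≤ Real.log T := by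
      rw [Real.log_mul hA.ne' (by linarith)]
      linarith
    have h2 := (Real.log_le_log_iff (mul_pos hA (by linarith)) hTpos).mp h1
    have h3 : 1 / η ≤ M.A₁ * (N + 1) := by
      have : M.A₁ * ((1 + 1 / M.A₁) / η + M.A₂ / M.A₁ + 1) ≤ M.A₁ * N :=
        mul_le_mul_of_nonneg_left hleN hA.le
      have e1 : M.A₁ * ((1 + 1 / M.A₁) / η + M.A₂ / M.A₁ + 1) =
          M.A₁ / η + 1 / η + M.A₂ + M.A₁ := by field_simp
      have : 0 < M.A₁ / η := by positivity
      linarith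
    rw [div_le_iff₀ hTpos]
    rw [div_le_iff₀ hη] at h3
    calc 1 ≤ M.A₁ * (N + 1) * η := h3
      _ ≤ T * η := by gcongr
      _ = η * T := mul_comm _ _
  have hreg : ∀ τ, N ≤ M.sdeg s v τ →
      Real.log M.A₁ + Real.log (M.sdeg s v τ) - Real.log τ < B →
      M.growthRate (node s v) (M.sphereVol s v τ) = a := fun τ h1 h2 => by
    rw [ha]
    have := hS.lt_of_le_sdeg hη h1
    exact (growthRate_sphereVol_eq hm hv (by omega) hδ h2).2
  refine ⟨hT1, hTn, hTinv, hβ, hBT, fun t ht htn => ?_⟩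
  have h := (hS.path v hvn).backward hη.le ha0.le ha1.le (by linarith) hreg hT1 hTn
    (by linarith) hNT (by rw [show 3 / (T : ℝ) = 3 * (1 / T) by ring]; linarith) ht htn
  exact ⟨h.1.trans (by linarith), h.2.1, (growthRate_sphereVol_eq hm hv (by omega) hδ h.2.2).1⟩

end

end SPAModel

/-! ### Two spheres driven by nearly the same flow -/

namespace SPAModel

variable {m κ : ℕ} {M : SPAModel m κ} {s : Outcome m} {n : ℕ} {w N η : ℝ}

theorem log_sphereVol (s : Outcome m) (v : ℕ) {t : ℕ} (ht : 1 ≤ t) :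
    Real.log (M.sphereVol s v t) = Real.log M.A₁ + Real.log (M.sdeg s v t) - Real.log t := by
  have hA := M.A₁_pos
  have hD := M.sdeg_pos s v t
  have ht' : (0 : ℝ) < t := by exact_mod_cast ht
  unfold sphereVol
  rw [Real.log_div (by positivity) (by positivity), Real.log_mul (by positivity) (by positivity)]

theorem sphereVol_le (s : Outcome m) (v : ℕ) {t : ℕ} (ht : 1 ≤ t) :
    M.sphereVol s v t ≤ M.A₁ + M.A₂ := by
  have hA := M.A₁_pos
  have hA₂ := M.A₂_pos
  have ht' : (1 : ℝ) ≤ t := by exact_mod_cast ht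
  have h1 : (M.degIn s v t : ℝ) ≤ t := by exact_mod_cast M.degIn_le s v t
  unfold sphereVol sdeg
  rw [div_le_iff₀ (by linarith), mul_add, mul_div_cancel₀ _ hA.ne']
  nlinarith

namespace Regular

theorem one_div_le (hS : M.Regular s n w N η) (hη : 0 < η) {v t : ℕ} (h : N ≤ M.sdeg s v t) :
    1 / (t : ℝ) ≤ η := by
  have hA := M.A₁_pos
  have h1 := hS.le_N
  have h2 : (M.degIn s v t : ℝ) ≤ t := by exact_mod_cast M.degIn_le s v t
  have h3 := (hS.lt_of_le_sdeg hη h).2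
  have ht : (0 : ℝ) < t := by exact_mod_cast (by omega : 0 < t)
  have h4 : 1 / η ≤ (1 + 1 / M.A₁) / η := by
    gcongr
    linarith [one_div_pos.mpr hA]
  unfold sdeg at h
  rw [div_le_iff₀ ht, mul_comm, ← div_le_iff₀ hη]
  linarith

/-- The logarithmic volume of a sphere of influence decreases at the rate `(1 - γ) / τ`. -/
theorem abs_log_sphereVol_sub_add_sum_le (hS : M.Regular s n w N η) (hη : 0 < η) {v t₀ t : ℕ}
    (hv : v ∈ Finset.Icc 1 n) (hN : N ≤ M.sdeg s v t₀) (ht : t₀ ≤ t) (htn : t ≤ n) :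
    |Real.log (M.sphereVol s v t) - Real.log (M.sphereVol s v t₀) + ∑ τ ∈ Finset.Ico t₀ t,
      (1 - M.growthRate (node s v) (M.sphereVol s v τ)) / τ| ≤ 2 * η := by
  have ht₀ : 1 ≤ t₀ := by have := (hS.lt_of_le_sdeg hη hN).2; omega
  have h1 := (hS.path v hv).growth t₀ t ht htn hN
  have h2 := log_div_le_sum_inv ht₀ ht
  have h3 := sum_inv_le_log_div ht₀ ht
  have h4 := hS.one_div_le hη hN
  rw [M.log_sphereVol s v ht₀, M.log_sphereVol s v (ht₀.trans ht)]
  simp only [sub_div, Finset.sum_sub_distrib]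
  rw [abs_le] at h1 ⊢
  constructor <;> linarith

/-- Wherever the sphere lies, its volume decays at least like `t^(-(1 - g))`; seen backwards in time
it therefore dominates a fixed power of the distance between the centres ever more strongly. -/
theorem log_sphereVol_add_le (hS : M.Regular s n w N η) (hη : 0 < η) {v t₀ t : ℕ} {g : ℝ}
    (hg : ∀ x V, 0 < V → M.growthRate x V ≤ g) (hg1 : g ≤ 1)
    (hv : v ∈ Finset.Icc 1 n) (hN : N ≤ M.sdeg s v t₀) (ht : t₀ ≤ t) (htn : t ≤ n) :
    Real.log (M.sphereVol s v t) + (1 - g) * (Real.log t - Real.log t₀) ≤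
      Real.log (M.sphereVol s v t₀) + 2 * η := by
  have ht₀ : 1 ≤ t₀ := by have := (hS.lt_of_le_sdeg hη hN).2; omega
  have h1 := hS.abs_log_sphereVol_sub_add_sum_le hη hv hN ht htn
  have h2 := log_div_le_sum_inv ht₀ ht
  have h3 : (1 - g) * ∑ τ ∈ Finset.Ico t₀ t, 1 / (τ : ℝ) ≤ ∑ τ ∈ Finset.Ico t₀ t,
      (1 - M.growthRate (node s v) (M.sphereVol s v τ)) / τ := by
    rw [Finset.mul_sum]
    refine Finset.sum_le_sum fun τ hτ => ?_
    rw [Finset.mem_Ico] at hτ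
    have := hg (node s v) _ (M.sphereVol_pos s v (ht₀.trans hτ.1))
    rw [mul_one_div]
    gcongr
  have h4 := mul_le_mul_of_nonneg_left h2 (sub_nonneg.mpr hg1)
  rw [abs_le] at h1
  linarith

end Regular

/-- Two spheres of influence whose centres are close do not drift apart in size. -/
theorem exists_log_sphereVol_sub_le (hm : 0 < m) {R : ℝ} (hR : ∀ ℓ, M.ρ ℓ ≤ R) (hR0 : 0 < R)
    (hR1 : M.p * M.A₁ * R < 1) : ∃ C : ℝ, 0 < C ∧
    ∀ {s : Outcome m} {n : ℕ} {w N η : ℝ}, M.Regular s n w N η → 0 < η →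
    ∀ u ∈ Finset.Icc 1 n, ∀ v ∈ Finset.Icc 1 n, ∀ t₀ T : ℕ, t₀ ≤ T → T ≤ n →
    N ≤ M.sdeg s u t₀ → N ≤ M.sdeg s v t₀ → η * (Real.log T - Real.log t₀ + 2) ≤ 1 → η ≤ 1 →
    M.unitBallVolume * M.torusDist (node s u) (node s v) ^ m ≤ M.sphereVol s u T →
    ∀ c, 0 ≤ c → Real.log (M.sphereVol s u t₀) - Real.log (M.sphereVol s v t₀) ≤ c →
    Real.log (M.sphereVol s u T) - Real.log (M.sphereVol s v T) ≤ C * (c + 1) := by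
  have hcm := M.unitBallVolume_pos
  have hmR : (0 : ℝ) < m := by exact_mod_cast hm
  obtain ⟨C₀, hC₀, hdist⟩ := M.exists_growthRate_sub_le_dist hm hR hR0
  set g := M.p * M.A₁ * R with hg
  -- The exponent of the guaranteed decay of the radius.
  set b := (1 - g) / m with hb
  have hb0 : 0 < b := div_pos (by linarith) hmR
  set K := (Real.exp 2 / M.unitBallVolume) ^ (1 / (m : ℝ)) with hK
  have hK0 : 0 ≤ K := Real.rpow_nonneg (by positivity) _
  set E := 2 * (1 / (1 - g)) ^ 2 * (C₀ * K * (2 / b) + 3) with hE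
  have hE0 : 0 ≤ E := by positivity
  have hF0 : 0 < 1 / (1 - g) := one_div_pos.mpr (by linarith)
  have hgr : ∀ x V, 0 < V → M.growthRate x V ≤ g := fun x V hV =>
    M.growthRate_le hm hR hR0 x hV
  refine ⟨1 / (1 - g) + 2 * E, by positivity, ?_⟩
  intro s n w N η hS hη u hu v hv t₀ T htT hTn hNu hNv hηT hη1 hd c hc hcc
  have ht₀ : 1 ≤ t₀ := by have := (hS.lt_of_le_sdeg hη hNu).2; omega
  -- The flow of `v` serves for both nodes: it is exact for `v`, and `u` follows it up to the effect
  -- of the different centre.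
  set G : ℝ → ℝ := fun L => M.growthRate (node s v) (Real.exp L) with hG
  have hG0 : ∀ x, 0 ≤ G x := fun x => M.growthRate_nonneg _ (Real.exp_pos x)
  have hG1 : ∀ x, G x ≤ g := fun x => hgr _ _ (Real.exp_pos x)
  have hGL : ∀ x y, |G x - G y| ≤ 2 * |x - y| := fun x y =>
    M.abs_growthRate_sub_le hm hR hR0 hR1 _ x y
  set d := M.torusDist (node s u) (node s v) with hdd
  have hd0 : 0 ≤ d := M.torusDist_nonneg _ _
  have hH := sum_inv_le_log_div ht₀ htT
  have hinv := hS.one_div_le hη hNu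
  have hHpos : 0 ≤ ∑ τ ∈ Finset.Ico t₀ T, 1 / (τ : ℝ) :=
    Finset.sum_nonneg fun τ _ => by positivity
  have herr : (2 * η + 1 / t₀) * ((∑ τ ∈ Finset.Ico t₀ T, 1 / (τ : ℝ)) + 1) ≤ 3 := by
    have h1 : (2 * η + 1 / (t₀ : ℝ)) ≤ 3 * η := by linarith
    calc (2 * η + 1 / (t₀ : ℝ)) * ((∑ τ ∈ Finset.Ico t₀ T, 1 / (τ : ℝ)) + 1) ≤
        3 * η * ((∑ τ ∈ Finset.Ico t₀ T, 1 / (τ : ℝ)) + 1) := by gcongr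
      _ ≤ 3 * η * (Real.log T - Real.log t₀ + 2) := by
        have : (∑ τ ∈ Finset.Ico t₀ T, 1 / (τ : ℝ)) + 1 ≤ Real.log T - Real.log t₀ + 2 := by
          linarith
        gcongr
      _ ≤ 3 := by linarith
  have hγ : ∀ x τ, 0 ≤ M.growthRate (node s x) (M.sphereVol s x τ) ∧
      M.growthRate (node s x) (M.sphereVol s x τ) ≤ 1 := by
    intro x τ
    rcases Nat.eq_zero_or_pos τ with rfl | h
    -- At time zero, division by zero makes both the volume and the rate zero.
    · simp [sphereVol, growthRate]
    · have := M.sphereVol_pos s x h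
      exact ⟨M.growthRate_nonneg _ this, (hgr _ _ this).trans hR1.le⟩
  -- At time `T` the distance is at most of the order of the radius of `u`, and earlier radii are
  -- larger by at least `(T / τ)^b` up to a constant. Hence the discrepancy of the rates is `O((τ /
  -- T)^b)`, and its sum against `1 / τ` is bounded independently of `t₀` and `T`.
  have hκu : ∀ τ, t₀ ≤ τ → τ < T →
      |M.growthRate (node s u) (M.sphereVol s u τ) - G (Real.log (M.sphereVol s u τ))| ≤
        C₀ * K * Real.exp (-(b * Real.log T)) * Real.exp (b * Real.log τ) := by
    intro τ h1 h2
    have hNτ : N ≤ M.sdeg s u τ := hNu.trans (M.sdeg_mono s u h1)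
    have hV : 0 < M.sphereVol s u τ := M.sphereVol_pos s u (ht₀.trans h1)
    have hVT : 0 < M.sphereVol s u T := M.sphereVol_pos s u (ht₀.trans htT)
    have h3 := hS.log_sphereVol_add_le hη hgr hR1.le hu hNτ h2.le hTn
    rw [hG]
    simp only
    rw [Real.exp_log hV]
    refine (hdist _ _ _ hV).trans ?_
    rw [← hdd, mul_assoc, mul_assoc]
    refine mul_le_mul_of_nonneg_left ?_ hC₀.le
    rw [← Real.exp_add]
    refine (pow_le_pow_iff_left₀ (by positivity) (by positivity) hm.ne').mp ?_
    rw [div_pow, root_pow hm hV.le, mul_pow, hK, root_pow hm (by positivity), ← Real.exp_nat_mul,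
      div_mul_eq_mul_div, ← Real.exp_add, div_le_div_iff₀ hV hcm]
    have e1 : 2 + (m : ℝ) * (-(b * Real.log T) + b * Real.log τ) =
        2 - (1 - g) * (Real.log T - Real.log τ) := by
      rw [hb]; field_simp; ring
    rw [e1]
    calc d ^ m * M.unitBallVolume ≤ M.sphereVol s u T := by linarith
      _ = Real.exp (Real.log (M.sphereVol s u T)) := (Real.exp_log hVT).symm
      _ ≤ Real.exp (2 - (1 - g) * (Real.log T - Real.log τ) + Real.log (M.sphereVol s u τ)) :=
        Real.exp_le_exp.mpr (by linarith)
      _ = _ := by rw [Real.exp_add, Real.exp_log hV]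
  have hκv : ∀ τ, t₀ ≤ τ → τ < T →
      |M.growthRate (node s v) (M.sphereVol s v τ) - G (Real.log (M.sphereVol s v τ))| ≤ 0 := by
    intro τ h1 _
    rw [hG]
    simp only
    rw [Real.exp_log (M.sphereVol_pos s v (ht₀.trans h1)), sub_self, abs_zero]
  have hu' := abs_integral_add_sum_le hR1 hG0 hG1 hGL (l := fun t => Real.log (M.sphereVol s u t))
    ht₀ htT (fun t h1 h2 => hS.abs_log_sphereVol_sub_add_sum_le hη hu hNu h1 (h2.trans hTn))
    (fun τ => (hγ u τ).1) (fun τ => (hγ u τ).2) hκu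
  have hv' := abs_integral_add_sum_le hR1 hG0 hG1 hGL (l := fun t => Real.log (M.sphereVol s v t))
    ht₀ htT (fun t h1 h2 => hS.abs_log_sphereVol_sub_add_sum_le hη hv hNv h1 (h2.trans hTn))
    (fun τ => (hγ v τ).1) (fun τ => (hγ v τ).2) (κ := fun _ => 0) hκv
  have hsum : ∑ τ ∈ Finset.Ico t₀ T,
      C₀ * K * Real.exp (-(b * Real.log T)) * Real.exp (b * Real.log τ) / τ ≤
        C₀ * K * (2 / b) := by
    have h1 := sum_rpow_div_le hb0 ht₀ htT
    simp only [mul_div_assoc _ (Real.exp _), mul_assoc C₀ K]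
    rw [← Finset.mul_sum]
    calc C₀ * (K * Real.exp (-(b * Real.log T))) * ∑ τ ∈ Finset.Ico t₀ T,
        Real.exp (b * Real.log τ) / τ ≤ C₀ * (K * Real.exp (-(b * Real.log T))) *
          (2 / b * Real.exp (b * Real.log T)) := by gcongr
      _ = C₀ * K * (2 / b) * (Real.exp (-(b * Real.log T)) * Real.exp (b * Real.log T)) := by ring
      _ = C₀ * (K * (2 / b)) := by rw [← Real.exp_add]; simp; ring
  have hEu := hu'.trans (c := E) (by
    rw [hE]
    gcongr)
  have hEv := hv'.trans (c := E) (by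
    rw [hE]
    simp only [zero_div, Finset.sum_const_zero]
    have : 0 ≤ C₀ * K * (2 / b) := by positivity
    gcongr)
  have h := sub_le_of_follow hR1 hG0 hG1 hGL hc hcc hEu hEv
  have h1 : 0 ≤ 2 * E * c := by positivity
  linarith

end SPAModel

/-! ### Pairs of nodes whose power laws have set in -/

namespace SPAModel

variable {m κ : ℕ} {M : SPAModel m κ} {s : Outcome m} {n : ℕ} {w N η a lθ : ℝ}
  {ℓ : Fin m → Fin κ}

/-- From time `T` on, the in-degree of the node `v` follows a power law with exponent `a`, and the
sphere of influence lies in the region. -/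
structure PowerLaw (M : SPAModel m κ) (s : Outcome m) (n : ℕ) (ℓ : Fin m → Fin κ) (v T : ℕ)
    (N η a : ℝ) : Prop where
  mem : v ∈ Finset.Icc 1 n
  region : node s v ∈ region ℓ
  deg_pos : (0 : ℝ) < M.degIn s v n
  le_sdeg : ∀ t, T ≤ t → t ≤ n → N ≤ M.sdeg s v t
  log_vol : ∀ t, T ≤ t → t ≤ n → |Real.log (M.sphereVol s v t) - (Real.log M.A₁ +
    Real.log (M.degIn s v n) - a * Real.log n - (1 - a) * Real.log t)| ≤ 3 * η
  log_vol_last : ∀ t, T ≤ t → t ≤ n → |Real.log (M.sphereVol s v t) -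
    (Real.log (M.sphereVol s v n) + (1 - a) * (Real.log n - Real.log t))| ≤ 2 * η
  vol_lt : ∀ t, T ≤ t → t ≤ n →
    M.sphereVol s v t < M.unitBallVolume * M.boundaryDist ℓ (node s v) ^ m

/-- Two nodes of a region whose in-degrees follow a power law from time `T` on, which is about
the time when the in-degree of `v` has order `w`. -/
structure NodePair (M : SPAModel m κ) (s : Outcome m) (n : ℕ) (ℓ : Fin m → Fin κ) (u v T : ℕ)
    (w N η a lθ : ℝ) : Prop where
  reg : M.Regular s n w N η
  eta_pos : 0 < η
  eta_le : η ≤ 1 / 20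
  ne : u ≠ v
  a_eq : a = M.p * M.ρ ℓ * M.A₁
  a_pos : 0 < a
  a_lt_one : a < 1
  one_le : 1 ≤ T
  le : T ≤ n
  left : M.PowerLaw s n ℓ u T N η a
  right : M.PowerLaw s n ℓ v T N η a
  deg_le : (M.degIn s v n : ℝ) ≤ M.degIn s u n
  w_le : w ≤ η * M.degIn s v n
  le_log : a * lθ + a * Real.log n + Real.log w - Real.log (M.degIn s v n) ≤ a * Real.log T
  log_le : a * Real.log T ≤
    a * lθ + a * Real.log n + Real.log w - Real.log (M.degIn s v n) + 2 * η

/-- Repackages `Regular.powerLaw` in terms of log volumes. Replacing the shifted final degree by the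
true one costs a further `η`, hence `3 * η` in one estimate and `2 * η` in the other. -/
theorem Regular.exists_powerLaw (hm : 0 < m) (hS : M.Regular s n w N η) (hη : 0 < η)
    {v : ℕ} (hvn : v ∈ Finset.Icc 1 n) (hv : node s v ∈ SPAModel.region ℓ)
    (ha : a = M.p * M.ρ ℓ * M.A₁) (ha0 : 0 < a) (ha1 : a < 1) {lε c₁ : ℝ}
    (hc₁ : 2 * c₁ ≤ lε) (hlθ : (1 - a) * lθ = 2 * c₁ - lε)
    (hη1 : η < 1) (hηc : 5 * η < c₁) (hηθ : Real.log η + c₁ ≤ a * lθ)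
    {j lT : ℝ} (hj : w ≤ η * j) (hjk : j ≤ M.degIn s v n)
    (hlT : lT = Real.log n + 1 / a * (Real.log w - Real.log j))
    (hδ : 0 < M.unitBallVolume * M.boundaryDist ℓ (node s v) ^ m)
    (hB : lε + Real.log M.A₁ + Real.log (M.degIn s v n) - a * Real.log n - (1 - a) * lT ≤
      Real.log (M.unitBallVolume * M.boundaryDist ℓ (node s v) ^ m)) {T : ℕ}
    (hT : T = ⌈Real.exp (lθ + lT)⌉₊) :
    M.PowerLaw s n ℓ v T N η a ∧ 1 ≤ T ∧ T ≤ n ∧ 1 / (T : ℝ) ≤ η := by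
  obtain ⟨hT1, hTn, hTinv, hβ, -, h⟩ := hS.powerLaw hm hη hvn hv ha ha0 ha1 hc₁ hlθ hη1 hηc hηθ
    hj hjk hlT hδ hB hT
  have hj0 : 0 < j := (mul_pos_iff_of_pos_left hη).mp ((hS.w_pos hη).trans_le hj)
  have hk0 : (0 : ℝ) < M.degIn s v n := hj0.trans_le hjk
  have hA := M.A₁_pos
  have hA₂ := M.A₂_pos
  have hsd : M.sdeg s v n = M.degIn s v n + M.A₂ / M.A₁ := rfl
  have hDk : Real.log (M.degIn s v n) ≤ Real.log (M.sdeg s v n) :=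
    Real.log_le_log hk0 (by rw [hsd]; linarith [div_pos hA₂ hA])
  have hDk' : Real.log (M.sdeg s v n) ≤ Real.log (M.degIn s v n) + η := by
    have h1 : M.sdeg s v n ≤ M.degIn s v n * Real.exp η := by
      have := Real.add_one_le_exp η
      have := mul_le_mul_of_nonneg_left this hk0.le
      rw [hsd]
      linarith
    calc Real.log (M.sdeg s v n) ≤ Real.log (M.degIn s v n * Real.exp η) :=
          Real.log_le_log (M.sdeg_pos s v n) h1
      _ = _ := by rw [Real.log_mul hk0.ne' (Real.exp_pos _).ne', Real.log_exp]
  refine ⟨⟨hvn, hv, hk0, fun t h1 h2 => (h t h1 h2).2.1, fun t h1 h2 => ?_, fun t h1 h2 => ?_,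
    fun t h1 h2 => (h t h1 h2).2.2⟩, hT1, hTn, hTinv⟩
  · have := (h t h1 h2).1
    rw [M.log_sphereVol s v (hT1.trans h1)]
    rw [abs_le] at this ⊢
    constructor <;> linarith
  · have := (h t h1 h2).1
    rw [M.log_sphereVol s v (hT1.trans h1), M.log_sphereVol s v hS.n_pos]
    rw [abs_le] at this ⊢
    constructor <;> linarith

/-- Both nodes use the same time scale `lT`, determined by the smaller degree; this is why
`exists_powerLaw` allows any `j` not exceeding the final degree. -/
theorem Regular.exists_nodePair (hm : 0 < m) (hS : M.Regular s n w N η) (hη : 0 < η)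
    (hη1 : η ≤ 1 / 20) {u v : ℕ} (hne : u ≠ v)
    (hun : u ∈ Finset.Icc 1 n) (hu : node s u ∈ SPAModel.region ℓ)
    (hvn : v ∈ Finset.Icc 1 n) (hv : node s v ∈ SPAModel.region ℓ)
    (ha : a = M.p * M.ρ ℓ * M.A₁) (ha0 : 0 < a) (ha1 : a < 1) {lε c₁ : ℝ}
    (hc₁ : 2 * c₁ ≤ lε) (hlθ : (1 - a) * lθ = 2 * c₁ - lε)
    (hηc : 5 * η < c₁) (hηθ : Real.log η + c₁ ≤ a * lθ)
    {lT : ℝ} (hj : w ≤ η * M.degIn s v n) (hjk : (M.degIn s v n : ℝ) ≤ M.degIn s u n)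
    (hlT : lT = Real.log n + 1 / a * (Real.log w - Real.log (M.degIn s v n)))
    (hδu : 0 < M.unitBallVolume * M.boundaryDist ℓ (node s u) ^ m)
    (hδv : 0 < M.unitBallVolume * M.boundaryDist ℓ (node s v) ^ m)
    (hBu : lε + Real.log M.A₁ + Real.log (M.degIn s u n) - a * Real.log n - (1 - a) * lT ≤
      Real.log (M.unitBallVolume * M.boundaryDist ℓ (node s u) ^ m))
    (hBv : lε + Real.log M.A₁ + Real.log (M.degIn s v n) - a * Real.log n - (1 - a) * lT ≤
      Real.log (M.unitBallVolume * M.boundaryDist ℓ (node s v) ^ m)) :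
    ∃ T, M.NodePair s n ℓ u v T w N η a lθ := by
  obtain ⟨h1, hT1, hTn, hinv⟩ := hS.exists_powerLaw hm hη hun hu ha ha0 ha1 hc₁ hlθ (by linarith)
    hηc hηθ hj hjk hlT hδu hBu rfl
  obtain ⟨h2, -⟩ := hS.exists_powerLaw hm hη hvn hv ha ha0 ha1 hc₁ hlθ (by linarith)
    hηc hηθ hj le_rfl hlT hδv hBv rfl
  have haT : a * lT = a * Real.log n + (Real.log w - Real.log (M.degIn s v n)) := by
    rw [hlT]
    field_simp
  set T := ⌈Real.exp (lθ + lT)⌉₊ with hT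
  have hTpos : (0 : ℝ) < T := by exact_mod_cast hT1
  have hlow : lθ + lT ≤ Real.log T := (Real.le_log_iff_exp_le hTpos).mpr (Nat.le_ceil _)
  -- Since `1 / T ≤ η`, rounding up changes the time by a factor of at most `1 / (1 - η) ≤ exp (2
  -- η)`.
  have hup : Real.log T ≤ lθ + lT + 2 * η := by
    have h3 : (T : ℝ) < Real.exp (lθ + lT) + 1 := Nat.ceil_lt_add_one (Real.exp_pos _).le
    have h4 : 1 ≤ η * T := by rwa [div_le_iff₀ hTpos] at hinv
    have h5 := Real.add_one_le_exp (2 * η)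
    have h6 : (T : ℝ) ≤ Real.exp (lθ + lT) * Real.exp (2 * η) := by
      have h7 : (T : ℝ) * (1 - η) ≤ Real.exp (lθ + lT) := by linarith
      have h8 : (T : ℝ) * (1 - η) * (2 * η + 1) ≤ Real.exp (lθ + lT) * Real.exp (2 * η) := by
        gcongr
      have h9 : (1 : ℝ) ≤ (1 - η) * (2 * η + 1) := by nlinarith
      have := mul_le_mul_of_nonneg_left h9 hTpos.le
      linarith
    rw [← Real.exp_add] at h6
    exact (Real.log_le_iff_le_exp hTpos).mpr h6
  refine ⟨T, hS, hη, hη1, hne, ha, ha0, ha1, hT1, hTn, h1, h2, hjk, hj, ?_, ?_⟩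
  · have := mul_le_mul_of_nonneg_left hlow ha0.le
    linarith
  · have h3 := mul_le_mul_of_nonneg_left hup ha0.le
    have h4 : a * η ≤ 1 * η := mul_le_mul_of_nonneg_right ha1.le hη.le
    linarith

namespace NodePair

variable {u v T : ℕ}

theorem inv_le (P : M.NodePair s n ℓ u v T w N η a lθ) {t : ℕ} (ht : T ≤ t) :
    1 / (t : ℝ) ≤ η := by
  have h1 := P.reg.one_div_le P.eta_pos (P.left.le_sdeg T le_rfl P.le)
  have h2 : (0 : ℝ) < T := by exact_mod_cast P.one_le
  exact (one_div_le_one_div_of_le h2 (by exact_mod_cast ht)).trans h1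

theorem abs_log_sdeg_sub_le (P : M.NodePair s n ℓ u v T w N η a lθ) {t : ℕ} (ht : T ≤ t)
    (htn : t ≤ n) : |Real.log (M.sdeg s v t) -
      (Real.log (M.degIn s v n) - a * Real.log n + a * Real.log t)| ≤ 3 * η := by
  have h := P.right.log_vol t ht htn
  rw [M.log_sphereVol s v (P.one_le.trans ht)] at h
  rw [abs_le] at h ⊢
  constructor <;> linarith

theorem sdeg_le (P : M.NodePair s n ℓ u v T w N η a lθ) {t : ℕ} (ht : T ≤ t) (htn : t ≤ n)
    {L : ℝ} (hL : Real.log (M.degIn s v n) - a * Real.log n + a * Real.log t + 3 * η ≤ L) :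
    M.sdeg s v t ≤ Real.exp L := by
  rw [← Real.log_le_iff_le_exp (M.sdeg_pos s v t)]
  have := (abs_le.mp (P.abs_log_sdeg_sub_le ht htn)).2
  linarith

theorem le_sdeg (P : M.NodePair s n ℓ u v T w N η a lθ) {t : ℕ} (ht : T ≤ t) (htn : t ≤ n)
    {L : ℝ} (hL : L ≤ Real.log (M.degIn s v n) - a * Real.log n + a * Real.log t - 3 * η) :
    Real.exp L ≤ M.sdeg s v t := by
  rw [← Real.le_log_iff_exp_le (M.sdeg_pos s v t)]
  have := (abs_le.mp (P.abs_log_sdeg_sub_le ht htn)).1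
  linarith

/-- The ratio of the sizes of the spheres of influence at time `n`, up to a constant factor. -/
theorem abs_log_sub_log_vol_le (P : M.NodePair s n ℓ u v T w N η a lθ) {t : ℕ} (ht : T ≤ t)
    (htn : t ≤ n) : |Real.log (M.sphereVol s v t) - Real.log (M.sphereVol s u t) -
      (Real.log (M.degIn s v n) - Real.log (M.degIn s u n))| ≤ 6 * η := by
  have h1 := P.left.log_vol t ht htn
  have h2 := P.right.log_vol t ht htn
  rw [abs_le] at h1 h2 ⊢
  constructor <;> linarith

theorem radius_left (P : M.NodePair s n ℓ u v T w N η a lθ) (hm : 0 < m) {t : ℕ} (ht : T ≤ t)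
    (htn : t ≤ n) : M.radius (M.sphereVol s u t) =
      (M.sphereVol s u t / M.unitBallVolume) ^ (1 / (m : ℝ)) :=
  M.radius_eq_of_lt_boundaryDist hm P.left.region
    (M.sphereVol_pos s u (P.one_le.trans ht)).le (P.left.vol_lt t ht htn)

theorem radius_right (P : M.NodePair s n ℓ u v T w N η a lθ) (hm : 0 < m) {t : ℕ} (ht : T ≤ t)
    (htn : t ≤ n) : M.radius (M.sphereVol s v t) =
      (M.sphereVol s v t / M.unitBallVolume) ^ (1 / (m : ℝ)) :=
  M.radius_eq_of_lt_boundaryDist hm P.right.region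
    (M.sphereVol_pos s v (P.one_le.trans ht)).le (P.right.vol_lt t ht htn)

/-- The sum of the linking probabilities while the sphere of `v` is contained in that of `u`. -/
theorem _root_.SPAModel.Regular.abs_commonNbrs_sub_le (hS : M.Regular s n w N η) (hη : 0 < η)
    (hne : u ≠ v) (hu : u ∈ Finset.Icc 1 n) (hv : v ∈ Finset.Icc 1 n) {t₀ t₁ : ℕ}
    (h : t₀ ≤ t₁) (ht₁ : t₁ ≤ n) (hNu : N ≤ M.sdeg s u t₀) (hNv : N ≤ M.sdeg s v t₀)
    (hsub : ∀ τ, t₀ ≤ τ → τ < t₁ → M.ballOfVolume (node s v) (M.sphereVol s v τ) ⊆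
      M.ballOfVolume (node s u) (M.sphereVol s u τ)) :
    |((M.commonNbrs s u v t₁ : ℝ) - M.commonNbrs s u v t₀) -
      M.p * (M.sdeg s v t₁ - M.sdeg s v t₀)| ≤ 2 * η * (M.sdeg s v t₁ + w) := by
  have h1 := hS.pair u hu v hv t₀ t₁ h ht₁
  have h2 := hS.pair v hv v hv t₀ t₁ h ht₁
  rw [Finset.pair_eq_singleton] at h2
  have hu1 := hS.lt_of_le_sdeg hη hNu
  have hv1 := hS.lt_of_le_sdeg hη hNv
  have h3 : ∑ τ ∈ Finset.Ico t₀ t₁, M.linkProb {u, v} τ s =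
      M.p * ∑ τ ∈ Finset.Ico t₀ t₁, M.linkProb {v} τ s := by
    rw [Finset.mul_sum]
    refine Finset.sum_congr rfl fun τ hτ => ?_
    rw [Finset.mem_Ico] at hτ
    exact M.linkProb_pair_of_subset s hne (Finset.mem_Icc.mpr (by omega))
      (Finset.mem_Icc.mpr (by omega)) (hsub τ hτ.1 hτ.2)
  rw [M.sum_linkInd_pair s u v h, h3] at h1
  rw [M.sum_linkInd_single s v h] at h2
  have h4 : |M.p * (M.sdeg s v t₁ - M.sdeg s v t₀) -
      M.p * ∑ τ ∈ Finset.Ico t₀ t₁, M.linkProb {v} τ s| ≤ η * (M.sdeg s v t₁ + w) := by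
    rw [← mul_sub, abs_mul, abs_of_pos M.p_pos]
    refine le_trans ?_ h2
    exact mul_le_of_le_one_left (abs_nonneg _) M.p_lt_one.le
  rw [abs_le] at h1 h4 ⊢
  constructor <;> linarith

end NodePair

end SPAModel

/-! ### Radii of the two spheres: containment and disjointness -/

namespace SPAModel

namespace NodePair

variable {m κ : ℕ} {M : SPAModel m κ} {s : Outcome m} {n : ℕ} {w N η a lθ : ℝ}
  {ℓ : Fin m → Fin κ} {u v T : ℕ}

theorem log_root (hm : 0 < m) {x : ℝ} (hx : 0 < x) :
    m * Real.log (x ^ (1 / (m : ℝ))) = Real.log x := by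
  have : (0 : ℝ) < m := by exact_mod_cast hm
  rw [Real.log_rpow hx]
  field_simp

section Radii

variable {y d L : ℝ} {t : ℕ}

/-- Both volumes follow the same power of `t`, so the ratio of the radii stays near `y = (j /
k)^(1/m)`. The factor two absorbs `exp (6 η)`. -/
theorem radius_right_le_mul (P : M.NodePair s n ℓ u v T w N η a lθ) (hm : 0 < m) (hy : 0 < y)
    (hlogy : m * Real.log y = Real.log (M.degIn s v n) - Real.log (M.degIn s u n))
    (ht : T ≤ t) (htn : t ≤ n) :
    (M.sphereVol s v t / M.unitBallVolume) ^ (1 / (m : ℝ)) ≤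
      2 * y * (M.sphereVol s u t / M.unitBallVolume) ^ (1 / (m : ℝ)) := by
  have hcm := M.unitBallVolume_pos
  have hm1 : (1 : ℝ) ≤ m := by exact_mod_cast hm
  have hVu := M.sphereVol_pos s u (P.one_le.trans ht)
  have hVv := M.sphereVol_pos s v (P.one_le.trans ht)
  set ru := (M.sphereVol s u t / M.unitBallVolume) ^ (1 / (m : ℝ)) with hru
  set rv := (M.sphereVol s v t / M.unitBallVolume) ^ (1 / (m : ℝ)) with hrv
  have hru0 : 0 < ru := Real.rpow_pos_of_pos (by positivity) _
  have hrv0 : 0 < rv := Real.rpow_pos_of_pos (by positivity) _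
  have h1 := log_root hm (div_pos hVu hcm)
  have h2 := log_root hm (div_pos hVv hcm)
  rw [← hru, Real.log_div hVu.ne' hcm.ne'] at h1
  rw [← hrv, Real.log_div hVv.ne' hcm.ne'] at h2
  have h3 := (abs_le.mp (P.abs_log_sub_log_vol_le ht htn)).2
  have h4 : Real.log rv ≤ Real.log ru + Real.log y + 6 * η := by
    have h5 : (m : ℝ) * Real.log rv ≤ m * (Real.log ru + Real.log y + 6 * η) := by
      have := mul_le_mul_of_nonneg_right hm1 (by linarith [P.eta_pos] : 0 ≤ 6 * η)
      linarith
    exact le_of_mul_le_mul_left h5 (by linarith)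
  have h6 : Real.log rv ≤ Real.log (2 * y * ru) := by
    rw [Real.log_mul (by positivity) (by positivity), Real.log_mul (by norm_num) hy.ne']
    have := Real.log_two_gt_d9
    have := P.eta_le
    linarith
  exact (Real.log_le_log_iff hrv0 (by positivity)).mp h6

/-- The equation for `L` says that `exp L` is the time at which the extrapolated radius of `u`
equals `d`. -/
theorem abs_log_radius_sub_le (P : M.NodePair s n ℓ u v T w N η a lθ) (hm : 0 < m)
    (hL : (1 - a) * L = Real.log M.A₁ + Real.log (M.degIn s u n) - Real.log M.unitBallVolume -
      a * Real.log n - m * Real.log d) (ht : T ≤ t) (htn : t ≤ n) :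
    |m * Real.log ((M.sphereVol s u t / M.unitBallVolume) ^ (1 / (m : ℝ))) - m * Real.log d -
      (1 - a) * (L - Real.log t)| ≤ 3 * η := by
  have hcm := M.unitBallVolume_pos
  have hVu := M.sphereVol_pos s u (P.one_le.trans ht)
  rw [log_root hm (div_pos hVu hcm), Real.log_div hVu.ne' hcm.ne']
  have := P.left.log_vol t ht htn
  rw [abs_le] at this ⊢
  constructor <;> linarith

/-- Before `exp L`, with the stated margin, `d ≤ exp(-4y) r_u ≤ (1 - 2y) r_u`, while `r_v ≤ 2y r_u`.
The second step on `d` needs `4y ≤ 1`. -/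
theorem add_radius_le (P : M.NodePair s n ℓ u v T w N η a lθ) (hm : 0 < m) (hd : 0 < d)
    (hy : 0 < y) (hy1 : 4 * y ≤ 1)
    (hlogy : m * Real.log y = Real.log (M.degIn s v n) - Real.log (M.degIn s u n))
    (hL : (1 - a) * L = Real.log M.A₁ + Real.log (M.degIn s u n) - Real.log M.unitBallVolume -
      a * Real.log n - m * Real.log d) (ht : T ≤ t) (htn : t ≤ n)
    (h : 3 * η + 4 * m * y ≤ (1 - a) * (L - Real.log t)) :
    d + (M.sphereVol s v t / M.unitBallVolume) ^ (1 / (m : ℝ)) ≤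
      (M.sphereVol s u t / M.unitBallVolume) ^ (1 / (m : ℝ)) := by
  have hcm := M.unitBallVolume_pos
  have hm0 : (0 : ℝ) < m := by exact_mod_cast hm
  have hVu := M.sphereVol_pos s u (P.one_le.trans ht)
  have h1 := P.radius_right_le_mul hm hy hlogy ht htn
  have h2 := (abs_le.mp (P.abs_log_radius_sub_le hm hL ht htn)).1
  set ru := (M.sphereVol s u t / M.unitBallVolume) ^ (1 / (m : ℝ)) with hru
  have hru0 : 0 < ru := Real.rpow_pos_of_pos (by positivity) _
  have h3 : Real.log d ≤ Real.log ru - 4 * y := by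
    have h5 : (m : ℝ) * Real.log d ≤ m * (Real.log ru - 4 * y) := by linarith
    exact le_of_mul_le_mul_left h5 hm0
  have h4 : d * Real.exp (4 * y) ≤ ru := by
    have := Real.exp_le_exp.mpr (by linarith : Real.log d + 4 * y ≤ Real.log ru)
    rwa [Real.exp_add, Real.exp_log hd, Real.exp_log hru0] at this
  have h5 := mul_le_mul_of_nonneg_left (Real.add_one_le_exp (4 * y)) hd.le
  have h6 : d ≤ ru * (1 - 2 * y) := by
    have h7 : d * (4 * y + 1) ≤ ru := h5.trans h4
    have h8 := mul_le_mul_of_nonneg_right h7 (by linarith : 0 ≤ 1 - 2 * y)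
    have h9 : d * 1 ≤ d * ((4 * y + 1) * (1 - 2 * y)) := by
      refine mul_le_mul_of_nonneg_left ?_ hd.le
      nlinarith
    linarith
  linarith

/-- The mirror image of `add_radius_le`: after `exp L` the radius of `u` has dropped below `exp(-4y)
d`, and `1 + 2y < exp(4y)`, so no smallness of `y` is required. -/
theorem radius_add_radius_lt (P : M.NodePair s n ℓ u v T w N η a lθ) (hm : 0 < m) (hd : 0 < d)
    (hy : 0 < y)
    (hlogy : m * Real.log y = Real.log (M.degIn s v n) - Real.log (M.degIn s u n))
    (hL : (1 - a) * L = Real.log M.A₁ + Real.log (M.degIn s u n) - Real.log M.unitBallVolume -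
      a * Real.log n - m * Real.log d) (ht : T ≤ t) (htn : t ≤ n)
    (h : 3 * η + 4 * m * y ≤ (1 - a) * (Real.log t - L)) :
    (M.sphereVol s u t / M.unitBallVolume) ^ (1 / (m : ℝ)) +
      (M.sphereVol s v t / M.unitBallVolume) ^ (1 / (m : ℝ)) < d := by
  have hcm := M.unitBallVolume_pos
  have hm0 : (0 : ℝ) < m := by exact_mod_cast hm
  have hVu := M.sphereVol_pos s u (P.one_le.trans ht)
  have h1 := P.radius_right_le_mul hm hy hlogy ht htn
  have h2 := (abs_le.mp (P.abs_log_radius_sub_le hm hL ht htn)).2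
  set ru := (M.sphereVol s u t / M.unitBallVolume) ^ (1 / (m : ℝ)) with hru
  have hru0 : 0 < ru := Real.rpow_pos_of_pos (by positivity) _
  have h3 : Real.log ru ≤ Real.log d - 4 * y := by
    have h5 : (m : ℝ) * Real.log ru ≤ m * (Real.log d - 4 * y) := by linarith
    exact le_of_mul_le_mul_left h5 hm0
  have h4 : ru * Real.exp (4 * y) ≤ d := by
    have := Real.exp_le_exp.mpr (by linarith : Real.log ru + 4 * y ≤ Real.log d)
    rwa [Real.exp_add, Real.exp_log hd, Real.exp_log hru0] at this
  have h5 := mul_le_mul_of_nonneg_left (Real.add_one_le_exp (4 * y)) hru0.le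
  have h6 : 0 < ru * y := by positivity
  linarith

/-- After a certain time the spheres of influence are disjoint and no common neighbour is added. -/
theorem exists_commonNbrs_eq (P : M.NodePair s n ℓ u v T w N η a lθ) (hm : 0 < m)
    (hd : 0 < M.torusDist (node s u) (node s v)) (hy : 0 < y)
    (hlogy : m * Real.log y = Real.log (M.degIn s v n) - Real.log (M.degIn s u n))
    (hL : (1 - a) * L = Real.log M.A₁ + Real.log (M.degIn s u n) - Real.log M.unitBallVolume -
      a * Real.log n - m * Real.log (M.torusDist (node s u) (node s v))) :
    ∃ t₁, T ≤ t₁ ∧ t₁ ≤ n ∧ M.commonNbrs s u v n = M.commonNbrs s u v t₁ ∧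
      Real.log t₁ ≤ max (Real.log T) (L + (3 * η + 4 * m * y) / (1 - a) + η) := by
  have ha : 0 < 1 - a := by linarith [P.a_lt_one]
  set X := L + (3 * η + 4 * m * y) / (1 - a) with hX
  have hT0 : (0 : ℝ) < T := by exact_mod_cast P.one_le
  refine ⟨min n (max T ⌈Real.exp X⌉₊), le_min P.le (le_max_left _ _), min_le_left _ _, ?_, ?_⟩
  · have hsum := M.sum_linkInd_pair s u v (min_le_left n (max T ⌈Real.exp X⌉₊))
    rw [Finset.sum_eq_zero] at hsum
    · have : (M.commonNbrs s u v n : ℝ) =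
        M.commonNbrs s u v (min n (max T ⌈Real.exp X⌉₊)) := by linarith
      exact_mod_cast this
    · intro τ hτ
      rw [Finset.mem_Ico] at hτ
      have hτn : max T ⌈Real.exp X⌉₊ ≤ τ := by
        rcases min_le_iff.mp hτ.1 with h | h
        · omega
        · exact h
      have hTτ : T ≤ τ := (le_max_left _ _).trans hτn
      have hτ0 : (0 : ℝ) < τ := by exact_mod_cast P.one_le.trans hTτ
      have hXτ : X ≤ Real.log τ := by
        rw [Real.le_log_iff_exp_le hτ0]
        exact (Nat.le_ceil _).trans (by exact_mod_cast (le_max_right _ _).trans hτn)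
      refine M.linkInd_pair_of_disjoint s ?_
      refine M.ballOfVolume_disjoint_of_radius
        (M.lt_one_of_lt_boundaryDist hm P.left.region (M.sphereVol_pos s u (P.one_le.trans hTτ)).le
          (P.left.vol_lt τ hTτ hτ.2.le))
        (M.lt_one_of_lt_boundaryDist hm P.right.region (M.sphereVol_pos s v (P.one_le.trans hTτ)).le
          (P.right.vol_lt τ hTτ hτ.2.le)) ?_
      rw [P.radius_left hm hTτ hτ.2.le, P.radius_right hm hTτ hτ.2.le]
      refine P.radius_add_radius_lt hm hd hy hlogy hL hTτ hτ.2.le ?_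
      calc 3 * η + 4 * m * y = (1 - a) * ((3 * η + 4 * m * y) / (1 - a)) := by field_simp
        _ ≤ (1 - a) * (Real.log τ - L) := by
          refine mul_le_mul_of_nonneg_left ?_ ha.le
          linarith
  · have hn0 : (0 : ℝ) < n := by exact_mod_cast P.reg.n_pos
    have hmin : 1 ≤ min n (max T ⌈Real.exp X⌉₊) :=
      le_min P.reg.n_pos (P.one_le.trans (le_max_left _ _))
    have h1 : Real.log (min n (max T ⌈Real.exp X⌉₊) : ℕ) ≤
        Real.log (max T ⌈Real.exp X⌉₊ : ℕ) :=
      Real.log_le_log (by exact_mod_cast hmin) (by exact_mod_cast min_le_right _ _)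
    refine h1.trans ?_
    rcases le_or_gt ⌈Real.exp X⌉₊ T with h | h
    · rw [max_eq_left h]
      exact le_max_left _ _
    · rw [max_eq_right h.le]
      refine le_trans ?_ (le_max_right _ _)
      have h2 : (⌈Real.exp X⌉₊ : ℝ) < Real.exp X + 1 := Nat.ceil_lt_add_one (Real.exp_pos _).le
      have h3 : (T : ℝ) < Real.exp X := Nat.lt_ceil.mp h
      have h4 : 1 ≤ η * T := by
        have := P.inv_le le_rfl
        rwa [div_le_iff₀ hT0] at this
      have hc0 : (0 : ℝ) < ⌈Real.exp X⌉₊ := hT0.trans (by exact_mod_cast h)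
      rw [Real.log_le_iff_le_exp hc0, Real.exp_add X η]
      have h5 := mul_le_mul_of_nonneg_left (Real.add_one_le_exp η) (Real.exp_pos X).le
      have h6 := mul_le_mul_of_nonneg_left h3.le P.eta_pos.le
      linarith

end Radii

end NodePair

end SPAModel

/-! ### The early phase, before the power laws -/

namespace SPAModel

variable {m κ : ℕ} {M : SPAModel m κ}

theorem NodePair.log_sdeg_left_ge {s : Outcome m} {n : ℕ} {w N η a lθ : ℝ}
    {ℓ : Fin m → Fin κ} {u v T : ℕ} (P : M.NodePair s n ℓ u v T w N η a lθ) :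
    a * lθ + Real.log w - 3 * η ≤ Real.log (M.sdeg s u T) := by
  have h1 := (abs_le.mp (P.left.log_vol T le_rfl P.le)).1
  rw [M.log_sphereVol s u P.one_le] at h1
  have h2 := Real.log_le_log P.right.deg_pos P.deg_le
  have h3 := P.le_log
  linarith

theorem NodePair.log_sdeg_right_le {s : Outcome m} {n : ℕ} {w N η a lθ : ℝ}
    {ℓ : Fin m → Fin κ} {u v T : ℕ} (P : M.NodePair s n ℓ u v T w N η a lθ) :
    Real.log (M.sdeg s v T) ≤ a * lθ + Real.log w + 5 * η := by
  have h1 := (abs_le.mp (P.abs_log_sdeg_sub_le le_rfl P.le)).2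
  have h3 := P.log_le
  linarith

/-- The time it takes a node to increase its in-degree is bounded. -/
theorem NodePair.log_sub_log_le {s : Outcome m} {n : ℕ} {w N η a lθ γ ψ : ℝ}
    {ℓ : Fin m → Fin κ} {u v T : ℕ} (P : M.NodePair s n ℓ u v T w N η a lθ) (hγ0 : 0 < γ)
    (hγ : ∀ V, 0 < V → V ≤ M.A₁ + M.A₂ → γ ≤ M.growthRate (node s v) V) (hψ : 0 < ψ)
    {t : ℕ} (ht : t ≤ T) (hN : N ≤ M.sdeg s v t) (htψ : ψ * w ≤ M.sdeg s v t) :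
    Real.log T - Real.log t ≤ (|a * lθ| + 1 + |Real.log ψ|) / γ := by
  have hη := P.eta_pos
  have hw := P.reg.w_pos hη
  have ht1 := (P.reg.lt_of_le_sdeg hη hN).2
  have h1 := (abs_le.mp ((P.reg.path v P.right.mem).growth t T ht P.le hN)).1
  have h2 := P.log_sdeg_right_le
  have h3 : Real.log ψ + Real.log w ≤ Real.log (M.sdeg s v t) := by
    rw [← Real.log_mul hψ.ne' hw.ne']
    exact Real.log_le_log (by positivity) htψ
  have h4 := log_div_le_sum_inv (show 1 ≤ t by omega) ht
  have h5 : γ * ∑ τ ∈ Finset.Ico t T, 1 / (τ : ℝ) ≤ ∑ τ ∈ Finset.Ico t T,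
      M.growthRate (node s v) (M.sphereVol s v τ) / τ := by
    rw [Finset.mul_sum]
    refine Finset.sum_le_sum fun τ hτ => ?_
    rw [Finset.mem_Ico] at hτ
    rw [mul_one_div]
    have hτ1 : 1 ≤ τ := by omega
    have := hγ _ (M.sphereVol_pos s v hτ1) (M.sphereVol_le s v hτ1)
    gcongr
  have h6 := mul_le_mul_of_nonneg_left h4 hγ0.le
  rw [le_div_iff₀ hγ0]
  have h7 := le_abs_self (a * lθ)
  have h8 := neg_abs_le (Real.log ψ)
  have h9 := P.eta_le
  linarith

/-- A node which becomes large enough within a bounded time must have been above the level `N`. -/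
theorem NodePair.le_sdeg_left {s : Outcome m} {n : ℕ} {w N η a lθ h : ℝ}
    {ℓ : Fin m → Fin κ} {u v T : ℕ} (P : M.NodePair s n ℓ u v T w N η a lθ)
    (hγ : ∀ x V, 0 < V → M.growthRate x V ≤ 1) (hηh : Real.log η + h + 1 < a * lθ)
    {t : ℕ} (ht : t ≤ T) (ht1 : 1 ≤ t) (hh : Real.log T - Real.log t ≤ h) :
    N ≤ M.sdeg s u t := by
  have hη := P.eta_pos
  have hw := P.reg.w_pos hη
  by_contra hcon
  rw [not_le] at hcon
  have hex : ∃ y, t ≤ y ∧ N ≤ M.sdeg s u y := ⟨T, ht, P.left.le_sdeg T le_rfl P.le⟩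
  classical
  obtain ⟨hty, hNy⟩ := Nat.find_spec hex
  have hyT : Nat.find hex ≤ T := Nat.find_min' hex ⟨ht, P.left.le_sdeg T le_rfl P.le⟩
  have hmin : ∀ z, z < Nat.find hex → ¬ (t ≤ z ∧ N ≤ M.sdeg s u z) := fun z => Nat.find_min hex
  generalize Nat.find hex = y at hty hNy hyT hmin
  have hty' : t < y := lt_of_le_of_ne hty fun h => by
    rw [← h] at hNy
    linarith
  have hprev : M.sdeg s u (y - 1) < N := by
    by_contra hcon2
    exact hmin (y - 1) (by omega) ⟨by omega, not_lt.mp hcon2⟩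
  have hstep := (P.reg.path u P.left.mem).step (y - 1)
  rw [Nat.sub_add_cancel (by omega)] at hstep
  have h1 := (abs_le.mp ((P.reg.path u P.left.mem).growth y T hyT P.le hNy)).2
  -- From its first passage above `N`, at a value of at most `N + 1 ≤ η w`, the degree grows at rate
  -- at most one for a logarithmic time of at most `h`. This is too little to reach the order `w` at
  -- time `T`.
  have h2 : ∑ τ ∈ Finset.Ico y T, M.growthRate (node s u) (M.sphereVol s u τ) / τ ≤
      ∑ τ ∈ Finset.Ico y T, 1 / (τ : ℝ) := by
    refine Finset.sum_le_sum fun τ hτ => ?_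
    rw [Finset.mem_Ico] at hτ
    have := hγ (node s u) _ (M.sphereVol_pos s u (show 1 ≤ τ by omega))
    gcongr
  have h3 := sum_inv_le_log_div (show 1 ≤ y by omega) hyT
  have h4 := P.reg.one_div_le hη hNy
  have h5 : Real.log t ≤ Real.log y :=
    Real.log_le_log (by exact_mod_cast ht1) (by exact_mod_cast hty)
  have h6 := P.log_sdeg_left_ge
  have h7 : Real.log (M.sdeg s u y) ≤ Real.log η + Real.log w := by
    rw [← Real.log_mul hη.ne' hw.ne']
    exact Real.log_le_log (M.sdeg_pos s u y) (by linarith [P.reg.N_le])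
  have h8 := P.eta_le
  linarith

/-- A sphere of influence which lies in its region and contains a concentric ball of volume
`cm * d ^ m` with a margin did so earlier as well. -/
theorem NodePair.le_log_sphereVol {s : Outcome m} {n : ℕ} {w N η a lθ c₁ D : ℝ}
    {ℓ : Fin m → Fin κ} {u v T : ℕ} (P : M.NodePair s n ℓ u v T w N η a lθ) (hm : 0 < m)
    (hc : 14 * η < c₁) (hD : 2 * c₁ - 5 * η ≤ Real.log (M.sphereVol s u T) - D)
    {t : ℕ} (ht : t ≤ T) (hN : N ≤ M.sdeg s u t) :
    D + c₁ / 2 ≤ Real.log (M.sphereVol s u t) := by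
  have hη := P.eta_pos
  have ht1 : 1 ≤ t := by have := (P.reg.lt_of_le_sdeg hη hN).2; omega
  -- A sphere smaller than this would satisfy the hypotheses of `forward` with a threshold below the
  -- volume at time `T`, and would then have to stay below that threshold.
  by_contra hcon
  rw [not_le] at hcon
  have hVT := M.sphereVol_pos s u P.one_le
  have hinv := P.reg.one_div_le hη hN
  have hδ := P.left.vol_lt T le_rfl P.le
  have hδ0 := hVT.trans hδ
  have hlog := Real.log_lt_log hVT hδ
  have hreg : ∀ τ, N ≤ M.sdeg s u τ →
      Real.log M.A₁ + Real.log (M.sdeg s u τ) - Real.log τ < D + c₁ →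
      M.growthRate (node s u) (M.sphereVol s u τ) = a := fun τ h1 h2 => by
    rw [P.a_eq]
    have := P.reg.lt_of_le_sdeg hη h1
    exact (growthRate_sphereVol_eq hm P.left.region (by omega) hδ0 (by linarith)).2
  have h := ((P.reg.path u P.left.mem).forward P.a_pos.le P.a_lt_one.le hreg ht1 hN
    (by rw [← M.log_sphereVol s u ht1]; linarith) ht P.le).2
  rw [← M.log_sphereVol s u P.one_le] at h
  linarith

/-- If the in-degree of `u` is much larger than that of `v`, then the sphere of `v` is contained in
the sphere of `u` already some bounded time before the power laws set in. -/
theorem exists_early_subset (hm : 0 < m) {ℓ : Fin m → Fin κ} (hρ : 0 < M.ρ ℓ) {c₁ : ℝ}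
    (hc₁ : 0 < c₁) (a lθ : ℝ) : ∃ x₁ : ℝ, ∀ ψ : ℝ, 0 < ψ → ∃ η₀ : ℝ, 0 < η₀ ∧
    ∀ {s : Outcome m} {n u v T : ℕ} {w N η : ℝ}, M.NodePair s n ℓ u v T w N η a lθ → η ≤ η₀ →
    0 < M.torusDist (node s u) (node s v) →
    2 * c₁ - 5 * η ≤ Real.log (M.sphereVol s u T) - (Real.log M.unitBallVolume +
      m * Real.log (M.torusDist (node s u) (node s v))) →
    x₁ ≤ Real.log (M.degIn s u n) - Real.log (M.degIn s v n) →
    ∀ t, t ≤ T → ψ * w ≤ M.sdeg s v t → N ≤ M.sdeg s u t ∧ N ≤ M.sdeg s v t ∧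
      M.ballOfVolume (node s v) (M.sphereVol s v t) ⊆
        M.ballOfVolume (node s u) (M.sphereVol s u t) := by
  have hcm := M.unitBallVolume_pos
  obtain ⟨R, hR0, hR1, hR⟩ := M.exists_density_bound
  have hgr : ∀ x V, 0 < V → M.growthRate x V ≤ 1 := fun x V hV =>
    (M.growthRate_le hm hR hR0 x hV).trans hR1.le
  obtain ⟨γ, hγ0, hγ⟩ := M.exists_le_growthRate hm hρ (M.A₁ + M.A₂)
  obtain ⟨C, hC, hcomp⟩ := M.exists_log_sphereVol_sub_le hm hR hR0 hR1
  obtain ⟨c₄, hc₄, hc₄1, hsub⟩ := M.exists_ballOfVolume_subset hm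
    (Real.one_lt_exp_iff.mpr (half_pos hc₁))
  have hlogc : 0 ≤ -Real.log c₄ := by linarith [Real.log_nonpos hc₄.le hc₄1]
  -- The largest value of `log k - log j` compatible with a volume ratio `V_u / V_v < 1 / c₄` at
  -- some early time; the last unit covers the errors in the power laws at time `T`.
  refine ⟨C * (-Real.log c₄ + 1) + 1, fun ψ hψ => ?_⟩
  set h := (|a * lθ| + 1 + |Real.log ψ|) / γ with hh
  have hh0 : 0 ≤ h := by positivity
  -- Here `h` bounds the logarithmic length of the early phase. The four entries keep `v` above `N`,
  -- keep the errors below the margin `c₁`, keep the error accumulated along the flow bounded, and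
  -- keep `u` above `N`.
  refine ⟨min ψ (min (c₁ / 15) (min (1 / (h + 2)) (Real.exp (a * lθ - h - 2)))), by positivity, ?_⟩
  intro s n u v T w N η P hη₀ hd hD hx t ht htψ
  have hη := P.eta_pos
  simp only [le_min_iff] at hη₀
  obtain ⟨hη1, hη2, hη3, hη4⟩ := hη₀
  have hw := P.reg.w_pos hη
  have hNv : N ≤ M.sdeg s v t := by
    have := P.reg.N_le
    have := mul_le_mul_of_nonneg_right hη1 hw.le
    linarith
  have ht1 : 1 ≤ t := by have := (P.reg.lt_of_le_sdeg hη hNv).2; omega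
  have hhor := P.log_sub_log_le hγ0 (hγ _ P.right.region) hψ ht hNv htψ
  have hlogη : Real.log η + h + 1 < a * lθ := by
    have := (Real.log_le_iff_le_exp hη).mpr hη4
    linarith
  have hNu := P.le_sdeg_left hgr hlogη ht ht1 hhor
  refine ⟨hNu, hNv, ?_⟩
  have hVu := P.le_log_sphereVol hm (by linarith) hD ht hNu
  have hVu0 := M.sphereVol_pos s u ht1
  have hVv0 := M.sphereVol_pos s v ht1
  have hVT0 := M.sphereVol_pos s u P.one_le
  set d := M.torusDist (node s u) (node s v) with hdd
  have hlogd : Real.log (M.unitBallVolume * d ^ m) = Real.log M.unitBallVolume + m * Real.log d := by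
    rw [Real.log_mul hcm.ne' (by positivity), Real.log_pow]
  -- The centre of `v` lies well inside the sphere of `u`, so failure of containment means that the
  -- volumes are comparable at time `t`. By the comparison of flows they would be comparable at time
  -- `T`, contrary to the large ratio of degrees.
  by_contra hcon
  have hV : ¬ M.sphereVol s v t ≤ c₄ * M.sphereVol s u t := fun hle => by
    refine hcon (hsub _ _ _ _ hVv0.le ?_ hle)
    rw [← hdd, mul_assoc, ← Real.log_le_log_iff (by positivity) hVu0,
      Real.log_mul (Real.exp_pos _).ne' (by positivity), Real.log_exp, hlogd]
    linarith
  have hlogV : Real.log (M.sphereVol s u t) - Real.log (M.sphereVol s v t) ≤ -Real.log c₄ := by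
    have := Real.log_lt_log (by positivity) (not_le.mp hV)
    rw [Real.log_mul hc₄.ne' hVu0.ne'] at this
    linarith
  have hfin := hcomp P.reg hη u P.left.mem v P.right.mem t T ht P.le hNu hNv
    (by
      rw [le_div_iff₀ (by linarith)] at hη3
      have : η * (Real.log T - Real.log t + 2) ≤ η * (h + 2) := by gcongr
      linarith)
    (by linarith [P.eta_le])
    (by
      rw [← hdd, ← Real.log_le_log_iff (by positivity) hVT0, hlogd]
      linarith [P.eta_le])
    _ hlogc hlogV
  have hratio := (abs_le.mp (P.abs_log_sub_log_vol_le le_rfl P.le)).2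
  have := P.eta_le
  linarith

end SPAModel

/-! ### Crude upper bounds and approximate containment -/

namespace SPAModel

variable {m κ : ℕ} {M : SPAModel m κ}

namespace NodePair

variable {s : Outcome m} {n : ℕ} {w N η a lθ : ℝ} {ℓ : Fin m → Fin κ} {u v T : ℕ}

/-- No common neighbour appears after the spheres have separated, which happens by `exp (X + O(1))`;
the degree of `v` at that time is the bound. -/
theorem commonNbrs_le_exp (P : M.NodePair s n ℓ u v T w N η a lθ) (hm : 0 < m) {y L X E : ℝ}
    (hd : 0 < M.torusDist (node s u) (node s v)) (hy : 0 < y) (hy1 : y ≤ 1)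
    (hlogy : m * Real.log y = Real.log (M.degIn s v n) - Real.log (M.degIn s u n))
    (hL : (1 - a) * L = Real.log M.A₁ + Real.log (M.degIn s u n) - Real.log M.unitBallVolume -
      a * Real.log n - m * Real.log (M.torusDist (node s u) (node s v)))
    (hLX : L ≤ X + E) (hTX : Real.log T ≤ X + E) :
    (M.commonNbrs s u v n : ℝ) ≤ Real.exp (a * (E + (1 + 4 * m) / (1 - a) + 1) + 1) *
      Real.exp (Real.log (M.degIn s v n) - a * Real.log n + a * X) := by
  have ha : 0 < 1 - a := by linarith [P.a_lt_one]
  have hη := P.eta_pos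
  have hη1 := P.eta_le
  obtain ⟨t₁, h1, h2, h3, h4⟩ := P.exists_commonNbrs_eq hm hd hy hlogy hL
  have hm0 : (0 : ℝ) < m := by exact_mod_cast hm
  have h5 : (3 * η + 4 * m * y) / (1 - a) ≤ (1 + 4 * m) / (1 - a) := by
    refine div_le_div_of_nonneg_right ?_ ha.le
    have : 4 * m * y ≤ 4 * m := mul_le_of_le_one_right (by positivity) hy1
    linarith
  have h6 : Real.log t₁ ≤ X + (E + (1 + 4 * m) / (1 - a) + 1) := by
    refine h4.trans (max_le ?_ ?_)
    · have : 0 < (1 + 4 * (m : ℝ)) / (1 - a) := by positivity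
      linarith
    · linarith
  have h7 := mul_le_mul_of_nonneg_left h6 P.a_pos.le
  rw [h3, ← Real.exp_add]
  have h8 : (M.degIn s v t₁ : ℝ) ≤ M.sdeg s v t₁ := by
    unfold sdeg
    linarith [div_pos M.A₂_pos M.A₁_pos]
  exact ((M.commonNbrs_le_degIn s u v t₁).trans h8).trans (P.sdeg_le h1 h2 (by linarith))

/-- A node pair at a large distance has few common neighbours. -/
theorem commonNbrs_le_mul (P : M.NodePair s n ℓ u v T w N η a lθ) (hm : 0 < m) {y lT D₀ : ℝ}
    (hd : 0 < M.torusDist (node s u) (node s v)) (hy : 0 < y) (hy1 : y ≤ 1)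
    (hlogy : m * Real.log y = Real.log (M.degIn s v n) - Real.log (M.degIn s u n))
    (hlT : a * lT = a * Real.log n + Real.log w - Real.log (M.degIn s v n))
    (hlogd : D₀ + Real.log w + Real.log (M.degIn s u n) - Real.log (M.degIn s v n) - lT ≤
      m * Real.log (M.torusDist (node s u) (node s v))) :
    (M.commonNbrs s u v n : ℝ) ≤
      Real.exp (a * ((|Real.log M.A₁ - Real.log M.unitBallVolume - D₀| / (1 - a) + |lθ| + 1 / a) +
        (1 + 4 * m) / (1 - a) + 1) + 1) * w := by
  have ha : 0 < 1 - a := by linarith [P.a_lt_one]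
  have ha0 := P.a_pos
  have hη := P.eta_pos
  have hη1 := P.eta_le
  set B := |Real.log M.A₁ - Real.log M.unitBallVolume - D₀| with hB
  have hB1 := le_abs_self (Real.log M.A₁ - Real.log M.unitBallVolume - D₀)
  rw [← hB] at hB1
  have hB0 : 0 ≤ B := abs_nonneg _
  have hB' : 0 ≤ B / (1 - a) := by positivity
  have ha' : 0 < 1 / a := by positivity
  obtain ⟨L, hL⟩ : ∃ L, (1 - a) * L = Real.log M.A₁ + Real.log (M.degIn s u n) -
      Real.log M.unitBallVolume - a * Real.log n -
      m * Real.log (M.torusDist (node s u) (node s v)) :=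
    ⟨_, mul_div_cancel₀ _ ha.ne'⟩
  have h1 : L ≤ lT + (B / (1 - a) + |lθ| + 1 / a) := by
    have h2 : (1 - a) * L ≤ (1 - a) * (lT + B / (1 - a)) := by
      rw [mul_add, mul_div_cancel₀ _ ha.ne']
      linarith
    have := le_of_mul_le_mul_left h2 ha
    linarith [abs_nonneg lθ]
  have h2 : Real.log T ≤ lT + (B / (1 - a) + |lθ| + 1 / a) := by
    have h3 : a * Real.log T ≤ a * (lT + |lθ| + 1 / a) := by
      rw [mul_add, mul_add, mul_one_div_cancel ha0.ne']
      have := mul_le_mul_of_nonneg_left (le_abs_self lθ) ha0.le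
      linarith [P.log_le]
    have := le_of_mul_le_mul_left h3 ha0
    linarith
  have h := P.commonNbrs_le_exp hm hd hy hy1 hlogy hL h1 h2
  rwa [show Real.log (M.degIn s v n) - a * Real.log n + a * lT = Real.log w by linarith,
    Real.exp_log (P.reg.w_pos hη)] at h

/-- The crude bound for a node pair at a small distance. -/
theorem commonNbrs_le_mul_exp (P : M.NodePair s n ℓ u v T w N η a lθ) (hm : 0 < m)
    {y lT D₀ L : ℝ}
    (hd : 0 < M.torusDist (node s u) (node s v)) (hy : 0 < y) (hy1 : y ≤ 1)
    (hlogy : m * Real.log y = Real.log (M.degIn s v n) - Real.log (M.degIn s u n))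
    (hlT : a * lT = a * Real.log n + Real.log w - Real.log (M.degIn s v n))
    (hlogd : m * Real.log (M.torusDist (node s u) (node s v)) ≤
      D₀ + Real.log w + Real.log (M.degIn s u n) - Real.log (M.degIn s v n) - lT)
    (hL : (1 - a) * L = Real.log M.A₁ + Real.log (M.degIn s u n) - Real.log M.unitBallVolume -
      a * Real.log n - m * Real.log (M.torusDist (node s u) (node s v))) :
    (M.commonNbrs s u v n : ℝ) ≤
      Real.exp (a * ((|Real.log M.A₁ - Real.log M.unitBallVolume - D₀| / (1 - a) + |lθ| + 1 / a) +
        (1 + 4 * m) / (1 - a) + 1) + 1) *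
      Real.exp (Real.log (M.degIn s v n) - a * Real.log n + a * L) := by
  have ha : 0 < 1 - a := by linarith [P.a_lt_one]
  have ha0 := P.a_pos
  have hη := P.eta_pos
  have hη1 := P.eta_le
  set B := |Real.log M.A₁ - Real.log M.unitBallVolume - D₀| with hB
  have hB1 := neg_abs_le (Real.log M.A₁ - Real.log M.unitBallVolume - D₀)
  rw [← hB] at hB1
  have hB0 : 0 ≤ B := abs_nonneg _
  have hB' : 0 ≤ B / (1 - a) := by positivity
  have ha' : 0 < 1 / a := by positivity
  refine P.commonNbrs_le_exp hm hd hy hy1 hlogy hL (by linarith [abs_nonneg lθ]) ?_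
  have h1 : lT ≤ L + B / (1 - a) := by
    have h2 : (1 - a) * lT ≤ (1 - a) * (L + B / (1 - a)) := by
      rw [mul_add _ L, mul_div_cancel₀ _ ha.ne']
      linarith
    exact le_of_mul_le_mul_left h2 ha
  have h3 : a * Real.log T ≤ a * (lT + |lθ| + 1 / a) := by
    rw [mul_add, mul_add, mul_one_div_cancel ha0.ne']
    have := mul_le_mul_of_nonneg_left (le_abs_self lθ) ha0.le
    linarith [P.log_le]
  have := le_of_mul_le_mul_left h3 ha0
  linarith

/-- Going back in time scales both radii by about `S`. The slack `(S - 1)(Ru - Rv)` gained in `d ≤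
Ru - Rv` pays for the error in `ru` when `Ru` is much larger than `Rv`; when the two are close, the
shrinking of `r` by `exp (8 η)` pays for it. -/
theorem _root_.SPAModel.add_le_of_mul_exp_le {η d Ru Rv S ru r : ℝ} (hη : 0 < η)
    (hη1 : η ≤ 1 / 20) (hRv : 0 < Rv) (hr : 0 < r) (hRR : Rv ≤ Ru) (hd : d ≤ Ru - Rv)
    (hS : 1 + 8 * η ≤ S) (h1 : Ru * S * Real.exp (-(2 * η)) ≤ ru)
    (h2 : r * Real.exp (8 * η) ≤ Rv * S) : d + r ≤ ru := by
  have hS0 : 0 < S := by linarith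
  have hRu : 0 < Ru := by linarith
  have g3 : Ru * S * (1 - 2 * η) ≤ ru := by
    refine le_trans ?_ h1
    have := Real.add_one_le_exp (-(2 * η))
    gcongr
    linarith
  have g4 : r ≤ Rv * S * (1 - 4 * η) := by
    have k1 : r * (8 * η + 1) ≤ Rv * S :=
      le_trans (mul_le_mul_of_nonneg_left (Real.add_one_le_exp _) hr.le) h2
    have k2 := mul_le_mul_of_nonneg_right k1 (by linarith : 0 ≤ 1 - 4 * η)
    have k3 : r * 1 ≤ r * ((8 * η + 1) * (1 - 4 * η)) := by
      refine mul_le_mul_of_nonneg_left ?_ hr.le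
      nlinarith
    linarith
  have hS4 : 4 * η * S ≤ S - 1 := by
    have k1 := mul_le_mul_of_nonneg_right hS (by linarith : 0 ≤ 1 - 4 * η)
    have k2 : 1 ≤ (1 + 8 * η) * (1 - 4 * η) := by nlinarith
    linarith
  have g5 : 2 * η * S * (Ru - 2 * Rv) ≤ (S - 1) * (Ru - Rv) := by
    have k1 := mul_le_mul_of_nonneg_right hS4 (by linarith : 0 ≤ Ru - Rv)
    have k2 : 0 ≤ 2 * η * S * Ru := by positivity
    linarith
  linarith

/-- If at time `n` the sphere of `v` is contained in the sphere of `u`, then some time before that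
the sphere of `u` contained almost all of the sphere of `v`. -/
theorem le_linkProb_pair (P : M.NodePair s n ℓ u v T w N η a lθ) (hm : 0 < m)
    (hd : M.torusDist (node s u) (node s v) ≤
      (M.sphereVol s u n / M.unitBallVolume) ^ (1 / (m : ℝ)) -
      (M.sphereVol s v n / M.unitBallVolume) ^ (1 / (m : ℝ)))
    {t : ℕ} (ht : T ≤ t) (htn : t ≤ n) (h : 8 * m * η ≤ (1 - a) * (Real.log n - Real.log t)) :
    M.p * Real.exp (-((8 * m + 2) * η)) * M.linkProb {v} t s ≤ M.linkProb {u, v} t s := by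
  have hcm := M.unitBallVolume_pos
  have hη := P.eta_pos
  have hη1 := P.eta_le
  have hm1 : (1 : ℝ) ≤ m := by exact_mod_cast hm
  have hd0 := M.torusDist_nonneg (node s u) (node s v)
  have ht1 := P.one_le.trans ht
  have hVu := M.sphereVol_pos s u ht1
  have hVv := M.sphereVol_pos s v ht1
  have hVun := M.sphereVol_pos s u P.reg.n_pos
  have hVvn := M.sphereVol_pos s v P.reg.n_pos
  have hVlt := P.right.vol_lt t ht htn
  -- Exact containment may fail by the error of the power laws, so the sphere of `v` is shrunk: the
  -- term `2 η` absorbs that error, and `8 m η` shrinks the radius by `exp (8 η)`.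
  set V' := M.sphereVol s v t * Real.exp (-((8 * m + 2) * η)) with hV'
  have hV'0 : 0 < V' := by positivity
  have hV'le : V' ≤ M.sphereVol s v t := by
    refine mul_le_of_le_one_right hVv.le (Real.exp_le_one_iff.mpr ?_)
    have : 0 ≤ (8 * m + 2) * η := by positivity
    linarith
  have hV'lt := hV'le.trans_lt hVlt
  have hmemu := P.reg.lt_of_le_sdeg hη (P.left.le_sdeg t ht htn)
  have hmemv := P.reg.lt_of_le_sdeg hη (P.right.le_sdeg t ht htn)
  have hu : u ∈ Finset.Icc 1 t := Finset.mem_Icc.mpr (by omega)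
  have hv : v ∈ Finset.Icc 1 t := Finset.mem_Icc.mpr (by omega)
  have hsub : M.ballOfVolume (node s v) V' ⊆
      M.ballOfVolume (node s u) (M.sphereVol s u t) := by
    refine M.ballOfVolume_subset_of_radius
      (M.lt_one_of_lt_boundaryDist hm P.right.region hV'0.le hV'lt) fun _ => ?_
    rw [P.radius_left hm ht htn,
      M.radius_eq_of_lt_boundaryDist hm P.right.region hV'0.le hV'lt]
    have e1 := log_root hm (div_pos hVu hcm)
    have e2 := log_root hm (div_pos hVun hcm)
    have e3 := log_root hm (div_pos hVvn hcm)
    have e4 := log_root hm (div_pos hV'0 hcm)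
    rw [Real.log_div hVu.ne' hcm.ne'] at e1
    rw [Real.log_div hVun.ne' hcm.ne'] at e2
    rw [Real.log_div hVvn.ne' hcm.ne'] at e3
    rw [Real.log_div hV'0.ne' hcm.ne', hV', Real.log_mul hVv.ne' (Real.exp_pos _).ne',
      Real.log_exp, ← hV'] at e4
    set ru := (M.sphereVol s u t / M.unitBallVolume) ^ (1 / (m : ℝ))
    set Ru := (M.sphereVol s u n / M.unitBallVolume) ^ (1 / (m : ℝ))
    set Rv := (M.sphereVol s v n / M.unitBallVolume) ^ (1 / (m : ℝ))
    set r' := (V' / M.unitBallVolume) ^ (1 / (m : ℝ))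
    have hru : 0 < ru := Real.rpow_pos_of_pos (by positivity) _
    have hRu : 0 < Ru := Real.rpow_pos_of_pos (by positivity) _
    have hRv : 0 < Rv := Real.rpow_pos_of_pos (by positivity) _
    have hr' : 0 < r' := Real.rpow_pos_of_pos (by positivity) _
    set q := (1 - a) * (Real.log n - Real.log t) / m with hq
    have hmq : m * q = (1 - a) * (Real.log n - Real.log t) := by
      rw [hq]; field_simp
    have hq8 : 8 * η ≤ q := by
      rw [hq, le_div_iff₀ (by linarith)]
      linarith
    have h1 := (abs_le.mp (P.left.log_vol_last t ht htn)).1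
    have h2 := (abs_le.mp (P.right.log_vol_last t ht htn)).2
    have hmη : η ≤ m * η := le_mul_of_one_le_left hη.le hm1
    have f1 : Real.log Ru + q - 2 * η ≤ Real.log ru := by
      have : (m : ℝ) * (Real.log Ru + q - 2 * η) ≤ m * Real.log ru := by linarith
      exact le_of_mul_le_mul_left this (by linarith)
    have f2 : Real.log r' ≤ Real.log Rv + q - 8 * η := by
      have : (m : ℝ) * Real.log r' ≤ m * (Real.log Rv + q - 8 * η) := by linarith
      exact le_of_mul_le_mul_left this (by linarith)
    have g1 : Ru * Real.exp q * Real.exp (-(2 * η)) ≤ ru := by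
      rw [← Real.log_le_log_iff (by positivity) hru, Real.log_mul (by positivity) (by positivity),
        Real.log_mul hRu.ne' (by positivity), Real.log_exp, Real.log_exp]
      linarith
    have g2 : r' * Real.exp (8 * η) ≤ Rv * Real.exp q := by
      rw [← Real.log_le_log_iff (by positivity) (by positivity),
        Real.log_mul (by positivity) (by positivity),
        Real.log_mul hRv.ne' (by positivity), Real.log_exp, Real.log_exp]
      linarith
    set S := Real.exp q
    have hS : 1 + 8 * η ≤ S := by
      have := Real.add_one_le_exp q
      linarith
    exact add_le_of_mul_exp_le hη hη1 hRv hr' (by linarith) hd hS g1 g2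
  have hsub2 : M.ballOfVolume (node s v) V' ⊆
      M.ballOfVolume (node s u) (M.sphereVol s u t) ∩
        M.ballOfVolume (node s v) (M.sphereVol s v t) :=
    Set.subset_inter hsub (M.ballOfVolume_mono hm _ hV'0.le hV'le)
  rw [M.linkProb_pair s P.ne hu hv, M.linkProb_single s hv,
    M.ballProb_eq_of_lt_boundaryDist hm P.right.region hVv.le hVlt]
  have h1 : M.ballProb (node s v) V' ≤ _ := measureReal_mono (μ := M.positionLaw) hsub2
  rw [M.ballProb_eq_of_lt_boundaryDist hm P.right.region hV'0.le hV'lt] at h1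
  calc _ = M.p ^ 2 * (M.ρ ℓ * V') := by rw [hV']; ring
    _ ≤ _ := by
      gcongr

end NodePair

end SPAModel

/-! ### Pairs at small distance -/

namespace SPAModel

variable {m κ : ℕ} {M : SPAModel m κ}

theorem exp_le_one_add_two_mul {x : ℝ} (hx : 0 ≤ x) (hx1 : x ≤ 1 / 2) :
    Real.exp x ≤ 1 + 2 * x := by
  have h1 := Real.add_one_le_exp (-x)
  have h2 : Real.exp x * Real.exp (-x) = 1 := by rw [← Real.exp_add]; simp
  have h3 := Real.exp_pos x
  have h4 : Real.exp x * (1 - x) ≤ 1 := by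
    rw [← h2]
    exact mul_le_mul_of_nonneg_left (by linarith) h3.le
  nlinarith

namespace NodePair

variable {s : Outcome m} {n : ℕ} {w N η a lθ : ℝ} {ℓ : Fin m → Fin κ} {u v T : ℕ}

theorem sdeg_right_le (P : M.NodePair s n ℓ u v T w N η a lθ) :
    M.sdeg s v T ≤ Real.exp (|a * lθ| + 1) * w := by
  have hw := P.reg.w_pos P.eta_pos
  rw [← Real.log_le_log_iff (M.sdeg_pos s v T) (by positivity),
    Real.log_mul (Real.exp_pos _).ne' hw.ne', Real.log_exp]
  have := P.log_sdeg_right_le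
  have := le_abs_self (a * lθ)
  have := P.eta_le
  linarith

/-- Links before `T` number `O(η j)` because `w ≤ η j`, and those in the final window of logarithmic
length `O(η)` number `O(η j)` as well. In between nearly all of the sphere of `v` is covered by that
of `u`, so a fraction of about `p` of the links to `v` is shared. -/
theorem abs_commonNbrs_sub_le_of_dist_le (P : M.NodePair s n ℓ u v T w N η a lθ) (hm : 0 < m)
    (hd : M.torusDist (node s u) (node s v) ≤
      (M.sphereVol s u n / M.unitBallVolume) ^ (1 / (m : ℝ)) -
      (M.sphereVol s v n / M.unitBallVolume) ^ (1 / (m : ℝ))) :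
    |(M.commonNbrs s u v n : ℝ) - M.p * M.degIn s v n| ≤
      (8 * m / (1 - a) + 3 * (8 * m + 2) + Real.exp (|a * lθ| + 1) + 12) * η *
        M.degIn s v n := by
  have ha : 0 < 1 - a := by linarith [P.a_lt_one]
  have ha0 := P.a_pos
  have hη := P.eta_pos
  have hη1 := P.eta_le
  have hp := M.p_pos
  have hp1 := M.p_lt_one
  have hw := P.reg.w_pos hη
  have hT0 : (0 : ℝ) < T := by exact_mod_cast P.one_le
  have hn0 : (0 : ℝ) < n := by exact_mod_cast P.reg.n_pos
  set j : ℝ := ((M.degIn s v n : ℕ) : ℝ) with hj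
  have hj0 : 0 < j := P.right.deg_pos
  set W := Real.exp (|a * lθ| + 1) with hW
  set Q : ℝ := 8 * m + 2 with hQ
  have hQ0 : 0 < Q := by positivity
  set b := 8 * m * η / (1 - a) with hb
  have hb0 : 0 ≤ b := by positivity
  have hwj : w ≤ η * j := P.w_le
  have hηj : η * j ≤ 1 / 20 * j := mul_le_mul_of_nonneg_right hη1 hj0.le
  have hηj0 : 0 < η * j := by positivity
  have hDT : M.sdeg s v T ≤ W * (η * j) := P.sdeg_right_le.trans (by gcongr)
  have hDT0 := M.sdeg_pos s v T
  have hDn : M.sdeg s v n ≤ (1 + 6 * η) * j := by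
    have h1 := P.sdeg_le P.le le_rfl (L := 3 * η + Real.log j) (by linarith)
    rw [Real.exp_add, Real.exp_log hj0] at h1
    have h2 := exp_le_one_add_two_mul (x := 3 * η) (by linarith) (by linarith)
    have := mul_le_mul_of_nonneg_right h2 hj0.le
    linarith
  have hDn2 : M.sdeg s v n + w ≤ 2 * j := by linarith
  have hcnT : (M.commonNbrs s u v T : ℝ) ≤ M.sdeg s v T := by
    refine (M.commonNbrs_le_degIn s u v T).trans ?_
    unfold sdeg
    linarith [div_pos M.A₂_pos M.A₁_pos]
  have hcnT0 : (0 : ℝ) ≤ M.commonNbrs s u v T := Nat.cast_nonneg _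
  have hpair := fun t h1 h2 => P.reg.pair u P.left.mem v P.right.mem T t h1 h2
  have hsing := fun t h1 h2 => P.reg.pair v P.right.mem v P.right.mem T t h1 h2
  simp only [Finset.pair_eq_singleton] at hsing
  have hupper : (M.commonNbrs s u v n : ℝ) - M.p * j ≤ (W + 10) * (η * j) := by
    have h1 := (abs_le.mp (hpair n P.le le_rfl)).2
    have h2 := (abs_le.mp (hsing n P.le le_rfl)).1
    rw [M.sum_linkInd_pair s u v P.le] at h1
    rw [M.sum_linkInd_single s v P.le] at h2
    have h3 : ∑ τ ∈ Finset.Ico T n, M.linkProb {u, v} τ s ≤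
        M.p * ∑ τ ∈ Finset.Ico T n, M.linkProb {v} τ s := by
      rw [Finset.mul_sum]
      exact Finset.sum_le_sum fun τ _ => M.linkProb_pair_le s P.ne
    have h4 : M.p * ∑ τ ∈ Finset.Ico T n, M.linkProb {v} τ s ≤
        M.p * (M.sdeg s v n + η * (M.sdeg s v n + w)) := by
      gcongr
      linarith
    have h5 := mul_le_mul_of_nonneg_left hDn2 hη.le
    have h6 : M.p * (M.sdeg s v n + η * (M.sdeg s v n + w)) ≤
        M.p * j + 1 * (6 * (η * j) + 2 * (η * j)) := by
      have h7 : M.p * (M.sdeg s v n + η * (M.sdeg s v n + w)) ≤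
          M.p * (j + (6 * (η * j) + 2 * (η * j))) :=
        mul_le_mul_of_nonneg_left (by linarith) hp.le
      have h8 : M.p * (6 * (η * j) + 2 * (η * j)) ≤ 1 * (6 * (η * j) + 2 * (η * j)) := by
        gcongr
      linarith
    linarith
  have hlower : M.p * j - (M.commonNbrs s u v n : ℝ) ≤
      (8 * m / (1 - a) + 3 * Q + W + 12) * (η * j) := by
    -- Stopping the lower estimate at `exp X` leaves the radii enough room to grow backwards for
    -- `le_linkProb_pair`; the links after it are discarded.
    set X := Real.log n - b with hX
    set t₁ := max T ⌊Real.exp X⌋₊ with ht₁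
    have hXn : Real.exp X ≤ n := by
      rw [← Real.le_log_iff_exp_le hn0]
      linarith
    have ht₁n : t₁ ≤ n := max_le P.le (Nat.floor_le_of_le hXn)
    have hTt₁ : T ≤ t₁ := le_max_left _ _
    have ht₁0 : (0 : ℝ) < t₁ := by exact_mod_cast P.one_le.trans hTt₁
    have hlogt₁ : X - η ≤ Real.log t₁ := by
      have h1 : Real.exp X < ⌊Real.exp X⌋₊ + 1 := Nat.lt_floor_add_one _
      have h2 : ((⌊Real.exp X⌋₊ : ℕ) : ℝ) ≤ t₁ := by exact_mod_cast le_max_right _ _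
      have h3 : 1 ≤ η * t₁ := by
        have := P.inv_le hTt₁
        rwa [div_le_iff₀ ht₁0] at this
      rw [sub_le_iff_le_add, ← Real.exp_le_exp, Real.exp_add, Real.exp_log ht₁0]
      have h4 := mul_le_mul_of_nonneg_left (Real.add_one_le_exp η) ht₁0.le
      linarith
    have hstep : ∀ τ ∈ Finset.Ico T t₁, M.p * Real.exp (-(Q * η)) * M.linkProb {v} τ s ≤
        M.linkProb {u, v} τ s := by
      intro τ hτ
      rw [Finset.mem_Ico] at hτ
      refine P.le_linkProb_pair hm hd hτ.1 (by omega) ?_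
      have h1 : τ ≤ ⌊Real.exp X⌋₊ := by
        rcases lt_max_iff.mp hτ.2 with h | h
        · omega
        · exact h.le
      have h2 : (τ : ℝ) ≤ Real.exp X :=
        (Nat.cast_le.mpr h1).trans (Nat.floor_le (Real.exp_pos X).le)
      have h3 : Real.log τ ≤ X :=
        (Real.log_le_iff_le_exp (by exact_mod_cast P.one_le.trans hτ.1)).mpr h2
      calc 8 * m * η = (1 - a) * b := by rw [hb]; field_simp
        _ ≤ _ := mul_le_mul_of_nonneg_left (by linarith) ha.le
    set P₁ := ∑ τ ∈ Finset.Ico T t₁, M.linkProb {v} τ s with hP₁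
    have h1 := (abs_le.mp (hpair t₁ hTt₁ ht₁n)).1
    have h2 := abs_le.mp (hsing t₁ hTt₁ ht₁n)
    rw [M.sum_linkInd_pair s u v hTt₁] at h1
    rw [M.sum_linkInd_single s v hTt₁, ← hP₁] at h2
    have h3 : M.p * Real.exp (-(Q * η)) * P₁ ≤ ∑ τ ∈ Finset.Ico T t₁, M.linkProb {u, v} τ s := by
      rw [hP₁, Finset.mul_sum]
      exact Finset.sum_le_sum hstep
    have hmono := M.sdeg_mono s v ht₁n
    have h4 : η * (M.sdeg s v t₁ + w) ≤ 2 * (η * j) := by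
      calc η * (M.sdeg s v t₁ + w) ≤ η * (2 * j) := by gcongr; linarith
        _ = _ := by ring
    have hP0 : 0 ≤ P₁ := Finset.sum_nonneg fun τ _ => measureReal_nonneg
    have hP3 : P₁ ≤ 3 * j := by linarith
    have h5 : M.p * P₁ - 3 * Q * (η * j) ≤ M.p * Real.exp (-(Q * η)) * P₁ := by
      have h6 := Real.add_one_le_exp (-(Q * η))
      have h7 : M.p * P₁ * (1 - Q * η) ≤ M.p * P₁ * Real.exp (-(Q * η)) := by
        gcongr
        linarith
      have h8 : M.p * P₁ ≤ 1 * (3 * j) := mul_le_mul hp1.le hP3 hP0 zero_le_one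
      have h9 := mul_le_mul_of_nonneg_right h8 (by positivity : 0 ≤ Q * η)
      linarith
    have hD1 : j * (1 - b - 4 * η) ≤ M.sdeg s v t₁ := by
      have h6 : Real.exp (-(b + 4 * η) + Real.log j) ≤ M.sdeg s v t₁ := by
        refine P.le_sdeg hTt₁ ht₁n ?_
        have h7 := mul_le_mul_of_nonneg_left hlogt₁ ha0.le
        have h8 : a * (b + η) ≤ 1 * (b + η) :=
          mul_le_mul_of_nonneg_right P.a_lt_one.le (by positivity)
        linarith
      rw [Real.exp_add, Real.exp_log hj0] at h6
      have h7 := mul_le_mul_of_nonneg_right (Real.add_one_le_exp (-(b + 4 * η))) hj0.le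
      linarith
    have h6 : M.p * (j * (1 - b - 4 * η) - W * (η * j) - 2 * (η * j)) ≤ M.p * P₁ := by
      gcongr
      linarith
    have h7 : M.p * (j * b + (6 + W) * (η * j)) ≤ 1 * (j * b + (6 + W) * (η * j)) := by
      have : 0 < W := Real.exp_pos _
      gcongr
    have h8 : (M.commonNbrs s u v t₁ : ℝ) ≤ M.commonNbrs s u v n := by
      exact_mod_cast M.commonNbrs_mono s u v ht₁n
    have h9 : j * b = 8 * m / (1 - a) * (η * j) := by rw [hb]; ring
    linarith
  have h0 : 0 ≤ (8 * m / (1 - a) + 3 * Q) * (η * j) := by positivity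
  have h0' : 0 ≤ (8 * m / (1 - a) + 3 * Q + W + 12) * (η * j) := by
    have : 0 < W := Real.exp_pos _
    positivity
  rw [abs_le]
  constructor <;> linarith

end NodePair

end SPAModel

/-! ### Pairs at intermediate distance -/

namespace SPAModel

variable {m κ : ℕ} {M : SPAModel m κ}

/-- The number of common neighbours of a node pair at an intermediate distance is about
`p * G`, where `G` is the in-degree of `v` at the time when the sphere of `u` ceases to contain
the sphere of `v`. -/
theorem exists_abs_commonNbrs_sub_le (hm : 0 < m) {ℓ : Fin m → Fin κ} (hρ : 0 < M.ρ ℓ) {c₁ a : ℝ}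
    (hc₁ : 0 < c₁) (ha0 : 0 < a) (ha1 : a < 1) (lθ : ℝ) : ∃ K y₀ : ℝ, 0 < K ∧ 0 < y₀ ∧
    ∀ ψ : ℝ, 0 < ψ → ∃ η₀ : ℝ, 0 < η₀ ∧
    ∀ {s : Outcome m} {n u v T : ℕ} {w N η y L : ℝ}, M.NodePair s n ℓ u v T w N η a lθ →
    η ≤ η₀ → 0 < M.torusDist (node s u) (node s v) → 0 < y → y ≤ y₀ →
    m * Real.log y = Real.log (M.degIn s v n) - Real.log (M.degIn s u n) →
    (1 - a) * L = Real.log M.A₁ + Real.log (M.degIn s u n) - Real.log M.unitBallVolume -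
      a * Real.log n - m * Real.log (M.torusDist (node s u) (node s v)) →
    (M.sphereVol s u n / M.unitBallVolume) ^ (1 / (m : ℝ)) -
      (M.sphereVol s v n / M.unitBallVolume) ^ (1 / (m : ℝ)) <
      M.torusDist (node s u) (node s v) →
    c₁ ≤ (1 - a) * (L - Real.log T) →
    |(M.commonNbrs s u v n : ℝ) -
      M.p * Real.exp (Real.log (M.degIn s v n) - a * Real.log n + a * L)| ≤
      K * (ψ + y) * Real.exp (Real.log (M.degIn s v n) - a * Real.log n + a * L) := by
  have ha : 0 < 1 - a := by linarith
  have hm0 : (0 : ℝ) < m := by exact_mod_cast hm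
  have hp := M.p_pos
  have hp1 := M.p_lt_one
  obtain ⟨x₁, hx₁⟩ := M.exists_early_subset hm hρ (half_pos hc₁) a lθ
  set W := Real.exp (|a * lθ| + 1) with hW
  have hW0 : 0 < W := Real.exp_pos _
  -- The constant collects the coefficients of `y`, `η` and `ψ` in the final error. The entries of
  -- `y₀` ensure in turn that `k / j` is large enough for the early phase, that `4y ≤ 1`, that the
  -- transition window fits between `T` and `exp L`, and that it is short.
  refine ⟨20 * m / (1 - a) + (15 / (1 - a) + 24 + 2 * W) + 4 * W,
    min (Real.exp (-x₁ / m)) (min (1 / 4) (min (c₁ / (8 * m)) ((1 - a) / (16 * m)))),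
    by positivity, by positivity, fun ψ₀ hψ₀ => ?_⟩
  -- Shrinking `ψ` guarantees that `v` reaches the degree `ψ w` no later than `T`.
  obtain ⟨ψ, hψ, hψψ, hψW⟩ : ∃ ψ : ℝ, 0 < ψ ∧ ψ ≤ ψ₀ ∧ ψ ≤ Real.exp (-(|a * lθ| + 1)) :=
    ⟨min ψ₀ (Real.exp (-(|a * lθ| + 1))), by positivity, min_le_left _ _, min_le_right _ _⟩
  obtain ⟨η₁, hη₁, hearly⟩ := hx₁ ψ hψ
  refine ⟨min η₁ (min ψ (min (c₁ / 10) (min (1 / 50) ((1 - a) / 50)))), by positivity, ?_⟩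
  intro s n u v T w N η y L P hη₀ hd hy hy₀ hlogy hL hlo hLT
  simp only [le_min_iff] at hη₀ hy₀
  obtain ⟨hη1, hηψ, hηc, hη50, hηa⟩ := hη₀
  obtain ⟨hyx, hy4, hyc, hya⟩ := hy₀
  have hη := P.eta_pos
  have hw := P.reg.w_pos hη
  rw [le_div_iff₀ (by positivity)] at hyc hya
  have hT0 : (0 : ℝ) < T := by exact_mod_cast P.one_le
  have hn0 : (0 : ℝ) < n := by exact_mod_cast P.reg.n_pos
  set G := Real.exp (Real.log (M.degIn s v n) - a * Real.log n + a * L) with hG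
  have hG0 : 0 < G := Real.exp_pos _
  -- Half the logarithmic length of the window about `L` in which the spheres overlap only partly.
  set b := (4 * m * y + 3 * η) / (1 - a) with hb
  have hb' : (1 - a) * b = 3 * η + 4 * m * y := by
    rw [hb, mul_div_cancel₀ _ ha.ne']
    ring
  have hb0 : 0 ≤ b := by positivity
  have hb4 : b ≤ 1 / 3 := by
    rw [hb, div_le_iff₀ ha]
    linarith
  set z := b + 4 * η with hz
  have hz0 : 0 ≤ z := by positivity
  have hz2 : z ≤ 1 / 2 := by linarith
  have hXT : Real.log T ≤ L - b := by
    have : (1 - a) * Real.log T ≤ (1 - a) * (L - b) := by linarith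
    exact le_of_mul_le_mul_left this ha
  -- Otherwise the sphere of `v` would be contained in that of `u` at time `n`, contradicting the
  -- lower bound on the distance.
  have hXn : L - b ≤ Real.log n := by
    by_contra hcon
    have h1 : (1 - a) * b ≤ (1 - a) * (L - Real.log n) := by
      refine mul_le_mul_of_nonneg_left ?_ ha.le
      linarith
    have := P.add_radius_le hm hd hy (by linarith) hlogy hL P.le le_rfl (by linarith)
    linarith
  set X := L - b with hX
  -- the time until which the sphere of `v` is contained in the sphere of `u`
  set ta := ⌊Real.exp X⌋₊ with hta
  have hTta : T ≤ ta := Nat.le_floor ((Real.log_le_iff_le_exp hT0).mp hXT)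
  have htan : ta ≤ n := Nat.floor_le_of_le ((Real.le_log_iff_exp_le hn0).mp hXn)
  have hta0 : (0 : ℝ) < ta := by exact_mod_cast P.one_le.trans hTta
  have hlogta : Real.log ta ≤ X :=
    (Real.log_le_iff_le_exp hta0).mpr (Nat.floor_le (Real.exp_pos X).le)
  have hlogta' : X - η ≤ Real.log ta := by
    have h1 : Real.exp X < ta + 1 := Nat.lt_floor_add_one _
    have h3 : 1 ≤ η * ta := by
      have := P.inv_le hTta
      rwa [div_le_iff₀ hta0] at this
    rw [sub_le_iff_le_add, ← Real.exp_le_exp, Real.exp_add, Real.exp_log hta0]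
    have h4 := mul_le_mul_of_nonneg_left (Real.add_one_le_exp η) hta0.le
    linarith
  have hexpz : ∀ x : ℝ, x ≤ z → Real.exp x * G ≤ (1 + 2 * z) * G := fun x hx =>
    mul_le_mul_of_nonneg_right
      ((Real.exp_le_exp.mpr hx).trans (exp_le_one_add_two_mul hz0 hz2)) hG0.le
  have hab : a * (b + η) ≤ b + η := mul_le_of_le_one_left (by positivity) ha1.le
  have hab0 : 0 ≤ a * b := by positivity
  have hDta : M.sdeg s v ta ≤ (1 + 2 * z) * G := by
    refine le_trans ?_ (hexpz z le_rfl)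
    rw [hG, ← Real.exp_add]
    refine P.sdeg_le hTta htan ?_
    have := mul_le_mul_of_nonneg_left hlogta ha0.le
    linarith
  have hDta' : (1 - z) * G ≤ M.sdeg s v ta := by
    have h1 : Real.exp (-z) * G ≤ M.sdeg s v ta := by
      rw [hG, ← Real.exp_add]
      refine P.le_sdeg hTta htan ?_
      have := mul_le_mul_of_nonneg_left hlogta' ha0.le
      linarith
    have h2 := mul_le_mul_of_nonneg_right (Real.add_one_le_exp (-z)) hG0.le
    linarith
  -- the time after which the spheres are disjoint
  obtain ⟨tb, hTtb, htbn, hcn, hlogtb⟩ := P.exists_commonNbrs_eq hm hd hy hlogy hL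
  have hlogtb' : Real.log tb ≤ L + b + η := by
    refine hlogtb.trans (max_le (by linarith) ?_)
    rw [hb, add_comm (4 * m * y)]
  have hDtb : M.sdeg s v tb ≤ (1 + 2 * z) * G := by
    refine le_trans ?_ (hexpz z le_rfl)
    rw [hG, ← Real.exp_add]
    refine P.sdeg_le hTtb htbn ?_
    have := mul_le_mul_of_nonneg_left hlogtb' ha0.le
    linarith
  have hcnle : (M.commonNbrs s u v n : ℝ) - M.commonNbrs s u v ta ≤ 3 * z * G := by
    rcases le_total ta tb with h | h
    · have := M.commonNbrs_sub_le s u v h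
      rw [hcn]
      linarith
    · have h1 : (M.commonNbrs s u v tb : ℝ) ≤ M.commonNbrs s u v ta := by
        exact_mod_cast M.commonNbrs_mono s u v h
      rw [hcn]
      have : 0 ≤ 3 * z * G := by positivity
      linarith
  have hcnge : (M.commonNbrs s u v ta : ℝ) ≤ M.commonNbrs s u v n := by
    exact_mod_cast M.commonNbrs_mono s u v htan
  -- the early phase
  have hwG : w ≤ W * G := by
    rw [← Real.log_le_log_iff hw (by positivity), Real.log_mul hW0.ne' hG0.ne', hW, hG,
      Real.log_exp, Real.log_exp]
    have h1 := P.le_log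
    have h2 := mul_le_mul_of_nonneg_left (hXT.trans (by linarith : X ≤ L)) ha0.le
    have h3 := neg_abs_le (a * lθ)
    linarith
  have hψT : ψ * w ≤ M.sdeg s v T := by
    have h1 : Real.exp (-(|a * lθ| + 1) + Real.log w) ≤ M.sdeg s v T := by
      refine P.le_sdeg le_rfl P.le ?_
      have h1 := P.le_log
      have h3 := neg_abs_le (a * lθ)
      linarith
    rw [Real.exp_add, Real.exp_log hw] at h1
    exact (mul_le_mul_of_nonneg_right hψW hw.le).trans h1
  have hex : ∃ t, ψ * w ≤ M.sdeg s v t := ⟨T, hψT⟩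
  classical
  obtain ⟨t₀, ht₀, ht₀min⟩ : ∃ t, ψ * w ≤ M.sdeg s v t ∧ ∀ z, z < t → ¬ ψ * w ≤ M.sdeg s v z :=
    ⟨Nat.find hex, Nat.find_spec hex, fun z => Nat.find_min hex⟩
  have ht₀T : t₀ ≤ T := by
    by_contra hcon
    exact ht₀min T (by omega) hψT
  -- Makes the overshoot at the first passage above `ψ w` harmless, also if that passage occurs at
  -- time zero, where the shifted degree is `A₂ / A₁`.
  have hone : 1 + M.A₂ / M.A₁ ≤ ψ * w := by
    have h1 := P.reg.le_N
    have h2 := P.reg.N_le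
    have h3 : 0 < (1 + 1 / M.A₁) / η := by
      have := M.A₁_pos
      positivity
    have h4 := mul_le_mul_of_nonneg_right hηψ hw.le
    linarith
  have hDt₀ : M.sdeg s v t₀ ≤ 2 * (ψ * w) := by
    rcases Nat.eq_zero_or_pos t₀ with rfl | h
    · have : M.sdeg s v 0 = M.A₂ / M.A₁ := by simp [sdeg, degIn, inDeg, edges]
      rw [this]
      linarith
    · have h1 := not_le.mp (ht₀min (t₀ - 1) (by omega))
      have h2 := (P.reg.path v P.right.mem).step (t₀ - 1)
      rw [Nat.sub_add_cancel h] at h2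
      have := div_pos M.A₂_pos M.A₁_pos
      linarith
  have hcnt₀ : (M.commonNbrs s u v t₀ : ℝ) ≤ M.sdeg s v t₀ := by
    refine (M.commonNbrs_le_degIn s u v t₀).trans ?_
    unfold sdeg
    linarith [div_pos M.A₂_pos M.A₁_pos]
  have hx : x₁ ≤ Real.log (M.degIn s u n) - Real.log (M.degIn s v n) := by
    have h1 := (Real.log_le_iff_le_exp hy).mpr hyx
    rw [le_div_iff₀ hm0] at h1
    linarith
  have hD : 2 * (c₁ / 2) - 5 * η ≤ Real.log (M.sphereVol s u T) - (Real.log M.unitBallVolume +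
      m * Real.log (M.torusDist (node s u) (node s v))) := by
    have := (abs_le.mp (P.left.log_vol T le_rfl P.le)).1
    linarith
  have hE := hearly P hη1 hd hD hx
  have hcont : ∀ τ, t₀ ≤ τ → τ < ta → M.ballOfVolume (node s v) (M.sphereVol s v τ) ⊆
      M.ballOfVolume (node s u) (M.sphereVol s u τ) := by
    intro τ h1 h2
    rcases le_total τ T with h | h
    · exact (hE τ h (ht₀.trans (M.sdeg_mono s v h1))).2.2
    · have hτn : τ ≤ n := by omega
      have hτ1 := P.one_le.trans h
      refine M.ballOfVolume_subset_of_radius (M.lt_one_of_lt_boundaryDist hm P.right.region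
        (M.sphereVol_pos s v hτ1).le (P.right.vol_lt τ h hτn)) fun _ => ?_
      rw [P.radius_left hm h hτn, P.radius_right hm h hτn]
      refine P.add_radius_le hm hd hy (by linarith) hlogy hL h hτn ?_
      have h3 : Real.log τ ≤ Real.log ta :=
        Real.log_le_log (by exact_mod_cast hτ1) (by exact_mod_cast h2.le)
      rw [← hb']
      exact mul_le_mul_of_nonneg_left (by linarith) ha.le
  have hmain := abs_le.mp (P.reg.abs_commonNbrs_sub_le hη P.ne P.left.mem P.right.mem
    (ht₀T.trans hTta) htan (hE t₀ ht₀T ht₀).1 (hE t₀ ht₀T ht₀).2.1 hcont)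
  have hDt₀pos := M.sdeg_pos s v t₀
  have hcnt₀' : (0 : ℝ) ≤ M.commonNbrs s u v t₀ := Nat.cast_nonneg _
  have e1 : ψ * w ≤ ψ * (W * G) := mul_le_mul_of_nonneg_left hwG hψ.le
  have e2 : 2 * η * (M.sdeg s v ta + w) ≤ 2 * η * (2 * G + W * G) := by
    have : (1 + 2 * z) * G ≤ 2 * G := mul_le_mul_of_nonneg_right (by linarith) hG0.le
    refine mul_le_mul_of_nonneg_left ?_ (by positivity)
    linarith
  have e3 : |M.p * (M.sdeg s v ta - M.sdeg s v t₀ - G)| ≤ 2 * z * G + 2 * (ψ * w) := by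
    rw [abs_mul, abs_of_pos hp]
    refine (mul_le_of_le_one_left (abs_nonneg _) hp1.le).trans ?_
    have := mul_nonneg hz0 hG0.le
    rw [abs_le]
    constructor <;> linarith
  rw [abs_le] at e3
  have e4 : z = 4 * m / (1 - a) * y + (3 / (1 - a) + 4) * η := by
    rw [hz, hb]
    ring
  have e5 : 5 * z * G + 2 * η * (2 * G + W * G) + 4 * (ψ * (W * G)) =
      (20 * m / (1 - a) * y + (15 / (1 - a) + 24 + 2 * W) * η + 4 * W * ψ) * G := by
    rw [e4]
    ring
  have e6 : (20 * m / (1 - a) * y + (15 / (1 - a) + 24 + 2 * W) * η + 4 * W * ψ) * G ≤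
      (20 * m / (1 - a) + (15 / (1 - a) + 24 + 2 * W) + 4 * W) * (ψ₀ + y) * G := by
    refine mul_le_mul_of_nonneg_right ?_ hG0.le
    have k1 : 20 * m / (1 - a) * y ≤ 20 * m / (1 - a) * (ψ₀ + y) := by
      gcongr
      linarith
    have k2 : (15 / (1 - a) + 24 + 2 * W) * η ≤ (15 / (1 - a) + 24 + 2 * W) * (ψ₀ + y) := by
      gcongr
      linarith
    have k3 : 4 * W * ψ ≤ 4 * W * (ψ₀ + y) := by
      gcongr
      linarith
    linarith
  refine le_trans ?_ (e5.trans_le e6)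
  have e7 := mul_nonneg hz0 hG0.le
  rw [abs_le]
  constructor <;> linarith

end SPAModel

/-! ### The claim for a single pair of nodes -/

namespace SPAModel

variable {m κ : ℕ} {M : SPAModel m κ}

/-- The conclusion about a single pair of nodes, with constant `K`, error `δ` and scale `w`. -/
def PairClaim (M : SPAModel m κ) (ε K δ w : ℝ) (s : Outcome m) (n u v : ℕ)
    (ℓ : Fin m → Fin κ) : Prop :=
  let k : ℝ := M.degIn s u n
  let j : ℝ := M.degIn s v n
  let cn : ℝ := M.commonNbrs s u v n
  let d : ℝ := M.torusDist (node s u) (node s v)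
  let cm : ℝ := M.unitBallVolume
  let a : ℝ := M.p * M.ρ ℓ * M.A₁
  let T : ℝ := n * (w / j) ^ (1 / a)
  let c : ℝ := (1 + ε) * (M.A₁ / (cm * (n : ℝ) ^ a * T ^ (1 - a)))
  let α : ℝ := a / (1 - a)
  let C : ℝ := M.p * M.A₁ ^ α * cm ^ (-α)
  let lo : ℝ := ((M.A₁ * k + M.A₂) / (cm * n)) ^ (1 / (m : ℝ))
    - ((M.A₁ * j + M.A₂) / (cm * n)) ^ (1 / (m : ℝ))
  let hi : ℝ := ε * (w * (k / j) / T) ^ (1 / (m : ℝ))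
  let main : ℝ := C * j * (n : ℝ) ^ (-α) * k ^ α * d ^ (-((m : ℝ) * α))
  j ≤ k →
  c * j ≤ M.boundaryDist ℓ (node s v) ^ m →
  c * k ≤ M.boundaryDist ℓ (node s u) ^ m →
  (hi ≤ d → cn ≤ K * w) ∧
  (d ≤ lo → |cn - M.p * j| ≤ δ * (M.p * j)) ∧
  (ε ^ m * cm < (1 + ε) * M.A₁ → lo < d → d < hi →
    |cn - main| ≤ (δ + K * (j / k) ^ (1 / (m : ℝ))) * main)

theorem sphereVol_div_unitBallVolume (s : Outcome m) (v n : ℕ) :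
    M.sphereVol s v n / M.unitBallVolume =
      (M.A₁ * M.degIn s v n + M.A₂) / (M.unitBallVolume * n) := by
  have := M.A₁_pos
  unfold sphereVol sdeg
  rw [div_div, mul_add, mul_div_cancel₀ _ M.A₁_pos.ne', mul_comm (n : ℝ)]

/-- The hypothesis on the boundary in logarithmic form: at time `T` the extrapolated volume lies
below the volume of the largest ball in the cube by the factor `1 + ε`. -/
theorem log_volume_of_le_boundaryDist {ε a n T k cm δ A : ℝ} (hε : 0 < ε) (hn : 0 < n) (hT : 0 < T)
    (hk : 0 < k) (hcm : 0 < cm) (hA : 0 < A)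
    (h : (1 + ε) * (A / (cm * n ^ a * T ^ (1 - a))) * k ≤ δ) :
    0 < cm * δ ∧ Real.log (1 + ε) + Real.log A + Real.log k - a * Real.log n -
      (1 - a) * Real.log T ≤ Real.log (cm * δ) := by
  have hna : 0 < n ^ a := Real.rpow_pos_of_pos hn _
  have hTa : 0 < T ^ (1 - a) := Real.rpow_pos_of_pos hT _
  have h0 : 0 < (1 + ε) * (A / (cm * n ^ a * T ^ (1 - a))) * k := by positivity
  have hδ : 0 < δ := h0.trans_le h
  refine ⟨by positivity, ?_⟩
  have h1 : Real.log ((1 + ε) * (A / (cm * n ^ a * T ^ (1 - a))) * k) =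
      Real.log (1 + ε) + (Real.log A - (Real.log cm + a * Real.log n + (1 - a) * Real.log T)) +
        Real.log k := by
    rw [Real.log_mul (by positivity) (by positivity), Real.log_mul (by positivity) (by positivity),
      Real.log_div (by positivity) (by positivity), Real.log_mul (by positivity) (by positivity),
      Real.log_mul (by positivity) (by positivity), Real.log_rpow hn, Real.log_rpow hT]
  rw [Real.log_mul hcm.ne' hδ.ne']
  have h2 := Real.log_le_log h0 h
  rw [h1] at h2
  linarith

/-- Identifies the main term with `p` times the extrapolated degree of `v` at time `exp L`.
Eliminating `L` is what produces the exponent `α = a / (1 - a)`. -/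
theorem main_eq_exp {a α p A cm j n k d L μ : ℝ} (ha1 : a < 1) (hα : α = a / (1 - a))
    (hA : 0 < A) (hcm : 0 < cm) (hj : 0 < j) (hn : 0 < n) (hk : 0 < k) (hd : 0 < d)
    (hL : (1 - a) * L = Real.log A + Real.log k - Real.log cm - a * Real.log n -
      μ * Real.log d) :
    p * A ^ α * cm ^ (-α) * j * n ^ (-α) * k ^ α * d ^ (-(μ * α)) =
      p * Real.exp (Real.log j - a * Real.log n + a * L) := by
  have ha : 0 < 1 - a := by linarith
  have hα1 : α * (1 - a) = a := by rw [hα, div_mul_cancel₀ _ ha.ne']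
  have e : Real.log j - a * Real.log n + a * L = Real.log A * α + Real.log cm * (-α) + Real.log j +
      Real.log n * (-α) + Real.log k * α + Real.log d * (-(μ * α)) := by
    have h1 : a * L = α * ((1 - a) * L) := by rw [← mul_assoc, hα1]
    rw [h1, hL]
    have h2 : α * (a * Real.log n) = α * Real.log n - a * Real.log n := by
      have h3 : α * a = α - a := by linarith
      linear_combination (Real.log n) * h3
    linear_combination -h2
  rw [e]
  simp only [Real.exp_add, Real.rpow_def_of_pos hA, Real.rpow_def_of_pos hcm,
    Real.rpow_def_of_pos hn, Real.rpow_def_of_pos hk, Real.rpow_def_of_pos hd, Real.exp_log hj]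
  ring

/-- The deterministic part of the theorem: on regular outcomes, the claim holds for all pairs of
nodes of a region of positive density. -/
theorem exists_pairClaim (hm : 0 < m) (M : SPAModel m κ) {ε : ℝ} (hε : 0 < ε)
    {ℓ : Fin m → Fin κ} (hρ : 0 < M.ρ ℓ) : ∃ K : ℝ, 0 ≤ K ∧ ∀ δ : ℝ, 0 < δ → ∃ η : ℝ, 0 < η ∧
    ∀ (s : Outcome m) (n : ℕ) (w N : ℝ), M.Regular s n w N η →
    ∀ u ∈ Finset.Icc 1 n, ∀ v ∈ Finset.Icc 1 n, u ≠ v → node s u ∈ region ℓ →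
    node s v ∈ region ℓ → w ≤ η * M.degIn s v n → M.PairClaim ε K δ w s n u v ℓ := by
  have hcm := M.unitBallVolume_pos
  have hA := M.A₁_pos
  have hA₂ := M.A₂_pos
  have hp := M.p_pos
  have hp1 := M.p_lt_one
  have hm0 : (0 : ℝ) < m := by exact_mod_cast hm
  obtain ⟨a, ha⟩ : ∃ a, a = M.p * M.ρ ℓ * M.A₁ := ⟨_, rfl⟩
  have ha0 : 0 < a := by rw [ha]; positivity
  have ha1 : a < 1 := by
    rw [ha]
    linarith [M.subcritical ℓ]
  have ha1' : 0 < 1 - a := by linarith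
  set lε := Real.log (1 + ε) with hlε
  have hlε0 : 0 < lε := Real.log_pos (by linarith)
  set D₀ := m * Real.log ε with hD₀
  set Λ := lε + Real.log M.A₁ - Real.log M.unitBallVolume - D₀ with hΛ
  -- The sign of `Λ` encodes the smallness condition on `ε` in the third case. When it is positive,
  -- `c₁` also separates `exp L` from the starting time of the power laws.
  obtain ⟨c₁, hc₁, hcε, hcΛ⟩ : ∃ c₁ : ℝ, 0 < c₁ ∧ 4 * c₁ ≤ lε ∧ (0 < Λ → 4 * c₁ ≤ Λ) := by
    rcases lt_or_ge 0 Λ with h | h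
    · exact ⟨min lε Λ / 4, by positivity, by linarith [min_le_left lε Λ],
        fun _ => by linarith [min_le_right lε Λ]⟩
    · exact ⟨lε / 4, by positivity, by linarith, fun h' => absurd h' (not_lt.mpr h)⟩
  set lθ := (2 * c₁ - lε) / (1 - a) with hlθdef
  have hlθ : (1 - a) * lθ = 2 * c₁ - lε := mul_div_cancel₀ _ ha1'.ne'
  obtain ⟨K₃, y₀, hK₃, hy₀, hfine⟩ := M.exists_abs_commonNbrs_sub_le hm hρ hc₁ ha0 ha1 lθ
  set K₁ := Real.exp (a * ((|Real.log M.A₁ - Real.log M.unitBallVolume - D₀| / (1 - a) + |lθ| +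
    1 / a) + (1 + 4 * m) / (1 - a) + 1) + 1) with hK₁
  have hK₁0 : 0 < K₁ := Real.exp_pos _
  set C₂ := 8 * m / (1 - a) + 3 * (8 * m + 2) + Real.exp (|a * lθ| + 1) + 12 with hC₂
  have hC₂0 : 0 < C₂ := by positivity
  -- The three summands serve large distances, intermediate distances with `j / k` small, and
  -- intermediate distances with `j / k` bounded below.
  refine ⟨K₁ + K₃ / M.p + (K₁ + M.p) / (M.p * y₀), by positivity, fun δ hδ => ?_⟩
  obtain ⟨η₀, hη₀, hfine⟩ := hfine (δ * M.p / K₃) (by positivity)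
  obtain ⟨η, hη, g1, g2, g3, g4, g5, g6⟩ : ∃ η : ℝ, 0 < η ∧ η ≤ 1 / 20 ∧ η ≤ c₁ / 6 ∧
      η ≤ Real.exp (a * lθ - c₁) ∧ η ≤ η₀ ∧ η ≤ δ * M.p / C₂ ∧ η ≤ a * c₁ / 2 :=
    ⟨min (1 / 20) (min (c₁ / 6) (min (Real.exp (a * lθ - c₁)) (min η₀
      (min (δ * M.p / C₂) (a * c₁ / 2))))), by positivity, by simp, by simp, by simp, by simp,
      by simp, by simp⟩
  refine ⟨η, hη, fun s n w N hS u hu v hv huv hru hrv hwj => ?_⟩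
  have hw := hS.w_pos hη
  have hn0 : (0 : ℝ) < n := by exact_mod_cast hS.n_pos
  have hlo : ∀ x, ((M.A₁ * M.degIn s x n + M.A₂) / (M.unitBallVolume * n)) ^ (1 / (m : ℝ)) =
      (M.sphereVol s x n / M.unitBallVolume) ^ (1 / (m : ℝ)) := fun x => by
    rw [M.sphereVol_div_unitBallVolume]
  unfold PairClaim
  intro k j cn d cm a' T c α C lo hi main hjk hcv hcu
  have hj0 : 0 < j := (mul_pos_iff_of_pos_left hη).mp (hw.trans_le hwj)
  have hk0 : 0 < k := hj0.trans_le hjk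
  have haa : a' = a := ha.symm
  have hT0 : 0 < T := by
    have : 0 < (w / j) ^ (1 / a') := Real.rpow_pos_of_pos (by positivity) _
    positivity
  have hlogT : Real.log T = Real.log n + 1 / a * (Real.log w - Real.log j) := by
    change Real.log (n * (w / j) ^ (1 / a')) = _
    rw [haa, Real.log_mul hn0.ne' (Real.rpow_pos_of_pos (by positivity) _).ne',
      Real.log_rpow (by positivity), Real.log_div hw.ne' hj0.ne']
  have haT : a * Real.log T = a * Real.log n + Real.log w - Real.log j := by
    rw [hlogT]
    field_simp
    ring
  have hBv := log_volume_of_le_boundaryDist hε hn0 hT0 hj0 hcm hA hcv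
  have hBu := log_volume_of_le_boundaryDist hε hn0 hT0 hk0 hcm hA hcu
  rw [haa] at hBv hBu
  obtain ⟨T₀, P⟩ := hS.exists_nodePair hm hη g1 huv hu hru hv hrv ha ha0 ha1
    (by linarith : 2 * c₁ ≤ lε) hlθ (by linarith)
    (by linarith [(Real.log_le_iff_le_exp hη).mpr g3]) hwj hjk hlogT hBu.1 hBv.1 hBu.2 hBv.2
  set y := (j / k) ^ (1 / (m : ℝ)) with hy
  have hy0 : 0 < y := Real.rpow_pos_of_pos (by positivity) _
  have hy1 : y ≤ 1 := Real.rpow_le_one (by positivity) ((div_le_one hk0).mpr hjk) (by positivity)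
  have hlogy : m * Real.log y = Real.log j - Real.log k := by
    rw [hy, NodePair.log_root hm (by positivity), Real.log_div hj0.ne' hk0.ne']
  have hhi0 : 0 < hi := mul_pos hε (Real.rpow_pos_of_pos (by positivity) _)
  have hloghi : m * Real.log hi = D₀ + Real.log w + Real.log k - Real.log j - Real.log T := by
    change m * Real.log (ε * (w * (k / j) / T) ^ (1 / (m : ℝ))) = _
    rw [Real.log_mul hε.ne' (Real.rpow_pos_of_pos (by positivity) _).ne', mul_add,
      NodePair.log_root hm (by positivity), Real.log_div (by positivity) hT0.ne',
      Real.log_mul hw.ne' (by positivity), Real.log_div hk0.ne' hj0.ne']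
    ring
  have hcn0 : 0 ≤ cn := Nat.cast_nonneg _
  refine ⟨fun hd => ?_, fun hd => ?_, fun hεm hd hd' => ?_⟩
  · have hd0 := hhi0.trans_le hd
    have h1 := P.commonNbrs_le_mul hm hd0 hy0 hy1 hlogy haT (D₀ := D₀) (by
      have := mul_le_mul_of_nonneg_left (Real.log_le_log hhi0 hd) hm0.le
      linarith)
    refine h1.trans (mul_le_mul_of_nonneg_right ?_ hw.le)
    have : 0 ≤ K₃ / M.p + (K₁ + M.p) / (M.p * y₀) := by positivity
    linarith
  · have h1 := P.abs_commonNbrs_sub_le_of_dist_le hm (by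
      rw [← hlo, ← hlo]
      exact hd)
    refine h1.trans ?_
    rw [le_div_iff₀ hC₂0] at g5
    calc C₂ * η * j ≤ δ * M.p * j := by
          refine mul_le_mul_of_nonneg_right ?_ hj0.le
          linarith
      _ = _ := by ring
  · have hlo0 : 0 ≤ lo := by
      refine sub_nonneg.mpr (Real.rpow_le_rpow (by positivity) ?_ (by positivity))
      gcongr
    have hd0 : 0 < d := hlo0.trans_lt hd
    have hlogd : m * Real.log d ≤ D₀ + Real.log w + Real.log k - Real.log j - Real.log T := by
      rw [← hloghi]
      exact mul_le_mul_of_nonneg_left (Real.log_le_log hd0 hd'.le) hm0.le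
    obtain ⟨L, hL⟩ : ∃ L, (1 - a) * L = Real.log M.A₁ + Real.log k -
        Real.log M.unitBallVolume - a * Real.log n - m * Real.log d :=
      ⟨_, mul_div_cancel₀ _ ha1'.ne'⟩
    have hmain : main = M.p * Real.exp (Real.log j - a * Real.log n + a * L) :=
      main_eq_exp ha1 (by change a' / (1 - a') = _; rw [haa]) hA hcm hj0 hn0 hk0 hd0 hL
    set G := Real.exp (Real.log j - a * Real.log n + a * L) with hG
    have hG0 : 0 < G := Real.exp_pos _
    rw [hmain]
    -- For `y > y₀` the allowed relative error `K y` exceeds a constant, so the bound of order `G`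
    -- on both quantities is enough.
    rcases le_or_gt y y₀ with hyy | hyy
    · have hΛ0 : 0 < Λ := by
        have h1 := Real.log_lt_log (by positivity) hεm
        rw [Real.log_mul (by positivity) hcm.ne', Real.log_pow,
          Real.log_mul (by positivity) hA.ne'] at h1
        linarith
      have h4 := hcΛ hΛ0
      have hLT : c₁ ≤ (1 - a) * (L - Real.log T₀) := by
        have h5 : Real.log T₀ ≤ lθ + Real.log T + c₁ := by
          have h6 : a * Real.log T₀ ≤ a * (lθ + Real.log T + c₁) := by linarith [P.log_le]
          exact le_of_mul_le_mul_left h6 ha0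
        have h7 := mul_le_mul_of_nonneg_left h5 ha1'.le
        have h8 := mul_pos ha0 hc₁
        linarith
      have h1 := hfine P g4 hd0 hy0 hyy hlogy hL (by rw [← hlo, ← hlo]; exact hd) hLT
      refine h1.trans ?_
      have h2 : K₃ * (δ * M.p / K₃ + y) * G = (δ + K₃ / M.p * y) * (M.p * G) := by
        field_simp
      refine h2.trans_le ?_
      gcongr
      have : 0 ≤ K₁ + (K₁ + M.p) / (M.p * y₀) := by positivity
      linarith
    · have h1 := P.commonNbrs_le_mul_exp hm hd0 hy0 hy1 hlogy haT hlogd hL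
      have h2 : |cn - M.p * G| ≤ (K₁ + M.p) * G := by
        have : 0 < M.p * G := by positivity
        have : 0 < K₁ * G := by positivity
        change cn ≤ K₁ * G at h1
        rw [abs_le]
        constructor <;> linarith
      refine h2.trans ?_
      have h3 : (K₁ + M.p) * G = (K₁ + M.p) / (M.p * y₀) * y₀ * (M.p * G) := by
        field_simp
      rw [h3]
      refine mul_le_mul_of_nonneg_right ?_ (by positivity)
      have h4 : (K₁ + M.p) / (M.p * y₀) * y₀ ≤ (K₁ + M.p) / (M.p * y₀) * y := by gcongr
      have h5 : 0 ≤ (K₁ + K₃ / M.p) * y := by positivity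
      linarith

end SPAModel

/-! ### Passage to probabilities and to the limit -/

namespace SPAModel

variable {m κ : ℕ} {M : SPAModel m κ}

theorem sdeg_succ_le (s : Outcome m) (v t : ℕ) : M.sdeg s v (t + 1) ≤ M.sdeg s v t + 1 := by
  have h : M.degIn s v (t + 1) ≤ M.degIn s v t + 1 := by
    rw [M.degIn_succ]
    split_ifs <;> omega
  have h' : (M.degIn s v (t + 1) : ℝ) ≤ M.degIn s v t + 1 := by exact_mod_cast h
  unfold sdeg
  linarith

/-- With `lam = 1 / x` and `N = x² log n`, the three errors in the growth of log degrees are at most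
`4/x`, `4/x` and `2/x`, whence the condition `10 ≤ η x`. The scale `w = x² N` is larger than `N` by
a factor tending to infinity with `x`. -/
theorem Good.regular {s : Outcome m} {n : ℕ} {x η : ℝ} (hG : M.Good n (1 / x) s) (hη : 0 < η)
    (hn : 1 ≤ n) (hlog : 1 ≤ Real.log n) (hx1 : 1 ≤ x) (h1 : 10 ≤ η * x)
    (h2 : (1 + 1 / M.A₁) / η + M.A₂ / M.A₁ + 1 ≤ x) :
    M.Regular s n (x ^ 4 * Real.log n) (x ^ 2 * Real.log n) η := by
  have hx0 : 0 < x := by linarith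
  have hxx : x ≤ x ^ 2 := le_self_pow₀ hx1 two_ne_zero
  have hx3 : x ≤ x ^ 3 := le_self_pow₀ hx1 three_ne_zero
  have hl : 0 < 1 / x := by positivity
  have hA := M.A₁_pos
  have hA₂ := M.A₂_pos
  have hβ : 0 < M.A₂ / M.A₁ := by positivity
  have hxN : x ≤ x ^ 2 * Real.log n := hxx.trans (le_mul_of_one_le_right (by positivity) hlog)
  have hη0 : 0 < (1 + 1 / M.A₁) / η := by positivity
  refine ⟨hn, fun v hv => ⟨M.sdeg_pos s v, M.sdeg_mono s v, M.sdeg_succ_le s v, ?_⟩, ?_,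
    h2.trans hxN, ?_⟩
  · intro t₀ t₁ ht ht₁ hN
    have hdeg : 0 < M.degIn s v t₀ := by
      unfold sdeg at hN
      have : (0 : ℝ) < M.degIn s v t₀ := by linarith
      exact_mod_cast this
    refine (Good.growth M hG hl hv ht ht₁ (by linarith) hdeg).trans ?_
    have hD := M.sdeg_pos s v t₀
    have e1 : 4 * Real.log n / (1 / x * M.sdeg s v t₀) ≤ 4 / x := by
      rw [div_le_div_iff₀ (by positivity) hx0]
      calc 4 * Real.log n * x = 4 * (1 / x * (x ^ 2 * Real.log n)) := by field_simp
        _ ≤ _ := by gcongr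
    have e2 : 2 / M.sdeg s v t₀ ≤ 2 / x := by
      gcongr
      linarith
    have e3 : 10 / x ≤ η := by rwa [div_le_iff₀ hx0]
    have e4 : 4 * (1 / x) + 4 / x + 2 / x = 10 / x := by ring
    linarith
  · intro u hu v hv t₀ t₁ ht ht₁
    refine (Good.pair M hG hl hu hv ht ht₁).trans ?_
    have hD := M.sdeg_pos s v t₁
    rw [mul_add]
    have e1 : 2 * (1 / x) ≤ η := by
      rw [mul_one_div, div_le_iff₀ hx0]
      linarith
    have e2 : 5 * Real.log n / (1 / x) ≤ η * (x ^ 4 * Real.log n) := by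
      have e3 : 5 * x ≤ η * x * x ^ 3 := by
        calc 5 * x ≤ 10 * x ^ 3 := by linarith
          _ ≤ _ := by gcongr
      rw [div_div_eq_mul_div, div_one]
      calc 5 * Real.log n * x = 5 * x * Real.log n := by ring
        _ ≤ η * x * x ^ 3 * Real.log n := by gcongr
        _ = _ := by ring
    gcongr
  · have e1 : x ^ 2 * Real.log n + 1 ≤ 2 * (x ^ 2 * Real.log n) := by linarith
    have e2 : 2 ≤ η * x ^ 2 := by
      have := mul_le_mul_of_nonneg_left hxx hη.le
      linarith
    calc _ ≤ 2 * (x ^ 2 * Real.log n) := e1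
      _ ≤ η * x ^ 2 * (x ^ 2 * Real.log n) := by gcongr
      _ = _ := by ring

theorem PairClaim.mono {ε K K' δ δ' w : ℝ} {s : Outcome m} {n u v : ℕ} {ℓ : Fin m → Fin κ}
    (h : M.PairClaim ε K δ w s n u v ℓ) (hw : 0 ≤ w) (hK : K ≤ K') (hδ : δ ≤ δ') :
    M.PairClaim ε K' δ' w s n u v ℓ := by
  unfold PairClaim at h ⊢
  intro k j cn d cm a T c α C lo hi main hjk hcv hcu
  obtain ⟨h1, h2, h3⟩ := h hjk hcv hcu
  have hp := M.p_pos
  have hA := M.A₁_pos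
  have hcm : 0 < cm := M.unitBallVolume_pos
  have hj : 0 ≤ j := Nat.cast_nonneg _
  have hk : 0 ≤ k := Nat.cast_nonneg _
  have hd : 0 ≤ d := M.torusDist_nonneg _ _
  have hC : 0 ≤ C := by positivity
  have hmain : 0 ≤ main := by positivity
  refine ⟨fun hd => (h1 hd).trans (mul_le_mul_of_nonneg_right hK hw),
    fun hd => (h2 hd).trans (mul_le_mul_of_nonneg_right hδ (by positivity)),
    fun e hd hd' => (h3 e hd hd').trans (mul_le_mul_of_nonneg_right ?_ hmain)⟩
  gcongr

/-- A property which holds eventually for every fixed error holds eventually with an error that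
tends to zero. -/
theorem exists_tendsto_zero_of_forall_eventually {Q : ℕ → ℝ → Prop}
    (h : ∀ δ : ℝ, 0 < δ → ∀ᶠ n in atTop, Q n δ) :
    ∃ η : ℕ → ℝ, Tendsto η atTop (𝓝 0) ∧ ∀ᶠ n in atTop, Q n (η n) := by
  have h' : ∀ i : ℕ, ∃ N : ℕ, ∀ n, N ≤ n → Q n (1 / ((i : ℝ) + 1)) := fun i =>
    eventually_atTop.mp (h _ Nat.one_div_pos_of_nat)
  choose N hN using h'
  classical
  -- A diagonal choice: `f n` is the finest accuracy already valid at `n`, capped at `n` so that the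
  -- maximum exists.
  set f : ℕ → ℕ := fun n => Nat.findGreatest (fun i => N i ≤ n) n with hf
  have hft : Tendsto f atTop atTop := by
    refine tendsto_atTop.mpr fun i => ?_
    filter_upwards [eventually_ge_atTop (N i), eventually_ge_atTop i] with n h1 h2
    exact Nat.le_findGreatest h2 h1
  refine ⟨fun n => 1 / ((f n : ℝ) + 1), tendsto_one_div_add_atTop_nhds_zero_nat.comp hft, ?_⟩
  filter_upwards [eventually_ge_atTop (N 0)] with n hn
  exact hN (f n) n (Nat.findGreatest_spec (P := fun i => N i ≤ n) (Nat.zero_le n) hn)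

theorem law_node_mem_region_eq_zero {ℓ : Fin m → Fin κ} (hρ : M.ρ ℓ = 0) (t : ℕ) :
    M.law {s | node s t ∈ region ℓ} = 0 := by
  have h0 : M.positionLaw (region ℓ) = 0 := by
    have := M.real_positionLaw_of_subset (measurableSet_region ℓ) (le_refl (region ℓ))
    rw [hρ, zero_mul, measureReal_eq_zero_iff] at this
    exact this
  have h1 := measurePreserving_eval_infinitePi
    (fun _ : ℕ => M.positionLaw.prod (Measure.infinitePi fun _ : ℕ => M.coinLaw)) t
  have h2 : MeasurableSet (Prod.fst ⁻¹' region ℓ : Set ((Fin m → ℝ) × (ℕ → Bool))) :=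
    measurable_fst (measurableSet_region ℓ)
  have h3 := h1.measure_preimage h2.nullMeasurableSet
  have h4 : (M.positionLaw.prod (Measure.infinitePi fun _ : ℕ => M.coinLaw))
      (Prod.fst ⁻¹' region ℓ) = 0 := by
    rw [← Set.prod_univ, Measure.prod_prod, h0, zero_mul]
  rw [h4] at h3
  exact h3

theorem law_exists_node_mem_region_eq_zero :
    M.law {s | ∃ t, ∃ ℓ, M.ρ ℓ = 0 ∧ node s t ∈ region ℓ} = 0 := by
  have : {s : Outcome m | ∃ t, ∃ ℓ, M.ρ ℓ = 0 ∧ node s t ∈ region ℓ} =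
      ⋃ t : ℕ, ⋃ ℓ : Fin m → Fin κ, {s | M.ρ ℓ = 0 ∧ node s t ∈ region ℓ} := by
    ext s
    simp
  rw [this]
  refine measure_iUnion_null fun t => measure_iUnion_null fun ℓ => ?_
  by_cases h : M.ρ ℓ = 0
  · simpa [h] using M.law_node_mem_region_eq_zero h t
  · simp [h]

/-- The sets `S n` are not assumed measurable: the whole space is covered by `S n` and a set of
small measure, and countable subadditivity holds for arbitrary sets. Positions in regions of density
zero form a null set. -/
theorem tendsto_law_of_eventually_good {x : ℕ → ℝ} (hx : Tendsto x atTop atTop)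
    {S : ℕ → Set (Outcome m)}
    (hS : ∀ᶠ n in atTop, ∀ s, M.Good n (1 / x n) s →
      (∀ t ℓ, node s t ∈ region ℓ → 0 < M.ρ ℓ) → s ∈ S n) :
    Tendsto (fun n => M.law (S n)) atTop (𝓝 1) := by
  have hlim : Tendsto (fun n : ℕ => 1 - ENNReal.ofReal (16 / n)) atTop (𝓝 1) := by
    have h1 : Tendsto (fun n : ℕ => ENNReal.ofReal (16 / n)) atTop (𝓝 0) := by
      rw [← ENNReal.ofReal_zero]
      exact ENNReal.tendsto_ofReal (tendsto_const_div_atTop_nhds_zero_nat 16)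
    simpa using ENNReal.Tendsto.sub tendsto_const_nhds h1 (Or.inl ENNReal.one_ne_top)
  refine tendsto_of_tendsto_of_tendsto_of_le_of_le' hlim tendsto_const_nhds ?_
    (Eventually.of_forall fun n => prob_le_one)
  filter_upwards [hS, eventually_ge_atTop 1, hx.eventually_ge_atTop 2] with n hn hn1 hxn
  have hx0 : 0 < x n := by linarith
  set B := {s : Outcome m | ∃ t, ∃ ℓ, M.ρ ℓ = 0 ∧ node s t ∈ region ℓ}
  have hcover : Set.univ ⊆ S n ∪ ({s | ¬ M.Good n (1 / x n) s} ∪ B) := by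
    intro s _
    by_cases h1 : M.Good n (1 / x n) s
    · by_cases h2 : s ∈ B
      · exact Or.inr (Or.inr h2)
      · refine Or.inl (hn s h1 fun t ℓ hmem => ?_)
        refine lt_of_le_of_ne (M.ρ_nonneg ℓ) fun h => h2 ⟨t, ℓ, h.symm, hmem⟩
    · exact Or.inr (Or.inl h1)
  have h1 := (measure_mono (μ := M.law) hcover).trans (measure_union_le _ _)
  have h2 : M.law ({s | ¬ M.Good n (1 / x n) s} ∪ B) ≤ ENNReal.ofReal (16 / n) := by
    refine (measure_union_le _ _).trans ?_
    rw [M.law_exists_node_mem_region_eq_zero, add_zero]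
    refine M.law_not_good_le hn1 (by positivity) ?_
    rw [div_le_div_iff₀ hx0 two_pos]
    linarith
  rw [measure_univ] at h1
  exact tsub_le_iff_right.mpr (h1.trans (by gcongr))

end SPAModel

end

theorem theorem4 {m κ : ℕ} (hm : 0 < m) (M : SPAModel m κ) (ε : ℝ) (hε : 0 < ε) :
    ∃ K : ℝ, ∀ ω : ℕ → ℝ, Tendsto ω atTop atTop →
      ∃ η : ℕ → ℝ, Tendsto η atTop (𝓝 0) ∧
        Tendsto (fun n : ℕ => M.law {s : SPAModel.Outcome m |
          ∀ u ∈ Finset.Icc 1 n, ∀ v ∈ Finset.Icc 1 n, u ≠ v →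
          ∀ ℓ : Fin m → Fin κ,
          SPAModel.node s u ∈ SPAModel.region ℓ → SPAModel.node s v ∈ SPAModel.region ℓ →
          let k : ℝ := M.degIn s u n
          let j : ℝ := M.degIn s v n
          let cn : ℝ := M.commonNbrs s u v n
          let d : ℝ := M.torusDist (SPAModel.node s u) (SPAModel.node s v)
          let cm : ℝ := M.unitBallVolume
          let a : ℝ := M.p * M.ρ ℓ * M.A₁
          let T : ℝ := n * (ω n * Real.log n / j) ^ (1 / a)
          let c : ℝ := (1 + ε) * (M.A₁ / (cm * (n : ℝ) ^ a * T ^ (1 - a)))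
          let α : ℝ := a / (1 - a)
          let C : ℝ := M.p * M.A₁ ^ α * cm ^ (-α)
          let lo : ℝ := ((M.A₁ * k + M.A₂) / (cm * n)) ^ (1 / (m : ℝ))
            - ((M.A₁ * j + M.A₂) / (cm * n)) ^ (1 / (m : ℝ))
          let hi : ℝ := ε * (ω n * Real.log n * (k / j) / T) ^ (1 / (m : ℝ))
          let main : ℝ := C * j * (n : ℝ) ^ (-α) * k ^ α * d ^ (-((m : ℝ) * α))
          j ≤ k → ω n ^ 2 * Real.log n ≤ j →
          c * j ≤ M.boundaryDist ℓ (SPAModel.node s v) ^ m →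
          c * k ≤ M.boundaryDist ℓ (SPAModel.node s u) ^ m →
          (hi ≤ d → cn ≤ K * (ω n * Real.log n)) ∧
          (d ≤ lo → |cn - M.p * j| ≤ η n * (M.p * j)) ∧
          (ε ^ m * cm < (1 + ε) * M.A₁ → lo < d → d < hi →
            |cn - main| ≤ (η n + K * (j / k) ^ (1 / (m : ℝ))) * main)})
          atTop (𝓝 1) 
    := by
  classical
  -- Each region of positive density has its own constant; the sum of absolute values over the
  -- finitely many regions dominates them all and does not depend on `ω`.
  choose! K hK0 hK using fun (ℓ : Fin m → Fin κ) (h : 0 < M.ρ ℓ) =>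
    SPAModel.exists_pairClaim hm M hε h
  have hKsum : ∀ ℓ, 0 < M.ρ ℓ → K ℓ ≤ ∑ ℓ', |K ℓ'| := fun ℓ _ =>
    (le_abs_self _).trans (Finset.single_le_sum (f := fun ℓ' => |K ℓ'|)
      (fun _ _ => abs_nonneg _) (Finset.mem_univ ℓ))
  refine ⟨∑ ℓ, |K ℓ|, fun ω hω => ?_⟩
  -- The fourth root makes the scale `x⁴ log n` of `Good.regular` equal to `ω log n`.
  set x : ℕ → ℝ := fun n => ω n ^ (1 / 4 : ℝ) with hx
  have hxt : Tendsto x atTop atTop := (tendsto_rpow_atTop (by norm_num)).comp hω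
  have hlog : Tendsto (fun n : ℕ => Real.log n) atTop atTop :=
    Real.tendsto_log_atTop.comp tendsto_natCast_atTop_atTop
  have hev : ∀ δ : ℝ, 0 < δ → ∀ᶠ n : ℕ in atTop, ∀ s, M.Good n (1 / x n) s →
      (∀ t ℓ, SPAModel.node s t ∈ SPAModel.region ℓ → 0 < M.ρ ℓ) →
      ∀ u ∈ Finset.Icc 1 n, ∀ v ∈ Finset.Icc 1 n, u ≠ v → ∀ ℓ : Fin m → Fin κ,
      SPAModel.node s u ∈ SPAModel.region ℓ → SPAModel.node s v ∈ SPAModel.region ℓ →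
      ω n ^ 2 * Real.log n ≤ M.degIn s v n →
      M.PairClaim ε (∑ ℓ, |K ℓ|) δ (ω n * Real.log n) s n u v ℓ := by
    intro δ hδ
    have h1 : ∀ ℓ : Fin m → Fin κ, ∀ᶠ n : ℕ in atTop, 0 < M.ρ ℓ → ∀ s, M.Good n (1 / x n) s →
        ∀ u ∈ Finset.Icc 1 n, ∀ v ∈ Finset.Icc 1 n, u ≠ v →
        SPAModel.node s u ∈ SPAModel.region ℓ → SPAModel.node s v ∈ SPAModel.region ℓ →
        ω n ^ 2 * Real.log n ≤ M.degIn s v n →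
        M.PairClaim ε (∑ ℓ, |K ℓ|) δ (ω n * Real.log n) s n u v ℓ := by
      intro ℓ
      by_cases hρ : 0 < M.ρ ℓ
      · obtain ⟨η, hη, h⟩ := hK ℓ hρ δ hδ
        filter_upwards [eventually_ge_atTop 1, hlog.eventually_ge_atTop 1,
          hxt.eventually_ge_atTop 1, hxt.eventually_ge_atTop (10 / η),
          hxt.eventually_ge_atTop ((1 + 1 / M.A₁) / η + M.A₂ / M.A₁ + 1),
          hω.eventually_ge_atTop 1, hω.eventually_ge_atTop (1 / η)] with
          n g1 g2 g3 g4 g5 g6 g7 _ s hG u hu v hv huv hru hrv hdeg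
        have hω0 : 0 < ω n := by linarith
        rw [div_le_iff₀' hη] at g4 g7
        have hx4 : x n ^ 4 = ω n := by
          rw [hx]
          simp only
          rw [← Real.rpow_natCast, ← Real.rpow_mul hω0.le]
          norm_num
        have hS := hG.regular hη g1 g2 g3 g4 g5
        rw [hx4] at hS
        refine (h s n _ _ hS u hu v hv huv hru hrv ?_).mono (by positivity) (hKsum ℓ hρ) le_rfl
        -- The hypothesis `j ≥ ω² log n` exceeds the scale `w` by the factor `ω`, which is
        -- eventually larger than `1 / η`.
        calc ω n * Real.log n = 1 * (ω n * Real.log n) := (one_mul _).symm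
          _ ≤ η * ω n * (ω n * Real.log n) := by gcongr
          _ = η * (ω n ^ 2 * Real.log n) := by ring
          _ ≤ _ := by gcongr
      · exact Eventually.of_forall fun n h => absurd h hρ
    filter_upwards [eventually_all.mpr h1] with n hn s hG hpos u hu v hv huv ℓ hru hrv hdeg
    exact hn ℓ (hpos u ℓ hru) s hG u hu v hv huv hru hrv hdeg
  obtain ⟨η, hη, hQ⟩ := SPAModel.exists_tendsto_zero_of_forall_eventually hev
  refine ⟨η, hη, SPAModel.tendsto_law_of_eventually_good hxt ?_⟩
  filter_upwards [hQ] with n hn s hG hpos u hu v hv huv ℓ hru hrv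
  intro k j cn d cm a T c α C lo hi main hjk hdeg hcv hcu
  exact hn s hG hpos u hu v hv huv ℓ hru hrv hdeg hjk hcv hcu
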